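/- Let $n\ge 1$, $d\ge 0$, let $f:\mathbb R^n\times\mathbb R^d\to\mathbb R^n$ and $\Lambda:\mathbb R\to\mathbb R^d$ be $C^1$, and suppose that $\Lambda(\tau)\to\lambda^\pm$ as $\tau\to\pm\infty$ and that, for some $\rho>0$, the limits $\lim_{\tau\to\pm\infty}\Lambda'(\tau)/e^{\mp\rho\tau}$ exist. The future and past limit systems are $\dot x=f(x,\lambda^+)$ and $\dot x=f(x,\lambda^-)$. For $r>0$ and $0<\alpha<\rho$ the compactified system is $$x'=f(x,\Lambda_\alpha(s))/r,\qquad s'=\alpha(1-s^2)/2$$ on the extended phase space $\mathbb R^n\times[-1,1]$, where $\Lambda_\alpha(s)=\Lambda\big(\tfrac1\alpha\ln\tfrac{1+s}{1-s}\big)$ for $|s|<1$ and $\Lambda_\alpha(\pm1)=\lambda^\pm$. Put $S^\pm=\mathbb R^n\times\{\pm1\}$. Jacobians at points of $S^\pm$ are taken within the extended phase space. An equilibrium is hyperbolic if the vector field is differentiable there and no eigenvalue of the Jacobian is purely imaginary or zero; it is a sink if all eigenvalues have negative real part, and a saddle if there are eigenvalues with negative and with positive real part. A leading eigenvalue is one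 of largest real part; a leading eigenvector is one that belongs to a real, algebraically simple eigenvalue $\mu$ such that all other eigenvalues have real part $<\mu$. A regular threshold of an autonomous system on $\mathbb R^n$ is a codimension-one embedded orientable forward-invariant $C^1$ manifold $\theta$ that is normally hyperbolic and repelling: along each trajectory in $\theta$ defined for all forward time there are $\beta>0$ and $a<\beta$ such that, for the variational equation, normal components grow at least like $e^{\beta t}$ and tangent vectors grow at most like $e^{at}$ (up to constant factors). An equilibrium $\eta$ is a regular edge state if it is hyperbolic and lies in a regular threshold $\theta\subseteq W^s(\eta)$ such that $\{\eta\}$ is an attractor for the flow restricted to $\theta$ (it is the $\omega$-limit set, in $\theta$, of a neighbourhood of itself in $\theta$). Stable and unstable manifolds $W^s$, $W^u$ of an equilibrium are the sets of points with a forward, respectively backward, orbit in the phase space converging to it. Manifolds below are $C^1$ and may be only injectively immersed unless called embedded. Stable manifolds in (b) and the unstable manifold in (c) may have boundary, where they meet the boundary of $\mathbb R^n\times[-1,1]$ transversely. Then, for all $r>0$ and $0<\alpha<\rho$: (a) If $e^+$ is a hyperbolic sink of the future limit system, then $\tilde e^+=(e^+,1)$ is a hyperbolic sink of the compactified system. Its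 additional eigenvector $v_+$, with eigenvalue $-\alpha$, exists and is normal to $S^+$. If moreover $\alpha<-\mathrm{Re}(l_1)/r$, where $l_1$ is the leading eigenvalue of $e^+$ in the future limit system, then $v_+$ is the leading eigenvector of $\tilde e^+$. (b) If $\eta^+$ is an equilibrium regular edge state of the future limit system, then $\tilde\eta^+=(\eta^+,1)$ is a hyperbolic saddle of the compactified system. It has a codimension-one stable manifold $W^s(\tilde\eta^+)$, a codimension-one embedded orientable local stable manifold $W^s_{loc}(\tilde\eta^+)\subseteq W^s(\tilde\eta^+)$ (for some open neighbourhood $U$ of $\tilde\eta^+$, the set of points whose forward orbit stays in $U$ and converges to $\tilde\eta^+$), and a one-dimensional unstable manifold $W^u(\tilde\eta^+)$. Its additional eigenvector, with eigenvalue $-\alpha$, exists and is normal to $S^+$. (c) If $e^-$ is a hyperbolic sink of the past limit system, then $\tilde e^-=(e^-,-1)$ is a hyperbolic saddle of the compactified system with a one-dimensional unstable manifold $W^u(\tilde e^-)$. Its additional eigenvector, with eigenvalue $\alpha$, exists and is normal to $S^-$. -/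

import Mathlib

open Filter Set Topology

noncomputable section

namespace RTip

section General

variable {V : Type*} [NormedAddCommGroup V] [InnerProductSpace ℝ V] [FiniteDimensional ℝ V]

/-! ### Linear stability of equilibria

A vector field `F` is considered on a phase space `X ⊆ V`. The phase spaces in use are the whole
space and a slab (a manifold with boundary), so the Jacobian is the derivative within `X`. -/

/-- The Jacobian at `p` of the vector field `F` on the phase space `X`. -/
def jacobian (F : V → V) (X : Set V) (p : V) : Module.End ℝ V :=
  (fderivWithin ℝ F X p : V →ₗ[ℝ] V)

/-- The multiset of complex eigenvalues of a real endomorphism, counted with algebraic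
multiplicity. -/
def complexEigenvalues (A : Module.End ℝ V) : Multiset ℂ :=
  (A.charpoly.map (algebraMap ℝ ℂ)).roots

/-- `p` is a hyperbolic equilibrium of `F` on `X`. -/
structure IsHyperbolicEquilibrium (F : V → V) (X : Set V) (p : V) : Prop where
  mem : p ∈ X
  equilibrium : F p = 0
  differentiable : DifferentiableWithinAt ℝ F X p
  hyperbolic : ∀ z ∈ complexEigenvalues (jacobian F X p), z.re ≠ 0

/-- A hyperbolic sink: all eigenvalues have negative real part. -/
structure IsHyperbolicSink (F : V → V) (X : Set V) (p : V) : Prop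
    extends IsHyperbolicEquilibrium F X p where
  stable : ∀ z ∈ complexEigenvalues (jacobian F X p), z.re < 0

/-- A hyperbolic saddle: there are both stable and unstable eigenvalues, and no others. -/
structure IsHyperbolicSaddle (F : V → V) (X : Set V) (p : V) : Prop
    extends IsHyperbolicEquilibrium F X p where
  exists_stable : ∃ z ∈ complexEigenvalues (jacobian F X p), z.re < 0
  exists_unstable : ∃ z ∈ complexEigenvalues (jacobian F X p), 0 < z.re

/-- `z` is a leading eigenvalue of `A`: an eigenvalue of largest real part. -/
def IsLeadingEigenvalue (A : Module.End ℝ V) (z : ℂ) : Prop :=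
  z ∈ complexEigenvalues A ∧ ∀ w ∈ complexEigenvalues A, w.re ≤ z.re

/-- `v` is the leading eigenvector of `A` (unique up to scaling): it belongs to a real, simple
eigenvalue, and every other eigenvalue has strictly smaller real part. -/
def IsLeadingEigenvector (A : Module.End ℝ V) (v : V) : Prop :=
  ∃ μ : ℝ, A.HasEigenvector μ v ∧ (complexEigenvalues A).count (μ : ℂ) = 1 ∧
    ∀ z ∈ complexEigenvalues A, z ≠ (μ : ℂ) → z.re < μ

/-- `v` is normal to the affine subspace `S`. -/
def IsNormalTo (v : V) (S : Set V) : Prop :=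
  ∀ p ∈ S, ∀ q ∈ S, inner ℝ v (p - q) = 0

/-! ### Solutions, stable and unstable sets -/

/-- `γ` solves `γ' = F(γ)` on the time interval `I` and stays in the phase space `X`. -/
def IsSolution (F : V → V) (X : Set V) (γ : ℝ → V) (I : Set ℝ) : Prop :=
  ∀ t ∈ I, γ t ∈ X ∧ HasDerivWithinAt γ (F (γ t)) I t

/-- The stable manifold of `p`, as a set: all points whose forward orbit converges to `p`. -/
def stableSet (F : V → V) (X : Set V) (p : V) : Set V :=
  {x | ∃ γ : ℝ → V, IsSolution F X γ (Ici 0) ∧ γ 0 = x ∧ Tendsto γ atTop (𝓝 p)}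

/-- The local stable manifold of `p` in `U`, as a set: all points whose forward orbit stays in `U`
and converges to `p`. -/
def localStableSet (F : V → V) (X U : Set V) (p : V) : Set V :=
  {x | ∃ γ : ℝ → V, IsSolution F X γ (Ici 0) ∧ γ 0 = x ∧ (∀ t ∈ Ici (0 : ℝ), γ t ∈ U) ∧
    Tendsto γ atTop (𝓝 p)}

/-- The unstable manifold of `p`, as a set: all points with a backward orbit converging to `p`. -/
def unstableSet (F : V → V) (X : Set V) (p : V) : Set V :=
  {x | ∃ γ : ℝ → V, IsSolution F X γ (Iic 0) ∧ γ 0 = x ∧ Tendsto γ atBot (𝓝 p)}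

/-! ### Submanifolds -/

/-- `S` is an embedded `k`-dimensional `C¹` submanifold of `X`, where `X` is a subset of `V` with
`C¹` boundary. Around each point of `S` there is a `C¹` chart of `V` which takes `S` to a
`k`-dimensional linear subspace `L`; the chart domain lies in `X`, or else the chart takes `X` to a
half-space that is bounded by a hyperplane transverse to `L` (so that `S` is a manifold with
boundary, whose boundary is its transverse intersection with the boundary of `X`).
For `X = univ` this is an embedded submanifold of `V` without boundary. -/
def IsEmbeddedSubmanifold (X S : Set V) (k : ℕ) : Prop :=
  S ⊆ X ∧ ∀ p ∈ S, ∃ Φ : OpenPartialHomeomorph V V, p ∈ Φ.source ∧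
    ContDiffOn ℝ 1 Φ Φ.source ∧ ContDiffOn ℝ 1 Φ.symm Φ.target ∧
    ∃ L : Submodule ℝ V, Module.finrank ℝ L = k ∧
      (∀ y ∈ Φ.source, y ∈ S ↔ y ∈ X ∧ Φ y ∈ L) ∧
      (Φ.source ⊆ X ∨ ∃ l : V →L[ℝ] ℝ, (∃ y ∈ L, l y ≠ 0) ∧
        ∀ y ∈ Φ.source, y ∈ X ↔ 0 ≤ l (Φ y))

/-- `S` is an injectively immersed `k`-dimensional `C¹` submanifold of `X`: the union of an
increasing sequence of embedded ones. (The images of an exhaustion of the source of an injective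
immersion by relatively compact open sets form such a sequence; conversely the union of such a
sequence, with the direct limit topology, is a manifold whose inclusion is an injective
immersion.) -/
def IsImmersedSubmanifold (X S : Set V) (k : ℕ) : Prop :=
  ∃ T : ℕ → Set V, Monotone T ∧ S = ⋃ i, T i ∧ ∀ i, IsEmbeddedSubmanifold X (T i) k

/-- `ν` is a continuous field of unit vectors normal to `S`. -/
def IsUnitNormalField (S : Set V) (ν : V → V) : Prop :=
  ContinuousOn ν S ∧ ∀ p ∈ S, ‖ν p‖ = 1 ∧ ∀ v ∈ tangentConeAt ℝ S p, inner ℝ (ν p) v = 0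

/-- A codimension-one embedded orientable `C¹` submanifold of `X`. -/
def IsEmbeddedOrientableHypersurface (X S : Set V) : Prop :=
  (∃ k : ℕ, k + 1 = Module.finrank ℝ V ∧ IsEmbeddedSubmanifold X S k) ∧
    ∃ ν : V → V, IsUnitNormalField S ν

/-- A codimension-one (injectively immersed) `C¹` submanifold of `X`. -/
def IsImmersedHypersurface (X S : Set V) : Prop :=
  ∃ k : ℕ, k + 1 = Module.finrank ℝ V ∧ IsImmersedSubmanifold X S k

/-! ### Regular thresholds and regular edge states -/

/-- Solutions of `γ' = F(γ)` that start in `S` stay in `S` for as long as they exist. -/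
def IsForwardInvariant (F : V → V) (S : Set V) : Prop :=
  ∀ (γ : ℝ → V) (T : ℝ), IsSolution F univ γ (Icc 0 T) → γ 0 ∈ S → ∀ t ∈ Icc 0 T, γ t ∈ S

/-- `w` solves the variational equation along `γ` in forward time. -/
def IsVariation (F : V → V) (γ w : ℝ → V) : Prop :=
  ∀ t ∈ Ici (0 : ℝ), HasDerivWithinAt w (fderiv ℝ F (γ t) (w t)) (Ici 0) t

/-- The hypersurface `S` with unit normal field `ν` is normally hyperbolic and repelling: along each
trajectory in `S` the normal component of every perturbation grows at least like `exp (β t)` with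
`β > 0`, and tangential perturbations grow at most like `exp (a t)` with `a < β`. -/
def IsNormallyRepelling (F : V → V) (S : Set V) (ν : V → V) : Prop :=
  ∀ γ : ℝ → V, IsSolution F univ γ (Ici 0) → γ 0 ∈ S →
    ∃ β a c C : ℝ, 0 < β ∧ a < β ∧ 0 < c ∧ ∀ w : ℝ → V, IsVariation F γ w →
      (∀ t ∈ Ici (0 : ℝ), c * Real.exp (β * t) * |inner ℝ (ν (γ 0)) (w 0)|
        ≤ |inner ℝ (ν (γ t)) (w t)|) ∧
      (inner ℝ (ν (γ 0)) (w 0) = 0 →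
        ∀ t ∈ Ici (0 : ℝ), ‖w t‖ ≤ C * Real.exp (a * t) * ‖w 0‖)

/-- A regular threshold of `x' = F(x)` in `V`: a codimension-one embedded orientable
forward-invariant manifold that is normally hyperbolic and repelling. -/
structure IsRegularThreshold (F : V → V) (θ : Set V) : Prop where
  embedded : ∃ k : ℕ, k + 1 = Module.finrank ℝ V ∧ IsEmbeddedSubmanifold univ θ k
  forwardInvariant : IsForwardInvariant F θ
  normallyRepelling : ∃ ν : V → V, IsUnitNormalField θ ν ∧ IsNormallyRepelling F θ ν

/-- The `ω`-limit set of a set `D`. -/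
def omegaLimitSet (F : V → V) (D : Set V) : Set V :=
  ⋂ T ∈ Ioi (0 : ℝ), closure
    {y | ∃ γ : ℝ → V, IsSolution F univ γ (Ici 0) ∧ γ 0 ∈ D ∧ ∃ t : ℝ, T < t ∧ γ t = y}

/-- The equilibrium `η` is a regular edge state of `x' = F(x)` in `V`: it is hyperbolic, and it lies
in a regular threshold `θ` that is contained in its stable manifold, such that `{η}` is an attractor
for the flow restricted to `θ`, that is, `{η}` is the `ω`-limit set (in `θ`) of a neighbourhood of
itself in `θ`. (The minimality in the definition of an attractor is automatic for one point.) -/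
def IsEquilibriumRegularEdgeState (F : V → V) (η : V) : Prop :=
  IsHyperbolicEquilibrium F univ η ∧
  ∃ θ : Set V, IsRegularThreshold F θ ∧ η ∈ θ ∧ θ ⊆ stableSet F univ η ∧
    ∃ D : Set V, D ⊆ θ ∧ D ∈ 𝓝[θ] η ∧ omegaLimitSet F D ∩ θ = {η}

end General

/-! ### The compactified system -/

/-- The limits of `Λ'(τ) / exp (∓ ρ τ)` as `τ → ± ∞` exist. -/
def IsExpBiAsymptoticallyConstant {P : Type*} [NormedAddCommGroup P] [NormedSpace ℝ P]
    (Λ : ℝ → P) (ρ : ℝ) : Prop :=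
  0 < ρ ∧
    (∃ a : P, Tendsto (fun τ => (Real.exp (-ρ * τ))⁻¹ • deriv Λ τ) atTop (𝓝 a)) ∧
    (∃ b : P, Tendsto (fun τ => (Real.exp (ρ * τ))⁻¹ • deriv Λ τ) atBot (𝓝 b))

/-- The frozen vector field `x ↦ f (x, lam)`. -/
def frozen {n d : ℕ}
    (f : EuclideanSpace ℝ (Fin n) × EuclideanSpace ℝ (Fin d) → EuclideanSpace ℝ (Fin n))
    (lam : EuclideanSpace ℝ (Fin d)) (x : EuclideanSpace ℝ (Fin n)) : EuclideanSpace ℝ (Fin n) :=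
  f (x, lam)

/-- The Euclidean space `ℝⁿ × ℝ` of pairs `(x, s)`. -/
abbrev Ext (n : ℕ) : Type := WithLp 2 (EuclideanSpace ℝ (Fin n) × ℝ)

/-- The pair `(x, s)`. -/
def pair {n : ℕ} (x : EuclideanSpace ℝ (Fin n)) (s : ℝ) : Ext n := WithLp.toLp 2 (x, s)

/-- The extended phase space `ℝⁿ × [-1, 1]`. -/
def phaseSpace (n : ℕ) : Set (Ext n) := {p | p.snd ∈ Icc (-1 : ℝ) 1}

/-- The subspace `ℝⁿ × {s}`; the invariant subspaces `S⁺`, `S⁻` are those with `s = 1`, `s = -1`. -/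
def slice (n : ℕ) (s : ℝ) : Set (Ext n) := {p | p.snd = s}

/-- The inverse of the time transformation `s = tanh (α τ / 2)`. -/
def hInv (α s : ℝ) : ℝ := (1 / α) * Real.log ((1 + s) / (1 - s))

/-- The input `Λ` as a function of `s ∈ [-1, 1]`, with the limits `lamP`, `lamM` at `s = 1`,
`s = -1`. (Values outside `[-1, 1]` are never used.) -/
def inputOfS {d : ℕ} (Λ : ℝ → EuclideanSpace ℝ (Fin d)) (lamP lamM : EuclideanSpace ℝ (Fin d))
    (α s : ℝ) : EuclideanSpace ℝ (Fin d) :=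
  if s ≤ -1 then lamM else if 1 ≤ s then lamP else Λ (hInv α s)

/-- The vector field of the compactified system
`x' = f (x, Λ_α(s)) / r`, `s' = α (1 - s²) / 2`. -/
def compactified {n d : ℕ}
    (f : EuclideanSpace ℝ (Fin n) × EuclideanSpace ℝ (Fin d) → EuclideanSpace ℝ (Fin n))
    (Λ : ℝ → EuclideanSpace ℝ (Fin d)) (lamP lamM : EuclideanSpace ℝ (Fin d)) (α r : ℝ)
    (p : Ext n) : Ext n :=
  pair (r⁻¹ • f (p.fst, inputOfS Λ lamP lamM α p.snd)) (α * (1 - p.snd ^ 2) / 2)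

end RTip

end

open RTip

/-! The substitution s = tanh(ατ/2) turns e^{ατ} into (1+s)/(1-s), so the s-derivative of the input
is 2Λ'(τ)/(α(1-s²)), which near s = 1 is of order e^{(α-ρ)τ} and tends to 0 because α < ρ;
reflection gives the same at s = -1. Hence the input, continued by constants beyond ±1, is C¹ on the
line with zero derivative at both ends (`contDiff_inputOfS`). The compactified field is then C¹ on
all of ℝⁿ⁺¹, and at (x, ±1) its Jacobian is block diagonal, with the Jacobian of the limit system
divided by r in one block and ∓α in the other (`hasFDerivAt_compactified`). All claims about
eigenvalues and eigenvectors follow from this block form; the additional eigenvector is the s-axis.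

The claims about manifolds rest on a stable manifold theorem, proved by Irwin's orbit method.
Convergent sequences form a Banach space, the orbits of the time-η map of the flow are the solutions
of an equation in it, and the inverse function theorem parametrises those near an equilibrium by
their stable component (`exists_stable_orbits`). Interpolating between multiples of η gives the
local stable set of the flow as a C¹ graph (`exists_localStableSet_eq_graph`), pulling back along
the flow gives the global one (`isImmersedSubmanifold_stableSet`), and time reversal gives unstable
sets. The slab enters only as an invariant set whose boundary is transverse to every manifold
containing the s-direction.

For (b), an edge state must have exactly one unstable direction
(`IsEquilibriumRegularEdgeState.exists_isDichotomy`). It has at least one, because growth of normal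
perturbations is incompatible with contraction in all directions. It has at most one, because the
attractor property makes η Lyapunov stable within θ; near η, θ therefore lies in the local stable
graph, and its dimension n - 1 is at most that of the stable subspace. At s = 1 the eigenvalue -α
adds a stable direction, so codimension one and the unstable line survive. At s = -1 the eigenvalue
α adds the only unstable direction to a sink. -/

noncomputable section

namespace RTip

/-! ### Exponential dichotomies -/

section Factorization

open Polynomial

/-- All complex roots of an irreducible real polynomial have the same real part. -/
lemma re_eq_of_irreducible {q : ℝ[X]} (hq : Irreducible q) {z w : ℂ} (hz : aeval z q = 0)
    (hw : aeval w q = 0) : w.re = z.re := by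
  have hint : IsIntegral ℝ z := IsAlgebraic.isIntegral ⟨q, hq.ne_zero, hz⟩
  have h1 : q ∣ minpoly ℝ z := (minpoly.irreducible hint).dvd_symm hq (minpoly.dvd ℝ z hz)
  -- This is (X - z)(X - z̄). The irreducible `q` divides the minimal polynomial of `z`, hence `m`,
  -- so its only possible roots are z and z̄.
  let m : ℝ[X] := X ^ 2 - C (2 * z.re) * X + C (z.re ^ 2 + z.im ^ 2)
  have hm : ∀ w : ℂ, aeval w m = (w - z) * (w - (starRingEnd ℂ) z) := by
    intro w
    simp only [m, map_add, map_sub, map_mul, map_pow, aeval_X, aeval_C]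
    apply Complex.ext <;> simp [pow_two] <;> ring
  have h2 : q ∣ m := h1.trans (minpoly.dvd ℝ z (by rw [hm]; simp))
  obtain ⟨c, hc⟩ := h2
  have h3 : aeval w m = 0 := by rw [hc, map_mul, hw, zero_mul]
  rw [hm] at h3
  rcases mul_eq_zero.1 h3 with h | h
  · rw [sub_eq_zero.1 h]
  · rw [sub_eq_zero.1 h]; simp

/-- A real polynomial without imaginary roots is a product of a polynomial with roots in the left
half-plane and a polynomial with roots in the right half-plane. -/
lemma exists_stable_mul_unstable (p : ℝ[X]) (hp : p ≠ 0)
    (h : ∀ z : ℂ, aeval z p = 0 → z.re ≠ 0) :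
    ∃ q₁ q₂ : ℝ[X], p = q₁ * q₂ ∧ (∀ z : ℂ, aeval z q₁ = 0 → z.re < 0) ∧
      (∀ z : ℂ, aeval z q₂ = 0 → 0 < z.re) := by
  induction p using WfDvdMonoid.induction_on_irreducible with
  | zero => exact absurd rfl hp
  | unit u hu =>
    refine ⟨u, 1, by simp, fun z hz => ?_, fun z hz => by simp at hz⟩
    exact absurd hz (hu.map (aeval z)).ne_zero
  | mul a i ha hi ih =>
    obtain ⟨q₁, q₂, rfl, h1, h2⟩ := ih ha fun z hz => h z (by simp [hz])
    -- The roots of an irreducible factor share one real part, so the factor goes as a whole to one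
    -- side.
    by_cases hneg : ∃ z : ℂ, aeval z i = 0 ∧ z.re < 0
    · obtain ⟨z, hz, hzn⟩ := hneg
      refine ⟨i * q₁, q₂, by ring, fun w hw => ?_, h2⟩
      rw [map_mul] at hw
      rcases mul_eq_zero.1 hw with h' | h'
      · rwa [re_eq_of_irreducible hi hz h']
      · exact h1 w h'
    · push Not at hneg
      refine ⟨q₁, i * q₂, by ring, h1, fun w hw => ?_⟩
      rw [map_mul] at hw
      rcases mul_eq_zero.1 hw with h' | h'
      · exact lt_of_le_of_ne (hneg w h') (h w (by simp [h'])).symm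
      · exact h2 w h'

end Factorization

/-! ### Exponential decay from the location of characteristic roots -/

section Decay

open Polynomial

/-- With the integrating factor e^{-zt}, the function f = e^{-zt}y has |f'| ≤ C e^{δt}, where δ = -c
- Re z is positive. Integrating and multiplying by e^{t Re z} loses nothing in the rate, since Re z
lies strictly to the left of -c. -/
lemma exists_exp_bound_of_hasDerivAt {y u : ℝ → ℂ} {z : ℂ} {c C : ℝ} (hz : z.re < -c)
    (hy : ∀ t, HasDerivAt y (u t + z * y t) t)
    (hu : ∀ t, 0 ≤ t → ‖u t‖ ≤ C * Real.exp (-c * t)) :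
    ∃ C', ∀ t, 0 ≤ t → ‖y t‖ ≤ C' * Real.exp (-c * t) := by
  set δ : ℝ := -c - z.re with hδ
  have hδ0 : 0 < δ := by linarith
  have hC : 0 ≤ C := by simpa using (norm_nonneg _).trans (hu 0 le_rfl)
  refine ⟨‖y 0‖ + C / δ, fun t ht => ?_⟩
  let f : ℝ → ℂ := fun t => Complex.exp (-z * t) * y t
  have hexp : ∀ t : ℝ, HasDerivAt (fun s : ℝ => Complex.exp (-z * s))
      (Complex.exp (-z * t) * (-z)) t := by
    intro t
    have h1 : HasDerivAt (fun s : ℝ => -z * (s : ℂ)) (-z) t := by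
      simpa using (Complex.ofRealCLM.hasDerivAt (x := t)).const_mul (-z)
    exact h1.cexp
  have hf : ∀ t : ℝ, HasDerivAt f (Complex.exp (-z * t) * u t) t := by
    intro t
    refine ((hexp t).mul (hy t)).congr_deriv ?_
    ring
  have hnorm : ∀ t : ℝ, ‖Complex.exp (-z * t)‖ = Real.exp (-z.re * t) := by
    intro t; rw [Complex.norm_exp]; simp
  have hB : ∀ x : ℝ, HasDerivAt (fun s => ‖y 0‖ + C / δ * (Real.exp (δ * s) - 1))
      (C * Real.exp (δ * x)) x := by
    intro x
    have h1 : HasDerivAt (fun s : ℝ => Real.exp (δ * s)) (Real.exp (δ * x) * δ) x := by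
      simpa using ((hasDerivAt_id x).const_mul δ).exp
    refine (((h1.sub_const 1).const_mul (C / δ)).const_add ‖y 0‖).congr_deriv ?_
    field_simp
  have key := image_norm_le_of_norm_deriv_right_le_deriv_boundary (a := 0) (b := t)
    (f := f) (f' := fun t => Complex.exp (-z * t) * u t)
    (fun s _ => (hf s).continuousAt.continuousWithinAt)
    (fun s _ => (hf s).hasDerivWithinAt)
    (B := fun s => ‖y 0‖ + C / δ * (Real.exp (δ * s) - 1)) (by simp [f]) hB
    (fun s hs => by
      rw [norm_mul, hnorm]
      calc _ ≤ Real.exp (-z.re * s) * (C * Real.exp (-c * s)) := by gcongr; exact hu s hs.1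
        _ = C * Real.exp (δ * s) := by
          rw [mul_left_comm, ← Real.exp_add]; congr 2; rw [hδ]; ring)
    (right_mem_Icc.2 ht)
  have hfy : ‖y t‖ = Real.exp (z.re * t) * ‖f t‖ := by
    simp only [f, norm_mul, hnorm]
    rw [← mul_assoc, ← Real.exp_add]; simp
  rw [hfy]
  have e1 : Real.exp (z.re * t) ≤ Real.exp (-c * t) := by
    apply Real.exp_le_exp.2; nlinarith
  have e2 : Real.exp (z.re * t) * Real.exp (δ * t) = Real.exp (-c * t) := by
    rw [← Real.exp_add]; congr 1; rw [hδ]; ring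
  have hCd : 0 ≤ C / δ := by positivity
  calc _ ≤ Real.exp (z.re * t) * (‖y 0‖ + C / δ * (Real.exp (δ * t) - 1)) := by gcongr
    _ = Real.exp (z.re * t) * ‖y 0‖ + C / δ * (Real.exp (-c * t)) -
        C / δ * Real.exp (z.re * t) := by rw [← e2]; ring
    _ ≤ Real.exp (-c * t) * ‖y 0‖ + C / δ * (Real.exp (-c * t)) - 0 := by gcongr; positivity
    _ = _ := by ring

/-- Exponential decay for the solutions `Y q` of a linear differential equation whose
characteristic roots lie to the left of `-c`. -/
lemma exists_exp_bound_of_multiset (Y : ℂ[X] →ₗ[ℂ] (ℝ → ℂ))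
    (hY : ∀ q t, HasDerivAt (Y q) (Y (X * q) t) t) {c : ℝ} (s : Multiset ℂ)
    (hs : ∀ z ∈ s, z.re < -c)
    (h : ∀ q, ∃ K, ∀ t, 0 ≤ t → ‖Y ((s.map fun z => X - C z).prod * q) t‖ ≤ K * Real.exp (-c * t))
    (q : ℂ[X]) : ∃ K, ∀ t, 0 ≤ t → ‖Y q t‖ ≤ K * Real.exp (-c * t) := by
  induction s using Multiset.induction_on generalizing q with
  | empty => simpa using h q
  | cons z s ih =>
    refine ih (fun w hw => hs w (Multiset.mem_cons_of_mem hw)) (fun q => ?_) q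
    obtain ⟨K, hK⟩ := h q
    refine exists_exp_bound_of_hasDerivAt (hs z (Multiset.mem_cons_self z s)) (fun t => ?_) hK
    convert hY ((s.map fun z => X - C z).prod * q) t using 1
    -- Multiplication by X acts as differentiation, so removing the factor X - z is solving y' = u +
    -- zy, where u is already known to decay.
    have : X * ((s.map fun z => X - C z).prod * q) =
        ((z ::ₘ s).map fun z => X - C z).prod * q + z • ((s.map fun z => X - C z).prod * q) := by
      rw [Multiset.map_cons, Multiset.prod_cons, smul_eq_C_mul]; ring
    rw [this, map_add, map_smul]; rfl

/-- Weak convergence is norm convergence in finite dimension: test on coordinates. This reduces the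
decay of operators to that of scalar functions. -/
lemma tendsto_of_forall_dual {ι E : Type*} [NormedAddCommGroup E] [NormedSpace ℝ E]
    [FiniteDimensional ℝ E] {l : Filter ι} {f : ι → E} {a : E}
    (h : ∀ φ : E →L[ℝ] ℝ, Tendsto (fun i => φ (f i)) l (𝓝 (φ a))) : Tendsto f l (𝓝 a) := by
  let b := Module.finBasis ℝ E
  have h1 : Tendsto (fun i => b.equivFunL (f i)) l (𝓝 (b.equivFunL a)) := by
    rw [tendsto_pi_nhds]
    intro i
    exact h ((ContinuousLinearMap.proj (R := ℝ) (φ := fun _ => ℝ) i).comp (b.equivFunL : E →L[ℝ] _))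
  have h2 := (b.equivFunL.symm.continuous.tendsto _).comp h1
  simpa [Function.comp_def] using h2

variable {𝔸 : Type*} [NormedRing 𝔸] [NormedAlgebra ℝ 𝔸] [FiniteDimensional ℝ 𝔸] [CompleteSpace 𝔸]

/-- If `p(a) b = 0` and all complex roots of `p` have negative real part, then `exp (t a) b`
tends to zero. -/
lemma tendsto_exp_smul_mul (a b : 𝔸) {p : ℝ[X]} (hp : p ≠ 0)
    (hroots : ∀ z : ℂ, aeval z p = 0 → z.re < 0) (hpb : aeval a p * b = 0) :
    Tendsto (fun t : ℝ => NormedSpace.exp (t • a) * b) atTop (𝓝 0) := by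
  refine tendsto_of_forall_dual fun φ => ?_
  -- `Y` sends X^k to φ(e^{ta} a^k b). Then multiplication by X is d/dt, and multiples of `p` are
  -- sent to zero because p(a)b = 0; so Y(1) solves a scalar equation with characteristic polynomial
  -- `p`.
  let Y : ℂ[X] →ₗ[ℂ] (ℝ → ℂ) := (Polynomial.basisMonomials ℂ).constr ℂ
    fun k t => ((φ (NormedSpace.exp (t • a) * a ^ k * b) : ℝ) : ℂ)
  have hYk : ∀ k : ℕ, Y (monomial k 1) =
      fun t => ((φ (NormedSpace.exp (t • a) * a ^ k * b) : ℝ) : ℂ) := by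
    intro k
    have := (Polynomial.basisMonomials ℂ).constr_basis ℂ
      (fun k (t : ℝ) => ((φ (NormedSpace.exp (t • a) * a ^ k * b) : ℝ) : ℂ)) k
    simpa [Y] using this
  have hYc : ∀ (k : ℕ) (c : ℂ), Y (monomial k c) =
      fun t => c * ((φ (NormedSpace.exp (t • a) * a ^ k * b) : ℝ) : ℂ) := by
    intro k c
    have : (monomial k c : ℂ[X]) = c • monomial k 1 := by simp [smul_monomial]
    rw [this, map_smul, hYk]; rfl
  have hderiv : ∀ q t, HasDerivAt (Y q) (Y (X * q) t) t := by
    intro q t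
    induction q using Polynomial.induction_on' with
    | add q₁ q₂ h₁ h₂ =>
      rw [mul_add, map_add, map_add]
      exact h₁.add h₂
    | monomial k c =>
      rw [X_mul_monomial, hYc, hYc]
      refine HasDerivAt.const_mul c ?_
      refine HasDerivAt.ofReal_comp ?_
      have h1 := hasDerivAt_exp_smul_const a t
      have h2 := (h1.mul_const (a ^ k)).mul_const b
      have h3 := φ.hasFDerivAt.comp_hasDerivAt t h2
      refine h3.congr_deriv ?_
      rw [pow_succ']; simp only [mul_assoc]
  have hmap : ∀ (q : ℝ[X]) t, Y (q.map (algebraMap ℝ ℂ)) t =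
      ((φ (NormedSpace.exp (t • a) * aeval a q * b) : ℝ) : ℂ) := by
    intro q t
    induction q using Polynomial.induction_on' with
    | add q₁ q₂ h₁ h₂ =>
      rw [Polynomial.map_add, map_add, Pi.add_apply, h₁, h₂, map_add, mul_add, add_mul, map_add]
      push_cast; rfl
    | monomial k c =>
      rw [map_monomial, hYc, aeval_monomial]
      simp only [mul_assoc, ← Algebra.smul_def, smul_mul_assoc, mul_smul_comm, map_smul]
      simp
  set P := p.map (algebraMap ℝ ℂ) with hP
  have hP0 : P ≠ 0 := (Polynomial.map_ne_zero_iff (algebraMap ℝ ℂ).injective).2 hp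
  have hsplit : P = C P.leadingCoeff * (P.roots.map fun z => X - C z).prod :=
    (IsAlgClosed.splits P).eq_prod_roots
  have hYP : ∀ q, Y (P * q) = 0 := by
    intro q
    induction q using Polynomial.induction_on' with
    | add q₁ q₂ h₁ h₂ => rw [mul_add, map_add, h₁, h₂, add_zero]
    | monomial k c =>
      have : P * monomial k c = c • ((p * X ^ k).map (algebraMap ℝ ℂ)) := by
        rw [Polynomial.map_mul, Polynomial.map_pow, map_X, ← C_mul_X_pow_eq_monomial,
          smul_eq_C_mul]
        ring
      rw [this, map_smul]
      ext t
      have h0 : aeval a (p * X ^ k) * b = 0 := by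
        rw [mul_comm p, map_mul, mul_assoc, hpb, mul_zero]
      rw [Pi.smul_apply, hmap, mul_assoc, h0]
      simp
  have hre : ∀ z ∈ P.roots, z.re < 0 := by
    intro z hz
    apply hroots
    have := (mem_roots hP0).1 hz
    rwa [IsRoot.def, hP, eval_map_algebraMap] at this
  -- The roots are finitely many, so they stay at a uniform distance from the imaginary axis.
  obtain ⟨c, hc0, hc⟩ : ∃ c : ℝ, 0 < c ∧ ∀ z ∈ P.roots, z.re < -c := by
    have : ∀ s : Multiset ℂ, (∀ z ∈ s, z.re < 0) → ∃ c : ℝ, 0 < c ∧ ∀ z ∈ s, z.re < -c := by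
      intro s
      induction s using Multiset.induction_on with
      | empty => exact fun _ => ⟨1, one_pos, by simp⟩
      | cons w s ih =>
        intro h
        obtain ⟨c, hc0, hc⟩ := ih fun z hz => h z (Multiset.mem_cons_of_mem hz)
        have hw := h w (Multiset.mem_cons_self w s)
        refine ⟨min c (-w.re / 2), lt_min hc0 (by linarith), fun z hz => ?_⟩
        rcases Multiset.mem_cons.1 hz with rfl | hz
        · linarith [min_le_right c (-z.re / 2)]
        · linarith [hc z hz, min_le_left c (-w.re / 2)]
    exact this _ hre
  have hlead : P.leadingCoeff ≠ 0 := leadingCoeff_ne_zero.2 hP0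
  -- The induction starts from the full product of root factors, which is `P` up to its leading
  -- coefficient and gives the zero function; it ends at the polynomial 1.
  obtain ⟨K, hK⟩ := exists_exp_bound_of_multiset Y hderiv P.roots hc (fun q => by
    refine ⟨0, fun t _ => ?_⟩
    have : (P.roots.map fun z => X - C z).prod * q = P * (P.leadingCoeff⁻¹ • q) := by
      have hC : C P.leadingCoeff * C P.leadingCoeff⁻¹ = (1 : ℂ[X]) := by
        rw [← C_mul, mul_inv_cancel₀ hlead, C_1]
      rw [smul_eq_C_mul]
      nth_rewrite 2 [hsplit]
      linear_combination (-(P.roots.map fun z => X - C z).prod * q) * hC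
    rw [this, hYP]; simp) 1
  rw [map_zero]
  have hlim : Tendsto (fun t : ℝ => K * Real.exp (-c * t)) atTop (𝓝 0) := by
    have h1 : Tendsto (fun t : ℝ => -c * t) atTop atBot :=
      tendsto_id.const_mul_atTop_of_neg (by linarith)
    simpa using (Real.tendsto_exp_atBot.comp h1).const_mul K
  refine squeeze_zero_norm' ?_ hlim
  filter_upwards [eventually_ge_atTop 0] with t ht
  have h1 := hK t ht
  have h2 := hYk 0
  rw [monomial_zero_left, C_1] at h2
  rw [h2] at h1
  simpa using h1

end Decay

/-! ### Spectral projections of hyperbolic operators -/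

section Dichotomy

variable {V : Type*} [NormedAddCommGroup V] [NormedSpace ℝ V]

/-- The projection `P` is an exponential dichotomy of `x' = A x`: it commutes with `A`, and
`exp (t A)` contracts its range forwards and its kernel backwards in time. -/
structure IsDichotomy (A P : V →L[ℝ] V) : Prop where
  idem : P * P = P
  comm : A * P = P * A
  stable : Tendsto (fun t : ℝ => NormedSpace.exp (t • A) * P) atTop (𝓝 0)
  unstable : Tendsto (fun t : ℝ => NormedSpace.exp (-t • A) * (1 - P)) atTop (𝓝 0)

lemma IsDichotomy.neg {A P : V →L[ℝ] V} (h : IsDichotomy A P) : IsDichotomy (-A) (1 - P) where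
  idem := by simp [mul_sub, sub_mul, h.idem]
  comm := by
    simp only [mul_sub, sub_mul, neg_mul, mul_neg, h.comm, mul_one, one_mul]; abel
  stable := by simpa using h.unstable
  unstable := by simpa using h.stable

lemma IsDichotomy.smul {A P : V →L[ℝ] V} (h : IsDichotomy A P) {c : ℝ} (hc : 0 < c) :
    IsDichotomy (c • A) P where
  idem := h.idem
  comm := by simp [h.comm]
  stable := by
    have := h.stable.comp (tendsto_id.atTop_mul_const hc)
    simpa [Function.comp_def, mul_smul] using this
  unstable := by
    have := h.unstable.comp (tendsto_id.atTop_mul_const hc)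
    simpa [Function.comp_def, mul_smul] using this

-- Cayley–Hamilton, moved to the algebra of continuous operators, where the exponential lives.
open Polynomial in
lemma aeval_charpoly_clm [FiniteDimensional ℝ V] (A : V →L[ℝ] V) :
    aeval A (A : V →ₗ[ℝ] V).charpoly = 0 := by
  have h := LinearMap.aeval_self_charpoly (A : V →ₗ[ℝ] V)
  have : ∀ q : ℝ[X], ((aeval A q : V →L[ℝ] V) : V →ₗ[ℝ] V) = aeval (A : V →ₗ[ℝ] V) q := by
    intro q
    induction q using Polynomial.induction_on' with
    | add q₁ q₂ h₁ h₂ => simp [h₁, h₂]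
    | monomial k c =>
      ext x
      simp [aeval_monomial, Algebra.algebraMap_eq_smul_one, ContinuousLinearMap.toLinearMap_pow]
  apply ContinuousLinearMap.coe_injective
  rw [this, h]; rfl

open Polynomial in
/-- A linear system without imaginary eigenvalues has an exponential dichotomy. -/
theorem exists_isDichotomy [FiniteDimensional ℝ V] (A : V →L[ℝ] V)
    (h : ∀ z : ℂ, aeval z (A : V →ₗ[ℝ] V).charpoly = 0 → z.re ≠ 0) :
    ∃ P : V →L[ℝ] V, IsDichotomy A P := by
  have hne := (LinearMap.charpoly_monic (A : V →ₗ[ℝ] V)).ne_zero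
  obtain ⟨q₁, q₂, hq, h1, h2⟩ := exists_stable_mul_unstable _ hne h
  have hq1 : q₁ ≠ 0 := by rintro rfl; simp [hq] at hne
  have hq2 : q₂ ≠ 0 := by rintro rfl; simp [hq] at hne
  have hcop : IsCoprime q₁ q₂ := by
    rw [Polynomial.isCoprime_iff_aeval_ne_zero_of_isAlgClosed ℝ ℂ]
    intro z
    by_contra! hz
    exact lt_asymm (h1 z hz.1) (h2 z hz.2)
  -- From the Bézout identity u q₁ + v q₂ = 1 the projection is (v q₂)(A), with complement (u
  -- q₁)(A). By Cayley–Hamilton q₁(A) kills the first and q₂(A) the second, which is what the decay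
  -- lemma needs forwards and, for -A and q₂(-X), backwards.
  obtain ⟨u, v, huv⟩ := hcop
  have hA := aeval_charpoly_clm A
  rw [hq] at hA
  have hcomp : 1 - aeval A (v * q₂) = aeval A (u * q₁) := by
    rw [sub_eq_iff_eq_add, ← map_add, huv, map_one]
  have hcomm : ∀ x y : ℝ[X], aeval A x * aeval A y = aeval A y * aeval A x := by
    intro x y; rw [← map_mul, mul_comm, map_mul]
  refine ⟨aeval A (v * q₂), ?_, ?_, ?_, ?_⟩
  · have : aeval A (v * q₂) * (1 - aeval A (v * q₂)) = 0 := by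
      rw [hcomp, ← map_mul, show v * q₂ * (u * q₁) = (v * u) * (q₁ * q₂) by ring, map_mul, hA,
        mul_zero]
    rw [mul_sub, mul_one, sub_eq_zero] at this
    exact this.symm
  · simpa using hcomm X (v * q₂)
  · refine tendsto_exp_smul_mul A _ hq1 h1 ?_
    rw [← map_mul, show q₁ * (v * q₂) = v * (q₁ * q₂) by ring, map_mul, hA, mul_zero]
  · have hneg : ∀ q : ℝ[X], aeval (-A) (q.comp (-X)) = aeval A q := by
      intro q; rw [aeval_comp]; simp
    have := tendsto_exp_smul_mul (-A) (1 - aeval A (v * q₂)) (p := q₂.comp (-X))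
      (by
        intro h0
        apply hq2
        have := congrArg (fun q => q.comp (-X)) h0
        simpa [comp_assoc] using this)
      (fun z hz => by
        rw [aeval_comp] at hz
        have := h2 _ hz
        simp at this
        linarith)
      (by
        rw [hneg, hcomp, ← map_mul, show q₂ * (u * q₁) = u * (q₁ * q₂) by ring, map_mul, hA,
          mul_zero])
    simpa using this

open Polynomial in
lemma isDichotomy_one [FiniteDimensional ℝ V] (A : V →L[ℝ] V)
    (h : ∀ z : ℂ, aeval z (A : V →ₗ[ℝ] V).charpoly = 0 → z.re < 0) : IsDichotomy A 1 where
  idem := by simp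
  comm := by simp
  stable := tendsto_exp_smul_mul A 1 (LinearMap.charpoly_monic (A : V →ₗ[ℝ] V)).ne_zero h
    (by rw [aeval_charpoly_clm, zero_mul])
  unstable := by simp

end Dichotomy

/-! ### Superposition operators -/

section Superposition

variable {K : Type*} [TopologicalSpace K] [CompactSpace K]
  {V W : Type*} [NormedAddCommGroup V] [NormedSpace ℝ V] [NormedAddCommGroup W] [NormedSpace ℝ W]

/-- Pointwise application of a continuous field of operators to a continuous map. -/
def pointwiseApply : C(K, V →L[ℝ] W) →L[ℝ] C(K, V) →L[ℝ] C(K, W) :=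
  LinearMap.mkContinuous₂
    (LinearMap.mk₂ ℝ (fun (D : C(K, V →L[ℝ] W)) (η : C(K, V)) =>
        (⟨fun k => D k (η k), D.continuous.clm_apply η.continuous⟩ : C(K, W)))
      (fun _ _ _ => by ext; simp) (fun _ _ _ => by ext; simp)
      (fun _ _ _ => by ext; simp) (fun _ _ _ => by ext; simp)) 1
    (fun D η => by
      rw [ContinuousMap.norm_le _ (by positivity)]
      intro k
      calc ‖D k (η k)‖ ≤ ‖D k‖ * ‖η k‖ := (D k).le_opNorm _
        _ ≤ 1 * ‖D‖ * ‖η‖ := by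
          rw [one_mul]
          exact mul_le_mul (D.norm_coe_le_norm k) (η.norm_coe_le_norm k) (by positivity)
            (by positivity))

@[simp] lemma pointwiseApply_apply (D : C(K, V →L[ℝ] W)) (η : C(K, V)) (k : K) :
    pointwiseApply D η k = D k (η k) := rfl

/-- The superposition operator `γ ↦ g ∘ γ`. -/
def superpose (g : C(V, W)) (γ : C(K, V)) : C(K, W) := g.comp γ

omit [CompactSpace K] [NormedSpace ℝ V] [NormedSpace ℝ W] in
@[simp] lemma superpose_apply (g : C(V, W)) (γ : C(K, V)) (k : K) : superpose g γ k = g (γ k) := rfl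

/-- The derivative of a `C¹` map as a continuous map. -/
def fderivMap (g : C(V, W)) (hg : ContDiff ℝ 1 g) : C(V, V →L[ℝ] W) :=
  ⟨fderiv ℝ g, hg.continuous_fderiv one_ne_zero⟩

/-- The range of γ is compact, so the derivative of g is uniformly continuous at its points. One δ
then serves all k in the mean value inequality, and the estimate is uniform in the supremum norm. -/
lemma hasFDerivAt_superpose (g : C(V, W)) (hg : ContDiff ℝ 1 g) (γ : C(K, V)) :
    HasFDerivAt (superpose g) (pointwiseApply (superpose (fderivMap g hg) γ)) γ := by
  rw [hasFDerivAt_iff_isLittleO, Asymptotics.isLittleO_iff]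
  intro ε hε
  have hunif := (isCompact_range γ.continuous).uniformContinuousAt_of_continuousAt (fderiv ℝ g)
    (fun x _ => (hg.continuous_fderiv one_ne_zero).continuousAt) (Metric.dist_mem_uniformity hε)
  obtain ⟨δ, hδ, h⟩ := Metric.mem_uniformity_dist.1 hunif
  filter_upwards [Metric.ball_mem_nhds γ hδ] with γ' hγ'
  rw [ContinuousMap.norm_le _ (by positivity)]
  intro k
  have hk : γ' k ∈ Metric.ball (γ k) δ :=
    (ContinuousMap.dist_apply_le_dist k).trans_lt hγ'
  have := (convex_ball (γ k) δ).norm_image_sub_le_of_norm_hasFDerivWithin_le' (𝕜 := ℝ) (f := g)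
    (f' := fderiv ℝ g) (φ := fderiv ℝ g (γ k)) (C := ε) (x := γ k) (y := γ' k)
    (fun x _ => ((hg.differentiable one_ne_zero) x).hasFDerivAt.hasFDerivWithinAt)
    (fun x hx => by
      rw [← dist_eq_norm, dist_comm]
      exact (h (a := γ k) (b := x) (by rw [dist_comm]; exact hx) (mem_range_self k)).le)
    (Metric.mem_ball_self hδ) hk
  calc _ ≤ ε * ‖γ' k - γ k‖ := this
    _ ≤ ε * ‖γ' - γ‖ := by gcongr; exact (γ' - γ).norm_coe_le_norm k

lemma contDiff_superpose (g : C(V, W)) (hg : ContDiff ℝ 1 g) :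
    ContDiff ℝ 1 (superpose g : C(K, V) → C(K, W)) := by
  rw [contDiff_one_iff_hasFDerivAt]
  exact ⟨_, (pointwiseApply).continuous.comp (ContinuousMap.continuous_postcomp _),
    hasFDerivAt_superpose g hg⟩

lemma norm_pointwiseApply_le {D : C(K, V →L[ℝ] W)} {C : ℝ} (hC : 0 ≤ C) (h : ∀ k, ‖D k‖ ≤ C) :
    ‖pointwiseApply D‖ ≤ C := by
  refine ContinuousLinearMap.opNorm_le_bound _ hC fun η => ?_
  rw [ContinuousMap.norm_le _ (by positivity)]
  intro k
  exact ((D k).le_opNorm _).trans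
    (mul_le_mul (h k) (η.norm_coe_le_norm k) (norm_nonneg _) hC)

end Superposition

/-! ### The flow of a compactly supported vector field -/

section Volterra

variable {V : Type*} [NormedAddCommGroup V] [NormedSpace ℝ V]

/-- The Volterra operator `γ ↦ ∫₀ γ` on curves over the unit interval. -/
def volterra : C(Icc (0 : ℝ) 1, V) →L[ℝ] C(Icc (0 : ℝ) 1, V) :=
  LinearMap.mkContinuous
    { toFun := fun γ => ⟨fun τ => ∫ s in (0 : ℝ)..τ, IccExtend zero_le_one γ s,
        (intervalIntegral.continuous_primitive (fun _ _ =>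
          (γ.continuous.Icc_extend' (h := zero_le_one)).intervalIntegrable _ _) 0).comp
            continuous_subtype_val⟩
      map_add' := fun γ η => by
        ext τ
        exact intervalIntegral.integral_add
          ((γ.continuous.Icc_extend' (h := zero_le_one)).intervalIntegrable _ _)
          ((η.continuous.Icc_extend' (h := zero_le_one)).intervalIntegrable _ _)
      map_smul' := fun c γ => by
        ext τ
        exact intervalIntegral.integral_smul c _ } 1
    (fun γ => by
      rw [ContinuousMap.norm_le _ (by positivity)]
      intro τ
      refine (intervalIntegral.norm_integral_le_of_norm_le_const (C := ‖γ‖)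
        (fun s _ => γ.norm_coe_le_norm _)).trans ?_
      rw [mul_comm, sub_zero, abs_of_nonneg τ.2.1]
      exact mul_le_mul_of_nonneg_right τ.2.2 (norm_nonneg _))

lemma norm_volterra_le : ‖(volterra : C(Icc (0 : ℝ) 1, V) →L[ℝ] C(Icc (0 : ℝ) 1, V))‖ ≤ 1 :=
  LinearMap.mkContinuous_norm_le _ zero_le_one _

lemma norm_volterra_apply_le (γ : C(Icc (0 : ℝ) 1, V)) : ‖volterra γ‖ ≤ ‖γ‖ := by
  simpa using ContinuousLinearMap.le_of_opNorm_le (volterra (V := V)) norm_volterra_le γ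

/-- The restriction of a continuous curve to the unit interval. -/
def unitCurve (u : ℝ → V) (hu : Continuous u) : C(Icc (0 : ℝ) 1, V) :=
  ⟨fun τ => u τ, hu.comp continuous_subtype_val⟩

lemma volterra_unitCurve [CompleteSpace V] {u v : ℝ → V} (h : ∀ s, HasDerivAt u (v s) s)
    (hu : Continuous u) (hv : Continuous v) :
    volterra (unitCurve v hv) = unitCurve u hu - ContinuousMap.const _ (u 0) := by
  ext τ
  change ∫ s in (0 : ℝ)..τ, IccExtend zero_le_one (unitCurve v hv) s = u τ - u 0
  rw [← intervalIntegral.integral_eq_sub_of_hasDerivAt (fun x _ => h x)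
    (hv.intervalIntegrable _ _)]
  refine intervalIntegral.integral_congr fun s hs => ?_
  rw [uIcc_of_le τ.2.1] at hs
  rw [IccExtend_of_mem _ _ ⟨hs.1, hs.2.trans τ.2.2⟩]
  rfl

end Volterra

/-! ### Global flows of bounded Lipschitz fields and their smoothness -/

section Flow

variable {V : Type*} [NormedAddCommGroup V] [NormedSpace ℝ V]

/-- `φ` is the global flow of `G`. -/
structure IsFlow (G : V → V) (φ : ℝ → V → V) : Prop where
  zero : ∀ x, φ 0 x = x
  deriv : ∀ x t, HasDerivAt (fun s => φ s x) (G (φ t x)) t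

lemma exists_isFlow [CompleteSpace V] {G : V → V} {K L : NNReal} (hK : LipschitzWith K G)
    (hL : ∀ x, ‖G x‖ ≤ L) : ∃ φ, IsFlow G φ := by
  have hsol : ∀ (x : V) (T : ℝ), ∃ γ : ℝ → V, 0 < T → γ 0 = x ∧
      ∀ t ∈ Icc (-T) T, HasDerivWithinAt γ (G (γ t)) (Icc (-T) T) t := by
    intro x T
    by_cases hT : 0 < T
    · have h0 : (0 : ℝ) ∈ Icc (-T) T := ⟨by linarith, hT.le⟩
      -- The bound L is global, so the ball of radius L·T never restricts the time T.
      have hPL : IsPicardLindelof (fun _ => G) (⟨0, h0⟩ : Icc (-T) T) x (L * ⟨T, hT.le⟩) 0 L K := by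
        refine IsPicardLindelof.of_time_independent (fun y _ => hL y) (hK.lipschitzOnWith) ?_
        simp only [sub_zero, zero_sub, neg_neg, max_self, NNReal.coe_zero]
        rfl
      obtain ⟨γ, h1, h2⟩ := hPL.exists_eq_forall_mem_Icc_hasDerivWithinAt₀
      exact ⟨γ, fun _ => ⟨h1, h2⟩⟩
    · exact ⟨fun _ => x, fun h => absurd h hT⟩
  choose γ hγ using hsol
  have hin : ∀ x T, 0 < T → ∀ t ∈ Ioo (-T) T, HasDerivAt (γ x T) (G (γ x T t)) t :=
    fun x T hT t ht => ((hγ x T hT).2 t (Ioo_subset_Icc_self ht)).hasDerivAt (Icc_mem_nhds ht.1 ht.2)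
  have hagree : ∀ x T T', 0 < T → T ≤ T' → ∀ t ∈ Icc (-T) T, γ x T t = γ x T' t := by
    intro x T T' hT hTT'
    have hsub : Icc (-T) T ⊆ Icc (-T') T' := Icc_subset_Icc (by linarith) hTT'
    have hsub' : Ioo (-T) T ⊆ Ioo (-T') T' := Ioo_subset_Ioo (by linarith) hTT'
    exact ODE_solution_unique_of_mem_Icc (v := fun _ => G) (s := fun _ => univ) (t₀ := 0)
      (fun _ _ => hK.lipschitzOnWith) ⟨by linarith, hT⟩
      (fun t ht => ((hγ x T hT).2 t ht).continuousWithinAt) (hin x T hT)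
      (fun _ _ => mem_univ _)
      (fun t ht => ((hγ x T' (hT.trans_le hTT')).2 t (hsub ht)).continuousWithinAt.mono hsub)
      (fun t ht => hin x T' (hT.trans_le hTT') t (hsub' ht)) (fun _ _ => mem_univ _)
      (by rw [(hγ x T hT).1, (hγ x T' (hT.trans_le hTT')).1])
  -- Solutions on different windows agree where both are defined. Near t, every window |s| + 1 is
  -- contained in the fixed window |t| + 2, which gives differentiability of the glued curve.
  refine ⟨fun t x => γ x (|t| + 1) t, fun x => (hγ x _ (by positivity)).1, fun x t => ?_⟩
  have ht : t ∈ Ioo (-(|t| + 2)) (|t| + 2) := by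
    rw [mem_Ioo, ← abs_lt]; linarith
  have hval : γ x (|t| + 1) t = γ x (|t| + 2) t :=
    hagree x _ _ (by positivity) (by linarith) t (abs_le.1 (by linarith))
  rw [hval]
  refine (hin x (|t| + 2) (by positivity) t ht).congr_of_eventuallyEq ?_
  have hnear : ∀ᶠ s in 𝓝 t, |s| < |t| + 1 :=
    (continuous_abs.tendsto t).eventually (gt_mem_nhds (by linarith))
  filter_upwards [hnear] with s hs
  exact hagree x _ _ (by positivity) (by linarith) s (abs_le.1 (by linarith))

namespace IsFlow

variable {G : V → V} {φ : ℝ → V → V} {K : NNReal}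

lemma continuous_curve (h : IsFlow G φ) (x : V) : Continuous fun t => φ t x :=
  continuous_iff_continuousAt.2 fun t => (h.deriv x t).continuousAt

lemma add (h : IsFlow G φ) (hK : LipschitzWith K G) (s t : ℝ) (x : V) :
    φ (s + t) x = φ s (φ t x) := by
  have := ODE_solution_unique_univ (v := fun _ => G) (s := fun _ => univ) (t₀ := 0)
    (f := fun s => φ (s + t) x) (g := fun s => φ s (φ t x))
    (fun _ => hK.lipschitzOnWith)
    (fun s => ⟨by simpa using (h.deriv x (s + t)).comp_add_const s t, mem_univ _⟩)
    (fun s => ⟨h.deriv _ s, mem_univ _⟩) (by simp [h.zero])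
  exact congrFun this s

lemma eq_of_hasDerivWithinAt (h : IsFlow G φ) (hK : LipschitzWith K G) {γ : ℝ → V} {T : ℝ}
    (hγ : ∀ t ∈ Icc 0 T, HasDerivWithinAt γ (G (γ t)) (Icc 0 T) t) :
    ∀ t ∈ Icc 0 T, γ t = φ t (γ 0) :=
  ODE_solution_unique_of_mem_Icc_right (v := fun _ => G) (s := fun _ => univ)
    (fun _ _ => hK.lipschitzOnWith) (fun t ht => (hγ t ht).continuousWithinAt)
    (fun t ht => (hγ t (Ico_subset_Icc_self ht)).mono_of_mem_nhdsWithin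
      (Icc_mem_nhdsGE_of_mem ht))
    (fun _ _ => mem_univ _) ((h.continuous_curve _).continuousOn)
    (fun t _ => (h.deriv _ t).hasDerivWithinAt) (fun _ _ => mem_univ _) (h.zero _).symm

lemma dist_le (h : IsFlow G φ) (hK : LipschitzWith K G) (x y : V) {t : ℝ} (ht : 0 ≤ t) :
    dist (φ t x) (φ t y) ≤ dist x y * Real.exp (K * t) := by
  have := dist_le_of_trajectories_ODE_of_mem (v := fun _ => G) (s := fun _ => univ) (a := 0)
    (b := t) (f := fun s => φ s x) (g := fun s => φ s y) (δ := dist x y)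
    (fun _ _ => hK.lipschitzOnWith) ((h.continuous_curve _).continuousOn)
    (fun t _ => (h.deriv _ t).hasDerivWithinAt) (fun _ _ => mem_univ _)
    ((h.continuous_curve _).continuousOn)
    (fun t _ => (h.deriv _ t).hasDerivWithinAt) (fun _ _ => mem_univ _)
    (by rw [h.zero, h.zero]) t (right_mem_Icc.2 ht)
  simpa using this

lemma fixed (h : IsFlow G φ) (hK : LipschitzWith K G) {p : V} (hp : G p = 0) (t : ℝ) :
    φ t p = p := by
  have := ODE_solution_unique_univ (v := fun _ => G) (s := fun _ => univ) (t₀ := 0)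
    (f := fun s => φ s p) (g := fun _ => p) (fun _ => hK.lipschitzOnWith)
    (fun s => ⟨h.deriv _ s, mem_univ _⟩)
    (fun s => ⟨by rw [hp]; exact hasDerivAt_const _ _, mem_univ _⟩) (h.zero p)
  exact congrFun this t

variable [CompleteSpace V]

/-- The derivative of the integral operator at a curve is invertible. -/
def volterraEquiv (g : C(V, V)) (hg : ContDiff ℝ 1 g) (hK : LipschitzWith K g) {t : ℝ}
    (ht : |t| * K < 1) (γ : C(Icc (0 : ℝ) 1, V)) :
    C(Icc (0 : ℝ) 1, V) ≃L[ℝ] C(Icc (0 : ℝ) 1, V) :=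
  ContinuousLinearEquiv.ofUnit (Units.oneSub
    (t • volterra * pointwiseApply (superpose (fderivMap g hg) γ)) (by
      refine lt_of_le_of_lt ?_ ht
      refine (ContinuousLinearMap.opNorm_comp_le _ _).trans
        (mul_le_mul ?_ ?_ (norm_nonneg _) (abs_nonneg _))
      · rw [norm_smul, Real.norm_eq_abs]
        exact mul_le_of_le_one_right (abs_nonneg _) norm_volterra_le
      · exact norm_pointwiseApply_le K.2 fun k => norm_fderiv_le_of_lipschitz ℝ hK))

lemma volterraEquiv_apply (g : C(V, V)) (hg : ContDiff ℝ 1 g) (hK : LipschitzWith K g) {t : ℝ}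
    (ht : |t| * K < 1) (γ η : C(Icc (0 : ℝ) 1, V)) :
    volterraEquiv g hg hK ht γ η =
      η - t • volterra (pointwiseApply (superpose (fderivMap g hg) γ) η) := rfl

/-- A contractive perturbation of the identity is a homeomorphism. -/
lemma exists_homeomorph_id_sub {E : Type*} [NormedAddCommGroup E] [NormedSpace ℝ E]
    [CompleteSpace E] {N : E → E} {c : NNReal} (hN : ∀ x y, ‖N x - N y‖ ≤ c * ‖x - y‖)
    (hc : c < 1) : ∃ Θ : E ≃ₜ E, ∀ x, Θ x = x - N x := by
  have happ : ApproximatesLinearOn (fun x => x - N x)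
      ((ContinuousLinearEquiv.refl ℝ E : E ≃L[ℝ] E) : E →L[ℝ] E) univ c := by
    intro x _ y _
    have h1 : x - N x - (y - N y) - (x - y) = -(N x - N y) := by abel
    change ‖x - N x - (y - N y) - (x - y)‖ ≤ _
    rw [h1, norm_neg]
    exact hN x y
  have hc' : Subsingleton E ∨
      c < ‖((ContinuousLinearEquiv.refl ℝ E).symm : E →L[ℝ] E)‖₊⁻¹ := by
    rcases subsingleton_or_nontrivial E with h | h
    · exact Or.inl h
    · right
      have : ‖((ContinuousLinearEquiv.refl ℝ E).symm : E →L[ℝ] E)‖₊ = 1 := by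
        ext
        exact ContinuousLinearMap.norm_id
      rwa [this, inv_one]
  exact ⟨happ.toHomeomorph _ hc', fun _ => rfl⟩

/-- The integral equation with initial value as the right-hand side, as a homeomorphism of the
space of curves. -/
lemma exists_homeomorph (g : C(V, V)) (hK : LipschitzWith K g) {t : ℝ} (ht : |t| * K < 1) :
    ∃ Θ : C(Icc (0 : ℝ) 1, V) ≃ₜ C(Icc (0 : ℝ) 1, V),
      ∀ γ, Θ γ = γ - t • volterra (superpose g γ) := by
  have h1 : ∀ γ η : C(Icc (0 : ℝ) 1, V),
      ‖superpose g γ - superpose g η‖ ≤ K * ‖γ - η‖ := by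
    intro γ η
    rw [ContinuousMap.norm_le _ (by positivity)]
    intro k
    have := hK.dist_le_mul (γ k) (η k)
    rw [dist_eq_norm, dist_eq_norm] at this
    exact this.trans (mul_le_mul_of_nonneg_left ((γ - η).norm_coe_le_norm k) K.2)
  have h2 : ∀ γ η : C(Icc (0 : ℝ) 1, V),
      ‖t • volterra (superpose g γ) - t • volterra (superpose g η)‖ ≤
        ((‖t‖₊ * K : NNReal) : ℝ) * ‖γ - η‖ := by
    intro γ η
    have h3 : ‖volterra (superpose g γ - superpose g η)‖ ≤ K * ‖γ - η‖ :=
      (norm_volterra_apply_le _).trans (h1 γ η)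
    rw [← smul_sub, ← map_sub, norm_smul, NNReal.coe_mul, coe_nnnorm, mul_assoc]
    exact mul_le_mul_of_nonneg_left h3 (norm_nonneg _)
  have h3 : ‖t‖₊ * K < 1 := by
    rw [← NNReal.coe_lt_coe]
    simpa using ht
  exact exists_homeomorph_id_sub h2 h3

lemma hasFDerivAt_integralMap (g : C(V, V)) (hg : ContDiff ℝ 1 g) (hK : LipschitzWith K g) {t : ℝ}
    (ht : |t| * K < 1) (γ : C(Icc (0 : ℝ) 1, V)) :
    HasFDerivAt (fun γ => γ - t • volterra (superpose g γ))
      (volterraEquiv g hg hK ht γ : C(Icc (0 : ℝ) 1, V) →L[ℝ] C(Icc (0 : ℝ) 1, V)) γ := by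
  refine ((hasFDerivAt_id γ).sub
    (((t • volterra).hasFDerivAt).comp γ (hasFDerivAt_superpose g hg γ))).congr_fderiv ?_
  ext1 η
  rw [ContinuousLinearEquiv.coe_coe, volterraEquiv_apply]
  rfl

/-- The short-time flow through the integral equation. -/
lemma contDiff_of_small (h : IsFlow G φ) (hG : ContDiff ℝ 1 G) (hK : LipschitzWith K G) {t : ℝ}
    (ht : |t| * K < 1) : ContDiff ℝ 1 (φ t) ∧ ∀ {p : V} {A : V →L[ℝ] V}, G p = 0 →
      fderiv ℝ G p = A → HasFDerivAt (φ t) (NormedSpace.exp (t • A)) p := by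
  let g : C(V, V) := ⟨G, hG.continuous⟩
  have hg : ContDiff ℝ 1 g := hG
  obtain ⟨Θ, hΘ⟩ := exists_homeomorph g hK ht
  have hΘ' : (Θ : C(Icc (0 : ℝ) 1, V) → C(Icc (0 : ℝ) 1, V)) =
      fun γ => γ - t • volterra (superpose g γ) := funext hΘ
  have hd : ∀ γ, HasFDerivAt Θ
      (volterraEquiv g hg hK ht γ : C(Icc (0 : ℝ) 1, V) →L[ℝ] C(Icc (0 : ℝ) 1, V)) γ := by
    intro γ; rw [hΘ']; exact hasFDerivAt_integralMap g hg hK ht γ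
  have hsmooth : ContDiff ℝ 1 Θ.symm := by
    refine Θ.contDiff_symm hd ?_
    rw [hΘ']
    exact contDiff_id.sub ((t • volterra).contDiff.comp (contDiff_superpose g hg))
  -- The trajectory rescaled to unit time solves the integral equation with the constant curve x on
  -- the right. Hence the time-t map is evaluation at 1 after `Θ.symm` after the inclusion of
  -- constants, and inherits smoothness from `Θ.symm`.
  have hcurve : ∀ x, Θ.symm (ContinuousMap.const _ x) =
      unitCurve (fun τ => φ (t * τ) x)
        ((h.continuous_curve x).comp (continuous_const.mul continuous_id)) := by
    intro x
    rw [Θ.symm_apply_eq, hΘ]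
    have hder : ∀ s, HasDerivAt (fun τ => φ (t * τ) x) (t • G (φ (t * s) x)) s := by
      intro s
      have := (h.deriv x (t * s)).scomp s ((hasDerivAt_id s).const_mul t)
      simpa [Function.comp_def] using this
    have hc : Continuous fun τ => φ (t * τ) x :=
      (h.continuous_curve x).comp (continuous_const.mul continuous_id)
    have hv := volterra_unitCurve hder hc ((hG.continuous.comp hc).const_smul t)
    rw [← map_smul]
    have : t • superpose g (unitCurve (fun τ => φ (t * τ) x) hc) =
        unitCurve (fun τ => t • G (φ (t * τ) x)) ((hG.continuous.comp hc).const_smul t) := rfl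
    rw [this, hv]
    simp [h.zero]
  have hφ : ∀ x, φ t x = ContinuousMap.evalCLM ℝ (1 : Icc (0 : ℝ) 1)
      (Θ.symm (ContinuousLinearMap.const ℝ (Icc (0 : ℝ) 1) x)) := by
    intro x
    have : (ContinuousLinearMap.const ℝ (Icc (0 : ℝ) 1) x : C(Icc (0 : ℝ) 1, V)) =
      ContinuousMap.const _ x := rfl
    rw [this, hcurve]
    change φ t x = φ (t * ((1 : Icc (0 : ℝ) 1) : ℝ)) x
    simp
  have hφ' : φ t = fun x => ContinuousMap.evalCLM ℝ (1 : Icc (0 : ℝ) 1)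
      (Θ.symm (ContinuousLinearMap.const ℝ (Icc (0 : ℝ) 1) x)) := funext hφ
  refine ⟨?_, fun {p A} hp hA => ?_⟩
  · rw [hφ']
    exact (ContinuousLinearMap.contDiff _).comp
      (hsmooth.comp (ContinuousLinearMap.contDiff _))
  · have hp' : Θ.symm (ContinuousLinearMap.const ℝ (Icc (0 : ℝ) 1) p) =
        ContinuousMap.const _ p := by
      change Θ.symm (ContinuousMap.const _ p) = _
      rw [hcurve]
      ext τ
      exact h.fixed hK hp _
    have h1 : HasFDerivAt Θ.symm
        ((volterraEquiv g hg hK ht (ContinuousMap.const _ p)).symm :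
          C(Icc (0 : ℝ) 1, V) →L[ℝ] C(Icc (0 : ℝ) 1, V))
        (ContinuousLinearMap.const ℝ (Icc (0 : ℝ) 1) p) := by
      refine Θ.toOpenPartialHomeomorph.hasFDerivAt_symm (mem_univ _) ?_
      change HasFDerivAt Θ _ (Θ.symm _)
      rw [hp']
      exact hd _
    have h2 := (ContinuousMap.evalCLM ℝ (M := V) (1 : Icc (0 : ℝ) 1)).hasFDerivAt.comp p
      (h1.comp p (ContinuousLinearMap.const ℝ (M := V) (Icc (0 : ℝ) 1)).hasFDerivAt)
    rw [hφ']
    refine h2.congr_fderiv ?_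
    ext v
    have hexp : ∀ s, HasDerivAt (fun τ : ℝ => NormedSpace.exp ((t * τ) • A) v)
        (t • A (NormedSpace.exp ((t * s) • A) v)) s := by
      intro s
      have h3 := (hasDerivAt_exp_smul_const' A (t * s)).scomp s ((hasDerivAt_id s).const_mul t)
      have h4 := h3.clm_apply (hasDerivAt_const s v)
      simpa [Function.comp_def] using h4
    have hc : Continuous fun τ : ℝ => NormedSpace.exp ((t * τ) • A) v :=
      continuous_iff_continuousAt.2 fun s => (hexp s).continuousAt
    have hv := volterra_unitCurve hexp hc ((A.continuous.comp hc).const_smul t)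
    -- At an equilibrium the linearised integral equation has constant coefficient A, and τ ↦
    -- e^{tτA}v solves it with right-hand side v.
    have hw : (volterraEquiv g hg hK ht (ContinuousMap.const _ p)).symm
        (ContinuousMap.const _ v) = unitCurve _ hc := by
      rw [ContinuousLinearEquiv.symm_apply_eq, volterraEquiv_apply, ← map_smul]
      have : t • pointwiseApply (superpose (fderivMap g hg) (ContinuousMap.const _ p))
          (unitCurve _ hc) = unitCurve (fun s => t • A (NormedSpace.exp ((t * s) • A) v))
            ((A.continuous.comp hc).const_smul t) := by
        ext τ
        simp only [ContinuousMap.smul_apply, pointwiseApply_apply, superpose_apply, fderivMap,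
          ContinuousMap.coe_mk, ContinuousMap.const_apply, unitCurve]
        rw [← hA]; rfl
      rw [this, hv]
      simp
    change (volterraEquiv g hg hK ht (ContinuousMap.const _ p)).symm
        (ContinuousMap.const _ v) 1 = _
    rw [hw]
    change NormedSpace.exp ((t * ((1 : Icc (0 : ℝ) 1) : ℝ)) • A) v = _
    simp

/-- The group property writes the time-t map as the n-th iterate of the time-t/n map, and for large
n the short-time result applies. -/
lemma contDiff (h : IsFlow G φ) (hG : ContDiff ℝ 1 G) (hK : LipschitzWith K G) (t : ℝ) :
    ContDiff ℝ 1 (φ t) := by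
  obtain ⟨n, hn⟩ := exists_nat_gt (|t| * K)
  have hn0 : (0 : ℝ) < n := lt_of_le_of_lt (by positivity) hn
  have hsmall : ContDiff ℝ 1 (φ (t / n)) := by
    refine (h.contDiff_of_small hG hK ?_).1
    rw [abs_div, Nat.abs_cast, div_mul_eq_mul_div, div_lt_one hn0]
    exact hn
  have hmul : ∀ m : ℕ, ContDiff ℝ 1 (φ (m * (t / n))) := by
    intro m
    induction m with
    | zero =>
      have : φ ((0 : ℕ) * (t / n)) = id := by
        ext x; simp [h.zero]
      rw [this]; exact contDiff_id
    | succ m ih =>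
      have : φ ((m + 1 : ℕ) * (t / n)) = fun x => φ (t / n) (φ (m * (t / n)) x) := by
        ext x
        rw [← h.add hK]; congr 1; push_cast; ring
      rw [this]
      exact hsmall.comp ih
  have := hmul n
  rwa [mul_div_cancel₀ _ hn0.ne'] at this

end IsFlow

end Flow

/-! ### Convergent sequences -/

section ConvergentSequences

variable {V : Type*} [NormedAddCommGroup V] [NormedSpace ℝ V]

/-- Convergent sequences in `V`, together with their limits. -/
abbrev ConvSeq (V : Type*) [TopologicalSpace V] := C(OnePoint ℕ, V)

omit [NormedSpace ℝ V] in
lemma ConvSeq.tendsto (x : ConvSeq V) :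
    Tendsto (fun n : ℕ => x (n : OnePoint ℕ)) atTop (𝓝 (x OnePoint.infty)) :=
  (OnePoint.continuous_iff_from_nat x).1 x.continuous

omit [NormedSpace ℝ V] in
lemma ConvSeq.ext' {x y : ConvSeq V} (h : ∀ n : ℕ, x (n : OnePoint ℕ) = y (n : OnePoint ℕ)) :
    x = y := by
  ext k
  induction k using OnePoint.rec with
  | coe n => exact h n
  | infty => exact tendsto_nhds_unique (x.tendsto.congr h) y.tendsto

omit [NormedSpace ℝ V] in
lemma ConvSeq.norm_le {x : ConvSeq V} {C : ℝ} (hC : 0 ≤ C)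
    (h : ∀ n : ℕ, ‖x (n : OnePoint ℕ)‖ ≤ C) : ‖x‖ ≤ C := by
  rw [ContinuousMap.norm_le _ hC, OnePoint.forall]
  exact ⟨le_of_tendsto' x.tendsto.norm h, h⟩

/-- A convergent sequence as a continuous map. -/
def ConvSeq.mk (u : ℕ → V) (a : V) (h : Tendsto u atTop (𝓝 a)) : ConvSeq V :=
  OnePoint.continuousMapMkNat u a h

omit [NormedSpace ℝ V] in
@[simp] lemma ConvSeq.mk_coe (u : ℕ → V) (a : V) (h : Tendsto u atTop (𝓝 a)) (n : ℕ) :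
    ConvSeq.mk u a h (n : OnePoint ℕ) = u n := rfl

/-- The left shift. -/
def shiftLeft : ConvSeq V →L[ℝ] ConvSeq V :=
  LinearMap.mkContinuous
    { toFun := fun x => ConvSeq.mk (fun n => x ((n + 1 : ℕ) : OnePoint ℕ)) (x OnePoint.infty)
        (x.tendsto.comp (tendsto_add_atTop_nat 1))
      map_add' := fun x y => ConvSeq.ext' fun n => rfl
      map_smul' := fun c x => ConvSeq.ext' fun n => rfl } 1
    (fun x => ConvSeq.norm_le (by positivity) fun n => by
      rw [one_mul]; exact x.norm_coe_le_norm _)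

lemma norm_shiftLeft_le : ‖(shiftLeft : ConvSeq V →L[ℝ] ConvSeq V)‖ ≤ 1 :=
  LinearMap.mkContinuous_norm_le _ zero_le_one _

/-- The right shift, which inserts a zero. -/
def shiftRight : ConvSeq V →L[ℝ] ConvSeq V :=
  LinearMap.mkContinuous
    { toFun := fun x => ConvSeq.mk (fun n => Nat.casesOn n 0 fun m => x (m : OnePoint ℕ))
        (x OnePoint.infty) ((tendsto_add_atTop_iff_nat 1).1 x.tendsto)
      map_add' := fun x y => ConvSeq.ext' fun n => by
        cases n
        · exact (add_zero (0 : V)).symm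
        · rfl
      map_smul' := fun c x => ConvSeq.ext' fun n => by
        cases n
        · exact (smul_zero c).symm
        · rfl } 1
    (fun x => ConvSeq.norm_le (by positivity) fun n => by
      cases n
      · simp
      · rw [one_mul]; exact x.norm_coe_le_norm _)

lemma norm_shiftRight_le : ‖(shiftRight : ConvSeq V →L[ℝ] ConvSeq V)‖ ≤ 1 :=
  LinearMap.mkContinuous_norm_le _ zero_le_one _

/-- The sequence `(v, 0, 0, …)`. -/
def initial : V →L[ℝ] ConvSeq V :=
  LinearMap.mkContinuous
    { toFun := fun v => ConvSeq.mk (fun n => Nat.casesOn n v fun _ => 0) 0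
        ((tendsto_add_atTop_iff_nat 1).1 tendsto_const_nhds)
      map_add' := fun x y => ConvSeq.ext' fun n => by
        cases n
        · rfl
        · exact (add_zero (0 : V)).symm
      map_smul' := fun c x => ConvSeq.ext' fun n => by
        cases n
        · rfl
        · exact (smul_zero c).symm } 1
    (fun x => ConvSeq.norm_le (by positivity) fun n => by
      cases n <;> simp)

@[simp] lemma initial_zero (v : V) : initial v ((0 : ℕ) : OnePoint ℕ) = v := rfl

@[simp] lemma initial_succ (v : V) (n : ℕ) : initial v ((n + 1 : ℕ) : OnePoint ℕ) = 0 := rfl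

/-- Termwise application of a linear map. -/
def termwise (L : V →L[ℝ] V) : ConvSeq V →L[ℝ] ConvSeq V :=
  LinearMap.mkContinuous
    { toFun := fun x => (L : C(V, V)).comp x
      map_add' := fun x y => ConvSeq.ext' fun n => map_add L _ _
      map_smul' := fun c x => ConvSeq.ext' fun n => map_smul L _ _ } ‖L‖
    (fun x => ConvSeq.norm_le (by positivity) fun n =>
      (L.le_opNorm _).trans (mul_le_mul_of_nonneg_left (x.norm_coe_le_norm _) (norm_nonneg _)))

lemma norm_termwise_le (L : V →L[ℝ] V) : ‖termwise L‖ ≤ ‖L‖ :=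
  LinearMap.mkContinuous_norm_le _ (norm_nonneg _) _

lemma termwise_pow (L : V →L[ℝ] V) (n : ℕ) : termwise L ^ n = termwise (L ^ n) := by
  induction n with
  | zero => ext x k; rfl
  | succ n ih => rw [pow_succ, ih, pow_succ]; rfl

/-- Some power has norm below 1, so 1 - xⁿ is invertible by the Neumann series, and 1 - x is a
factor of it. Using powers avoids a norm adapted to the splitting. -/
lemma isUnit_one_sub_of_tendsto_pow {R : Type*} [NormedRing R] [CompleteSpace R] {x : R}
    (h : Tendsto (fun n : ℕ => x ^ n) atTop (𝓝 0)) : IsUnit (1 - x) := by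
  obtain ⟨n, hn⟩ := ((tendsto_zero_iff_norm_tendsto_zero.1 h).eventually
    (gt_mem_nhds zero_lt_one)).exists
  have h1 : IsUnit (1 - x ^ n) := (Units.oneSub (x ^ n) hn).isUnit
  rw [← mul_neg_geom_sum] at h1
  refine ((Commute.isUnit_mul_iff ?_).1 h1).1
  rw [commute_iff_eq, mul_neg_geom_sum, geom_sum_mul_neg]

lemma eq_zero_of_tendsto_pow [CompleteSpace V] {L : V →L[ℝ] V}
    (h : Tendsto (fun n : ℕ => L ^ n) atTop (𝓝 0)) {v : V} (hv : L v = v) : v = 0 := by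
  obtain ⟨u, hu⟩ := isUnit_one_sub_of_tendsto_pow h
  have h1 : (u : V →L[ℝ] V) v = 0 := by rw [hu]; exact sub_eq_zero.2 hv.symm
  have h2 : ((↑u⁻¹ : V →L[ℝ] V) * (u : V →L[ℝ] V)) v = v := by rw [u.inv_mul]; rfl
  rw [← h2]
  change (↑u⁻¹ : V →L[ℝ] V) ((u : V →L[ℝ] V) v) = 0
  rw [h1, map_zero]

/-- Since S commutes with the termwise action, the n-th power of the product has norm at most ‖Lⁿ‖,
as S is a contraction. -/
lemma isUnit_one_sub_mul_termwise [CompleteSpace V] {S : ConvSeq V →L[ℝ] ConvSeq V}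
    (hS : ‖S‖ ≤ 1) {L : V →L[ℝ] V} (hcomm : Commute S (termwise L))
    (h : Tendsto (fun n : ℕ => L ^ n) atTop (𝓝 0)) : IsUnit (1 - S * termwise L) := by
  apply isUnit_one_sub_of_tendsto_pow
  refine squeeze_zero_norm (fun n => ?_) (tendsto_zero_iff_norm_tendsto_zero.1 h)
  rw [hcomm.mul_pow, termwise_pow]
  refine (ContinuousLinearMap.opNorm_comp_le _ _).trans ?_
  calc ‖S ^ n‖ * ‖termwise (L ^ n)‖ ≤ 1 * ‖L ^ n‖ := by
        refine mul_le_mul ?_ (norm_termwise_le _) (norm_nonneg _) zero_le_one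
        rcases n.eq_zero_or_pos with rfl | hn
        · exact ContinuousLinearMap.norm_id_le
        · exact (norm_pow_le' S hn).trans (pow_le_one₀ (norm_nonneg _) hS)
    _ = _ := one_mul _

end ConvergentSequences

/-! ### The stable manifold of a fixed point of a map -/

section FixedPoint

variable {V : Type*} [NormedAddCommGroup V] [NormedSpace ℝ V] [FiniteDimensional ℝ V]

/-- **Stable manifold theorem for a map** `g` with a hyperbolic fixed point `p`, in terms of
orbits: the orbits near `p` that converge to `p` are parametrised by their stable components. -/
theorem exists_stable_orbits {g : V → V} (hg : ContDiff ℝ 1 g) {p : V} (hp : g p = p)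
    {B C P : V →L[ℝ] V} (hB : HasFDerivAt g B p) (hPP : P * P = P) (hPB : P * B = B * P)
    (hCP : C * P = 0) (hPC : P * C = 0) (hCB : C * B = 1 - P) (hBC : B * C = 1 - P)
    (hs : Tendsto (fun n : ℕ => (B * P) ^ n) atTop (𝓝 0))
    (hu : Tendsto (fun n : ℕ => C ^ n) atTop (𝓝 0)) :
    ∃ (Ω : Set V) (X : V → ConvSeq V) (δ : ℝ), IsOpen Ω ∧ p ∈ Ω ∧ 0 < δ ∧
      ContDiffOn ℝ 1 X Ω ∧ (∀ y, P y ∈ Ω ↔ y ∈ Ω) ∧ (∀ y, X (P y) = X y) ∧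
      X p = ContinuousMap.const _ p ∧
      (∀ y ∈ Ω, P (X y (0 : ℕ)) = P y ∧ X y OnePoint.infty = p ∧
        ∀ n : ℕ, X y (n + 1 : ℕ) = g (X y n)) ∧
      ∀ x : ConvSeq V, dist x (ContinuousMap.const _ p) < δ →
        (∀ n : ℕ, x (n + 1 : ℕ) = g (x n)) → x (0 : ℕ) ∈ Ω ∧ X (x (0 : ℕ)) = x := by
  have : CompleteSpace V := FiniteDimensional.complete ℝ V
  let gc : C(V, V) := ⟨g, hg.continuous⟩
  have hgc : ContDiff ℝ 1 gc := hg
  -- The P-part of each entry compares x_{n+1} with g(x_n), looking forwards; the C-part makes the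
  -- same comparison one index later after inverting B on the unstable directions. As PC = 0 and Cv
  -- = 0 implies v = Pv, the two parts can be separated, and Θx = (Pv, 0, 0, …) says exactly that x
  -- is an orbit with Px₀ = Pv.
  let Θ : ConvSeq V → ConvSeq V := fun x =>
    (termwise P x - shiftRight (termwise P (superpose gc x))) +
      (termwise C (superpose gc x) - shiftLeft (termwise C x))
  have hΘ0 : ∀ x, Θ x (0 : ℕ) = P (x (0 : ℕ)) + C (g (x (0 : ℕ)) - x (1 : ℕ)) := by
    intro x; rw [map_sub]; change P _ - 0 + (C _ - C _) = _; rw [sub_zero]; rfl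
  have hΘs : ∀ x (n : ℕ), Θ x (n + 1 : ℕ) = P (x (n + 1 : ℕ) - g (x n)) +
      C (g (x (n + 1 : ℕ)) - x (n + 2 : ℕ)) := by
    intro x n; rw [map_sub, map_sub]; rfl
  have happ : ∀ {L M N : V →L[ℝ] V}, L * M = N → ∀ v, L (M v) = N v := by
    rintro L M N rfl v; rfl
  have hPP' := happ hPP
  have hCP' : ∀ v, C (P v) = 0 := happ hCP
  have hPC' : ∀ v, P (C v) = 0 := happ hPC
  have hC0 : ∀ v, C v = 0 → v = P v := by
    intro v hv
    have := happ hBC v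
    rw [hv, map_zero] at this
    exact sub_eq_zero.1 this.symm
  have horbit : ∀ x v, Θ x = initial (P v) ↔ P (x (0 : ℕ)) = P v ∧
      ∀ n : ℕ, x (n + 1 : ℕ) = g (x n) := by
    intro x v
    constructor
    · intro h
      have h0 : P (x (0 : ℕ)) + C (g (x (0 : ℕ)) - x (1 : ℕ)) = P v := by rw [← hΘ0, h]; rfl
      have hn : ∀ n : ℕ, P (x (n + 1 : ℕ) - g (x n)) +
          C (g (x (n + 1 : ℕ)) - x (n + 2 : ℕ)) = 0 := by
        intro n; rw [← hΘs, h]; rfl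
      have hP0 : P (x (0 : ℕ)) = P v := by
        have := congrArg P h0
        rwa [map_add, hPC', add_zero, hPP', hPP'] at this
      have hPn : ∀ n : ℕ, P (x (n + 1 : ℕ) - g (x n)) = 0 := by
        intro n
        have := congrArg P (hn n)
        rwa [map_add, hPC', add_zero, hPP', map_zero] at this
      have hCn : ∀ n : ℕ, C (g (x n) - x (n + 1 : ℕ)) = 0 := by
        intro n
        cases n with
        | zero => rw [hP0] at h0; simpa using h0
        | succ n => have := hn n; rwa [hPn, zero_add] at this
      refine ⟨hP0, fun n => ?_⟩
      have h1 := hC0 _ (hCn n)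
      have h2 : P (g (x n) - x (n + 1 : ℕ)) = 0 := by
        rw [← neg_sub, map_neg, hPn, neg_zero]
      rw [h2] at h1
      exact (sub_eq_zero.1 h1).symm
    · rintro ⟨h0, hn⟩
      refine ConvSeq.ext' fun n => ?_
      cases n with
      | zero => rw [hΘ0, hn 0, sub_self, map_zero, add_zero, initial_zero, h0]
      | succ n => rw [hΘs, hn (n + 1), hn n, sub_self, sub_self, map_zero, map_zero, add_zero,
          initial_succ]
  have hΘ1 : ContDiff ℝ 1 Θ :=
    ((termwise P).contDiff.sub ((shiftRight (V := V)).contDiff.comp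
      ((termwise P).contDiff.comp (contDiff_superpose gc hgc)))).add
      (((termwise C).contDiff.comp (contDiff_superpose gc hgc)).sub
        ((shiftLeft (V := V)).contDiff.comp (termwise C).contDiff))
  set c : ConvSeq V := ContinuousMap.const _ p with hc
  have hΘc : Θ c = initial (P p) := (horbit c p).2 ⟨rfl, fun _ => hp.symm⟩
  -- the derivative at the constant sequence
  have hunit1 : IsUnit (1 - shiftRight * termwise (B * P)) :=
    isUnit_one_sub_mul_termwise norm_shiftRight_le (by
      ext1 x
      refine ConvSeq.ext' fun n => ?_
      cases n with
      | zero => exact (map_zero (B * P)).symm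
      | succ n => rfl) hs
  have hunit2 : IsUnit (1 - shiftLeft * termwise C) :=
    isUnit_one_sub_mul_termwise norm_shiftLeft_le (by
      ext1 x
      exact ConvSeq.ext' fun n => rfl) hu
  -- The derivative of Θ at the constant sequence factors as (1 - shiftRight·BP)(1 - shiftLeft·C):
  -- the identities P + CB = 1, PB = BP and PC = 0 remove the cross terms.
  have hunit := hunit1.mul hunit2
  let Θ' : ConvSeq V ≃L[ℝ] ConvSeq V := ContinuousLinearEquiv.ofUnit hunit.unit
  have hΘ'app : ∀ y, Θ' y = (1 - shiftRight * termwise (B * P) : ConvSeq V →L[ℝ] ConvSeq V)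
      ((1 - shiftLeft * termwise C : ConvSeq V →L[ℝ] ConvSeq V) y) :=
    fun y => rfl
  have hsup : superpose (fderivMap gc hgc) c = ContinuousMap.const (OnePoint ℕ) B := by
    ext1 k
    exact hB.fderiv
  have hgd : HasFDerivAt (superpose gc : ConvSeq V → ConvSeq V) (termwise B) c := by
    have := hasFDerivAt_superpose gc hgc c
    rw [hsup] at this
    exact this
  have hΘd : HasFDerivAt Θ (Θ' : ConvSeq V →L[ℝ] ConvSeq V) c := by
    have h1 := (((termwise P).hasFDerivAt (x := c)).sub (shiftRight.hasFDerivAt.comp c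
      ((termwise P).hasFDerivAt.comp c hgd))).add
      (((termwise C).hasFDerivAt.comp c hgd).sub
        (shiftLeft.hasFDerivAt.comp c (termwise C).hasFDerivAt))
    refine h1.congr_fderiv ?_
    ext1 y
    have hCB' : ∀ v, C (B v) = v - P v := happ hCB
    have hPB' : ∀ v, P (B v) = B (P v) := happ hPB
    rw [ContinuousLinearEquiv.coe_coe, hΘ'app]
    refine ConvSeq.ext' fun n => ?_
    cases n with
    | zero =>
      change P (y (0 : ℕ)) - 0 + (C (B (y (0 : ℕ))) - C (y (1 : ℕ))) =
        (y (0 : ℕ) - C (y (1 : ℕ))) - 0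
      rw [hCB']; abel
    | succ n =>
      change P (y (n + 1 : ℕ)) - P (B (y n)) + (C (B (y (n + 1 : ℕ))) - C (y (n + 2 : ℕ))) =
        (y (n + 1 : ℕ) - C (y (n + 2 : ℕ))) - B (P (y n - C (y (n + 1 : ℕ))))
      rw [hCB', map_sub P, hPC', hPB', sub_zero]; abel
  -- the inverse function theorem
  let e := hΘ1.contDiffAt.toOpenPartialHomeomorph Θ hΘd one_ne_zero
  have he : ∀ x, e x = Θ x := fun x => rfl
  have hce : c ∈ e.source := hΘ1.contDiffAt.mem_toOpenPartialHomeomorph_source hΘd one_ne_zero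
  have het : Θ c ∈ e.target := e.map_source hce
  have hsc : e.symm (Θ c) = c := e.left_inv hce
  have hsymm : ContDiffAt ℝ 1 e.symm (Θ c) :=
    e.contDiffAt_symm het (by rw [hsc]; exact hΘd) hΘ1.contDiffAt
  obtain ⟨N, hNs, hNo, hcN⟩ := eventually_nhds_iff.1
    ((hsymm.eventually (by decide)).and (e.open_target.mem_nhds het))
  -- `p` is an isolated fixed point
  have hinj : ((B - 1 : V →L[ℝ] V) : V →ₗ[ℝ] V).ker = ⊥ := by
    rw [LinearMap.ker_eq_bot']
    intro v hv
    have hBv : B v = v := sub_eq_zero.1 hv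
    have e1 : P v = 0 := by
      refine eq_zero_of_tendsto_pow hs ?_
      change B (P (P v)) = P v
      rw [hPP']
      exact (happ hPB v).symm.trans (congrArg P hBv)
    have e2 : v - P v = 0 := by
      refine eq_zero_of_tendsto_pow hu ?_
      rw [map_sub, hCP', sub_zero]
      nth_rewrite 1 [← hBv]
      exact happ hCB v
    rw [e1, sub_zero] at e2
    exact e2
  obtain ⟨W, hWs, hWo, hpW⟩ : ∃ W : Set V, (∀ v ∈ W, g v = v → v = p) ∧ IsOpen W ∧ p ∈ W := by
    obtain ⟨κ, -, hκ⟩ := LinearMap.exists_antilipschitzWith _ hinj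
    have h1 : HasFDerivAt (fun v => g v - v) (B - 1) p := hB.sub (hasFDerivAt_id p)
    have h2 := h1.eventually_ne (c := 0) ⟨κ, hκ⟩
    rw [eventually_nhdsWithin_iff, eventually_nhds_iff] at h2
    obtain ⟨W, h3, h4, h5⟩ := h2
    refine ⟨W, fun v hv hgv => ?_, h4, h5⟩
    by_contra hne
    exact h3 v hv hne (sub_eq_zero.2 hgv)
  let X : V → ConvSeq V := fun y => e.symm (initial (P y))
  let Ω₀ : Set V := {y | initial (P y) ∈ N}
  have hΩ₀ : IsOpen Ω₀ := hNo.preimage (initial.continuous.comp P.continuous)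
  have hX1 : ContDiffOn ℝ 1 X Ω₀ := by
    intro y hy
    have h1 : ContDiffAt ℝ 1 e.symm (initial (P y)) := (hNs _ hy).1
    exact (h1.comp y (initial.contDiff.comp P.contDiff).contDiffAt).contDiffWithinAt
  let Ω : Set V := Ω₀ ∩ X ⁻¹' {x | x OnePoint.infty ∈ W}
  have hWopen : IsOpen {x : ConvSeq V | x OnePoint.infty ∈ W} :=
    hWo.preimage (ContinuousMap.evalCLM ℝ (M := V) OnePoint.infty).continuous
  have hΩ : IsOpen Ω := hX1.continuousOn.isOpen_inter_preimage hΩ₀ hWopen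
  have hXp : X p = c := by change e.symm (initial (P p)) = c; rw [← hΘc, hsc]
  have hXP : ∀ y, X (P y) = X y := fun y => by
    change e.symm (initial (P (P y))) = e.symm (initial (P y)); rw [hPP']
  have hpΩ : p ∈ Ω := by
    refine ⟨?_, ?_⟩
    · change initial (P p) ∈ N
      rw [← hΘc]; exact hcN
    · change X p OnePoint.infty ∈ W
      rw [hXp]; exact hpW
  have hnear : ∀ᶠ x in 𝓝 c, x ∈ e.source ∧ Θ x ∈ N ∧ x OnePoint.infty ∈ W :=
    Filter.Eventually.and (e.open_source.mem_nhds hce)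
      (((hΘ1.continuous.tendsto c).eventually (hNo.mem_nhds hcN)).and (hWopen.mem_nhds hpW))
  obtain ⟨δ, hδ, hball⟩ := Metric.eventually_nhds_iff.1 hnear
  refine ⟨Ω, X, δ, hΩ, hpΩ, hδ, hX1.mono inter_subset_left, fun y => ?_, hXP, hXp, fun y hy => ?_,
    fun x hx hn => ?_⟩
  · change initial (P (P y)) ∈ N ∧ X (P y) OnePoint.infty ∈ W ↔ _
    rw [hPP', hXP]; rfl
  · have h1 : Θ (X y) = initial (P y) := e.right_inv (hNs _ hy.1).2
    obtain ⟨h2, h3⟩ := (horbit _ _).1 h1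
    refine ⟨h2, hWs _ hy.2 ?_, h3⟩
    have h4 := (X y).tendsto
    have h5 := h4.comp (tendsto_add_atTop_nat 1)
    have h6 := (hg.continuous.tendsto _).comp h4
    exact tendsto_nhds_unique (h6.congr fun n => (h3 n).symm) h5
  · obtain ⟨h1, h2, h3⟩ := hball hx
    have h4 : Θ x = initial (P (x (0 : ℕ))) := (horbit _ _).2 ⟨rfl, hn⟩
    have h5 : X (x (0 : ℕ)) = x := by
      change e.symm (initial (P (x (0 : ℕ)))) = x
      rw [← h4]; exact e.left_inv h1
    refine ⟨⟨?_, ?_⟩, h5⟩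
    · change initial (P (x (0 : ℕ))) ∈ N
      rw [← h4]; exact h2
    · change X (x (0 : ℕ)) OnePoint.infty ∈ W
      rw [h5]; exact h3

end FixedPoint

/-! ### Iterates of the time-t maps of a linear dichotomy -/

section DichotomyPowers

variable {V : Type*} [NormedAddCommGroup V] [NormedSpace ℝ V] [CompleteSpace V]

lemma exp_smul_pow (A : V →L[ℝ] V) (t : ℝ) (n : ℕ) :
    NormedSpace.exp (t • A) ^ n = NormedSpace.exp ((n * t) • A) := by
  let _ : NormedAlgebra ℚ (V →L[ℝ] V) := NormedAlgebra.restrictScalars ℚ ℝ _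
  rw [← NormedSpace.exp_nsmul, mul_smul, Nat.cast_smul_eq_nsmul]

lemma exp_neg_smul_mul (A : V →L[ℝ] V) (t : ℝ) :
    NormedSpace.exp (-t • A) * NormedSpace.exp (t • A) = 1 := by
  let _ : NormedAlgebra ℚ (V →L[ℝ] V) := NormedAlgebra.restrictScalars ℚ ℝ _
  rw [← NormedSpace.exp_add_of_commute]
  · rw [← add_smul]; simp
  · exact ((Commute.refl A).smul_left _).smul_right _

omit [CompleteSpace V] in
lemma IsDichotomy.commute_exp {A P : V →L[ℝ] V} (h : IsDichotomy A P) (t : ℝ) :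
    Commute (NormedSpace.exp (t • A)) P := by
  let _ : NormedAlgebra ℚ (V →L[ℝ] V) := NormedAlgebra.restrictScalars ℚ ℝ _
  exact Commute.exp_left (Commute.smul_left h.comm t)

lemma IsDichotomy.tendsto_pow {A P : V →L[ℝ] V} (h : IsDichotomy A P) {t : ℝ} (ht : 0 < t) :
    Tendsto (fun n : ℕ => (NormedSpace.exp (t • A) * P) ^ n) atTop (𝓝 0) := by
  have h1 := h.stable.comp (tendsto_natCast_atTop_atTop.atTop_mul_const ht)
  refine h1.congr' ?_
  -- The exponent 0 is excluded: the power is then 1, whereas e^{0}P = P.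
  filter_upwards [eventually_gt_atTop 0] with n hn
  obtain ⟨m, rfl⟩ : ∃ m, n = m + 1 := ⟨n - 1, by omega⟩
  rw [(h.commute_exp t).mul_pow, exp_smul_pow, IsIdempotentElem.pow_succ_eq m h.idem]
  rfl

end DichotomyPowers

/-! ### Cutting off a vector field -/

section Cutoff

variable {V : Type*} [NormedAddCommGroup V] [NormedSpace ℝ V] [FiniteDimensional ℝ V]

/-- A `C¹` vector field agrees on a given ball with a vector field that has a global flow. -/
lemma exists_isFlow_eqOn {F : V → V} (hF : ContDiff ℝ 1 F) (p : V) {R : ℝ} (hR : 0 < R) :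
    ∃ (G : V → V) (K : NNReal) (φ : ℝ → V → V), ContDiff ℝ 1 G ∧ LipschitzWith K G ∧
      IsFlow G φ ∧ ∀ x ∈ Metric.closedBall p R, G x = F x := by
  have : CompleteSpace V := FiniteDimensional.complete ℝ V
  -- The bump is 1 on the ball of radius R. Compact support makes the product with F bounded and
  -- Lipschitz.
  let b : ContDiffBump p := ⟨R, R + 1, hR, by linarith⟩
  let b' : V → ℝ := b
  have hb : ContDiff ℝ 1 b' := b.contDiff (n := 1)
  have hG : ContDiff ℝ 1 (b' • F) := hb.smul hF
  have hc : HasCompactSupport (b' • F) := HasCompactSupport.smul_right b.hasCompactSupport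
  obtain ⟨K, hK⟩ := hG.lipschitzWith_of_hasCompactSupport hc one_ne_zero
  obtain ⟨L, hL⟩ := hc.exists_bound_of_continuous hG.continuous
  obtain ⟨φ, hφ⟩ := exists_isFlow (L := L.toNNReal) hK fun x => (hL x).trans (Real.le_coe_toNNReal L)
  refine ⟨b' • F, K, φ, hG, hK, hφ, fun x hx => ?_⟩
  have : b' x = 1 := b.one_of_mem_closedBall hx
  simp [this]

-- On the compact time interval the trajectory keeps a positive distance from the complement of the
-- ball, and by Gronwall nearby trajectories separate by at most a factor e^{KT}.
omit [FiniteDimensional ℝ V] in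
lemma IsFlow.isOpen_setOf_mem_ball {G : V → V} {φ : ℝ → V → V} {K : NNReal} (h : IsFlow G φ)
    (hK : LipschitzWith K G) (p : V) (δ T : ℝ) :
    IsOpen {v | ∀ t ∈ Icc 0 T, φ t v ∈ Metric.ball p δ} := by
  rcases lt_or_ge T 0 with hT | hT
  · simp [Icc_eq_empty_of_lt hT]
  rw [Metric.isOpen_iff]
  intro v hv
  obtain ⟨t₀, ht₀, hmax⟩ := isCompact_Icc.exists_isMaxOn (nonempty_Icc.2 hT)
    ((h.continuous_curve v).dist continuous_const (f := fun t => φ t v) (g := fun _ => p)).continuousOn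
  have hm : 0 < δ - dist (φ t₀ v) p := sub_pos.2 (hv t₀ ht₀)
  refine ⟨(δ - dist (φ t₀ v) p) / Real.exp (K * T), by positivity, fun w hw t ht => ?_⟩
  have h1 := h.dist_le hK w v ht.1
  have h2 : dist w v * Real.exp (K * t) < δ - dist (φ t₀ v) p := by
    calc dist w v * Real.exp (K * t) ≤ dist w v * Real.exp (K * T) := by
          have := ht.2
          gcongr
      _ < _ := by rwa [Metric.mem_ball, lt_div_iff₀ (Real.exp_pos _)] at hw
  have h3 : dist (φ t v) p ≤ dist (φ t₀ v) p := hmax ht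
  calc dist (φ t w) p ≤ dist (φ t w) (φ t v) + dist (φ t v) p := dist_triangle _ _ _
    _ < δ := by linarith

end Cutoff

/-! ### The local stable manifold of an equilibrium -/

section LocalStable

variable {V : Type*} [NormedAddCommGroup V] [InnerProductSpace ℝ V]

lemma IsSolution.mono {F : V → V} {X Y : Set V} {γ : ℝ → V} {I J : Set ℝ}
    (h : IsSolution F X γ I) (hJ : J ⊆ I) (hX : X ⊆ Y) : IsSolution F Y γ J :=
  fun t ht => ⟨hX (h t (hJ ht)).1, (h t (hJ ht)).2.mono hJ⟩

lemma IsSolution.comp_add {F : V → V} {X : Set V} {γ : ℝ → V} (h : IsSolution F X γ (Ici 0))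
    {s : ℝ} (hs : 0 ≤ s) : IsSolution F X (fun t => γ (t + s)) (Ici 0) := by
  intro t ht
  have hts : t + s ∈ Ici (0 : ℝ) := add_nonneg ht hs
  refine ⟨(h _ hts).1, ?_⟩
  have h1 := (h _ hts).2
  have h2 : HasDerivWithinAt (fun t : ℝ => t + s) 1 (Ici 0) t :=
    ((hasDerivAt_id t).add_const s).hasDerivWithinAt
  have h3 := h1.scomp t h2 (fun u hu => add_nonneg hu hs)
  simpa [Function.comp_def] using h3

lemma IsSolution.continuousOn {F : V → V} {X : Set V} {γ : ℝ → V} {I : Set ℝ}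
    (h : IsSolution F X γ I) : ContinuousOn γ I :=
  fun t ht => (h t ht).2.continuousWithinAt

variable {F G : V → V} {φ : ℝ → V → V} {K : NNReal}

lemma IsFlow.eq_of_isSolution (h : IsFlow G φ) (hK : LipschitzWith K G) {S X : Set V}
    (hS : ∀ x ∈ S, G x = F x) {γ : ℝ → V} {T : ℝ} (hγ : IsSolution F X γ (Icc 0 T))
    (hγS : ∀ t ∈ Icc 0 T, γ t ∈ S) : ∀ t ∈ Icc 0 T, γ t = φ t (γ 0) :=
  h.eq_of_hasDerivWithinAt hK fun t ht => by
    rw [hS _ (hγS t ht)]; exact (hγ t ht).2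

lemma IsFlow.isSolution (h : IsFlow G φ) {S : Set V} (hS : ∀ x ∈ S, G x = F x) {y : V}
    {I : Set ℝ} (hy : ∀ t ∈ I, φ t y ∈ S) : IsSolution F univ (fun t => φ t y) I := fun t ht =>
  ⟨mem_univ _, by
    change HasDerivWithinAt _ (F (φ t y)) _ _
    rw [← hS _ (hy t ht)]; exact (h.deriv y t).hasDerivWithinAt⟩

/-- `h` is a `C¹` map on `O` that parametrises a graph over the range of the projection `P`: the
points with `h y = y`. -/
structure IsStableGraph (P : V →L[ℝ] V) (p : V) (O : Set V) (h : V → V) : Prop where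
  isOpen : IsOpen O
  mem : p ∈ O
  proj_mem : ∀ y, P y ∈ O ↔ y ∈ O
  contDiffOn : ContDiffOn ℝ 1 h O
  proj_apply : ∀ y ∈ O, P (h y) = P y
  apply_proj : ∀ y, h (P y) = h y
  apply_self : h p = p

/-- **Local stable manifold theorem**: the local stable set of an equilibrium with an exponential
dichotomy is a `C¹` graph over the stable subspace. -/
theorem exists_localStableSet_eq_graph [FiniteDimensional ℝ V] (hF : ContDiff ℝ 1 F) {p : V}
    (hp : F p = 0) {P : V →L[ℝ] V} (hP : IsDichotomy (fderiv ℝ F p) P) :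
    ∃ δ₀ > 0, ∀ δ, 0 < δ → δ ≤ δ₀ → ∃ (O : Set V) (h : V → V), IsStableGraph P p O h ∧
      localStableSet F univ (Metric.ball p δ) p = {y | y ∈ O ∧ h y = y} := by
  have : CompleteSpace V := FiniteDimensional.complete ℝ V
  obtain ⟨G, K, φ, hG, hK, hφ, hGF⟩ := exists_isFlow_eqOn hF p one_pos
  have hGp : G p = 0 := by rw [hGF p (Metric.mem_closedBall_self zero_le_one), hp]
  set A := fderiv ℝ F p with hA
  have hGA : fderiv ℝ G p = A := by
    refine Filter.EventuallyEq.fderiv_eq ?_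
    filter_upwards [Metric.closedBall_mem_nhds p one_pos] with x hx using hGF x hx
  -- This choice gives ηK < 1, as the short-time formula for the derivative of the flow requires.
  set η : ℝ := 1 / (K + 1) with hη
  have hη0 : 0 < η := by positivity
  have hηK : |η| * K < 1 := by
    rw [abs_of_pos hη0, hη, div_mul_eq_mul_div, one_mul, div_lt_one (by positivity)]
    linarith
  have hfix : ∀ t, φ t p = p := hφ.fixed hK hGp
  have hB := (hφ.contDiff_of_small hG hK hηK).2 hGp hGA
  have hcomm : NormedSpace.exp (-η • A) * P = P * NormedSpace.exp (-η • A) := hP.commute_exp (-η)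
  have hexp1 : NormedSpace.exp (-η • A) * NormedSpace.exp (η • A) = 1 := exp_neg_smul_mul A η
  have hexp2 : NormedSpace.exp (η • A) * NormedSpace.exp (-η • A) = 1 := by
    simpa using exp_neg_smul_mul A (-η)
  have hcB : NormedSpace.exp (η • A) * P = P * NormedSpace.exp (η • A) := hP.commute_exp η
  obtain ⟨Ω, X, δ₁, hΩ, hpΩ, hδ₁, hX1, hPΩ, hXP, hXp, hXorb, hXuniq⟩ :=
    exists_stable_orbits (hφ.contDiff hG hK η) (hfix η) (B := NormedSpace.exp (η • A))
      (C := NormedSpace.exp (-η • A) * (1 - P)) hB hP.idem hcB.symm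
      (by rw [mul_assoc, sub_mul, one_mul, hP.idem, sub_self, mul_zero])
      (by rw [← mul_assoc, ← hcomm, mul_assoc, mul_sub, mul_one, hP.idem, sub_self, mul_zero])
      (by rw [mul_assoc, sub_mul, one_mul, ← hcB, mul_sub, hexp1, ← mul_assoc, hexp1, one_mul])
      (by rw [← mul_assoc, hexp2, one_mul])
      (hP.tendsto_pow hη0) (by simpa using hP.neg.tendsto_pow hη0)
  -- Radius at most 1 keeps orbits where the cut-off field equals F. Halving δ₁ leaves room for the
  -- limit point, where strict inequalities become weak.
  refine ⟨min 1 (δ₁ / 2), by positivity, fun δ hδ hδle => ?_⟩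
  have hδ1 : δ ≤ 1 := hδle.trans (min_le_left _ _)
  have hδδ₁ : δ < δ₁ := by linarith [hδle.trans (min_le_right 1 (δ₁ / 2))]
  have hballGF : ∀ x ∈ Metric.ball p δ, G x = F x := fun x hx =>
    hGF x (Metric.ball_subset_closedBall (Metric.ball_subset_ball hδ1 hx))
  -- Remaining in U at all multiples of η keeps the trajectory in the ball at the intermediate times
  -- as well.
  let U : Set V := {v | ∀ t ∈ Icc 0 η, φ t v ∈ Metric.ball p δ}
  have hU : IsOpen U := hφ.isOpen_setOf_mem_ball hK p δ η
  let O : Set V := Ω ∩ X ⁻¹' {x | MapsTo x univ U}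
  have hO : IsOpen O := hX1.continuousOn.isOpen_inter_preimage hΩ
    (ContinuousMap.isOpen_setOfPred_mapsTo isCompact_univ hU)
  have hpU : p ∈ U := fun t _ => by rw [hfix]; exact Metric.mem_ball_self hδ
  let h : V → V := fun y => X y (0 : ℕ)
  refine ⟨O, h, ⟨hO, ⟨hpΩ, ?_⟩, fun y => ?_, ?_, fun y hy => (hXorb y hy.1).1, fun y => ?_, ?_⟩, ?_⟩
  · change MapsTo (X p) univ U
    rw [hXp]; exact fun _ _ => hpU
  · change P y ∈ Ω ∧ MapsTo (X (P y)) univ U ↔ _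
    rw [hPΩ, hXP]; rfl
  · exact ((ContinuousMap.evalCLM ℝ (M := V) ((0 : ℕ) : OnePoint ℕ)).contDiff.comp_contDiffOn
      hX1).mono inter_subset_left
  · change X (P y) _ = X y _
    rw [hXP]
  · change X p _ = p
    rw [hXp]; rfl
  ext y
  constructor
  · rintro ⟨γ, hγ, rfl, hγball, hγlim⟩
    have hγφ : ∀ t, 0 ≤ t → γ t = φ t (γ 0) := fun t ht =>
      hφ.eq_of_isSolution hK hballGF (hγ.mono Icc_subset_Ici_self subset_rfl)
        (fun s hs => hγball s hs.1) t (right_mem_Icc.2 ht)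
    have hnη : ∀ n : ℕ, 0 ≤ n * η := fun n => by positivity
    let x : ConvSeq V := ConvSeq.mk (fun n => γ (n * η)) p
      (hγlim.comp (tendsto_natCast_atTop_atTop.atTop_mul_const hη0))
    have hx0 : x (0 : ℕ) = γ 0 := by change γ ((0 : ℕ) * η) = γ 0; simp
    have hxd : dist x (ContinuousMap.const _ p) < δ₁ := by
      refine lt_of_le_of_lt ?_ hδδ₁
      rw [dist_eq_norm]
      refine ConvSeq.norm_le hδ.le fun n => ?_
      change ‖γ (n * η) - p‖ ≤ δ
      rw [← dist_eq_norm]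
      exact (hγball _ (hnη n)).le
    obtain ⟨h1, h2⟩ := hXuniq x hxd (fun n => by
      change γ ((n + 1 : ℕ) * η) = φ η (γ (n * η))
      rw [hγφ _ (hnη _), hγφ _ (hnη _), ← hφ.add hK]
      congr 1; push_cast; ring)
    rw [hx0] at h1 h2
    refine ⟨⟨h1, ?_⟩, ?_⟩
    · change MapsTo (X (γ 0)) univ U
      rw [h2]
      intro k _
      induction k using OnePoint.rec with
      | infty => exact hpU
      | coe n =>
        intro t ht
        change φ t (γ (n * η)) ∈ _
        rw [hγφ _ (hnη n), ← hφ.add hK, ← hγφ _ (add_nonneg ht.1 (hnη n))]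
        exact hγball _ (add_nonneg ht.1 (hnη n))
    · change X (γ 0) (0 : ℕ) = γ 0
      rw [h2, hx0]
  · rintro ⟨⟨hyΩ, hyU⟩, hhy⟩
    obtain ⟨-, hinf, horb⟩ := hXorb y hyΩ
    have hyn : ∀ n : ℕ, X y n = φ (n * η) y := by
      intro n
      induction n with
      | zero => rw [Nat.cast_zero, zero_mul, hφ.zero]; exact hhy
      | succ n ih =>
        rw [horb, ih, ← hφ.add hK]; congr 1; push_cast; ring
    -- Each time is a multiple of η plus a remainder in [0, η]. Over the remainder the distance to p
    -- grows by at most e^{Kη}, so convergence along the multiples suffices.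
    have hdecomp : ∀ t, 0 ≤ t → t - ⌊t / η⌋₊ * η ∈ Icc 0 η ∧
        φ t y = φ (t - ⌊t / η⌋₊ * η) (X y (⌊t / η⌋₊ : ℕ)) := by
      intro t ht
      have h1 := Nat.floor_le (div_nonneg ht hη0.le)
      have h2 := Nat.lt_floor_add_one (t / η)
      rw [le_div_iff₀ hη0] at h1
      rw [div_lt_iff₀ hη0] at h2
      refine ⟨⟨by linarith, by linarith⟩, ?_⟩
      rw [hyn, ← hφ.add hK]
      congr 1; ring
    have hball : ∀ t ∈ Ici (0 : ℝ), φ t y ∈ Metric.ball p δ := by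
      intro t ht
      obtain ⟨h1, h2⟩ := hdecomp t ht
      rw [h2]
      exact hyU (mem_univ _) _ h1
    refine ⟨fun t => φ t y, hφ.isSolution hballGF hball, hφ.zero y, hball, ?_⟩
    rw [tendsto_iff_dist_tendsto_zero]
    have hfloor : Tendsto (fun t : ℝ => ⌊t / η⌋₊) atTop atTop :=
      tendsto_nat_floor_atTop.comp (tendsto_id.atTop_div_const hη0)
    have hlim : Tendsto (fun t : ℝ => dist (X y (⌊t / η⌋₊ : ℕ)) p * Real.exp (K * η)) atTop
        (𝓝 0) := by
      have h1 := (X y).tendsto.comp hfloor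
      rw [hinf, tendsto_iff_dist_tendsto_zero] at h1
      simpa using h1.mul_const (Real.exp (K * η))
    refine squeeze_zero' (Eventually.of_forall fun _ => dist_nonneg) ?_ hlim
    filter_upwards [eventually_ge_atTop 0] with t ht
    obtain ⟨h1, h2⟩ := hdecomp t ht
    rw [h2]
    calc _ = dist (φ (t - ⌊t / η⌋₊ * η) (X y (⌊t / η⌋₊ : ℕ))) (φ (t - ⌊t / η⌋₊ * η) p) := by
          rw [hfix]
      _ ≤ _ := hφ.dist_le hK _ _ h1.1
      _ ≤ _ := by
        have := h1.2
        gcongr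

end LocalStable

/-! ### Stable manifolds -/

section StableManifold

variable {V : Type*} [NormedAddCommGroup V] [InnerProductSpace ℝ V]

/-- Solutions of `x' = F(x)` neither enter nor leave `X`. -/
def IsInvariant (F : V → V) (X : Set V) : Prop :=
  ∀ (γ : ℝ → V) (T : ℝ), 0 ≤ T → IsSolution F univ γ (Icc 0 T) → (γ 0 ∈ X ↔ γ T ∈ X)

lemma isInvariant_univ (F : V → V) : IsInvariant F univ := fun _ _ _ _ => Iff.rfl

lemma IsInvariant.isSolution {F : V → V} {X : Set V} (hX : IsInvariant F X) {γ : ℝ → V}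
    (hγ : IsSolution F univ γ (Ici 0)) (h0 : γ 0 ∈ X) : IsSolution F X γ (Ici 0) := fun t ht =>
  ⟨(hX γ t ht (hγ.mono Icc_subset_Ici_self subset_rfl)).1 h0, (hγ t ht).2⟩

lemma IsInvariant.localStableSet_eq {F : V → V} {X : Set V} (hX : IsInvariant F X) (U : Set V)
    (p : V) : localStableSet F X U p = localStableSet F univ U p ∩ X := by
  ext x
  constructor
  · rintro ⟨γ, hγ, rfl, h1, h2⟩
    exact ⟨⟨γ, hγ.mono subset_rfl (subset_univ _), rfl, h1, h2⟩, (hγ 0 self_mem_Ici).1⟩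
  · rintro ⟨⟨γ, hγ, rfl, h1, h2⟩, h3⟩
    exact ⟨γ, hX.isSolution hγ h3, rfl, h1, h2⟩

/-- Near `p`, the set `X` is a neighbourhood of `p` or a half-space whose boundary hyperplane
contains the kernel, but not the range, of the projection `P`. -/
def IsTransverseHalfSpace (P : V →L[ℝ] V) (X : Set V) (p : V) : Prop :=
  ∃ W : Set V, IsOpen W ∧ p ∈ W ∧ (W ⊆ X ∨ ∃ l : V →L[ℝ] ℝ, (∀ v, l (P v) = l v) ∧
    (∃ v, l v ≠ 0) ∧ ∀ y ∈ W, y ∈ X ↔ 0 ≤ l (y - p))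

lemma isTransverseHalfSpace_univ (P : V →L[ℝ] V) (p : V) : IsTransverseHalfSpace P univ p :=
  ⟨univ, isOpen_univ, mem_univ _, Or.inl subset_rfl⟩

/-- Embedded submanifolds pull back along diffeomorphisms that respect the phase space. -/
lemma IsEmbeddedSubmanifold.preimage {X S : Set V} {k : ℕ} (hS : IsEmbeddedSubmanifold X S k)
    (ψ : V ≃ₜ V) (h1 : ContDiff ℝ 1 ψ) (h2 : ContDiff ℝ 1 ψ.symm) {D : Set V} (hD : IsOpen D)
    (hX : ∀ y ∈ D, y ∈ X ↔ ψ y ∈ X) : IsEmbeddedSubmanifold X {y | y ∈ D ∧ ψ y ∈ S} k := by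
  refine ⟨fun y hy => (hX y hy.1).2 (hS.1 hy.2), fun y hy => ?_⟩
  obtain ⟨Φ, hy', hΦ1, hΦ2, L, hL, hmem, hbd⟩ := hS.2 _ hy.2
  let Ψ := (ψ.toOpenPartialHomeomorph.trans Φ).restrOpen D hD
  have hsrc : ∀ z, z ∈ Ψ.source ↔ ψ z ∈ Φ.source ∧ z ∈ D := by
    intro z
    simp [Ψ]
  have htgt : ∀ z, z ∈ Ψ.target → z ∈ Φ.target := by
    intro z hz
    have h3 := (hsrc _).1 (Ψ.map_target hz)
    have h4 : Ψ (Ψ.symm z) = z := Ψ.right_inv hz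
    rw [← h4]
    exact Φ.map_source h3.1
  refine ⟨Ψ, (hsrc y).2 ⟨hy', hy.1⟩, ?_, ?_, L, hL, fun z hz => ?_, ?_⟩
  · exact hΦ1.comp h1.contDiffOn fun z hz => ((hsrc z).1 hz).1
  · exact h2.comp_contDiffOn (hΦ2.mono htgt)
  · obtain ⟨hz1, hz2⟩ := (hsrc z).1 hz
    have := hmem _ hz1
    change z ∈ D ∧ ψ z ∈ S ↔ z ∈ X ∧ Φ (ψ z) ∈ L
    rw [this, hX z hz2]
    exact and_iff_right hz2
  · rcases hbd with h | ⟨l, hl, h⟩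
    · left
      intro z hz
      obtain ⟨hz1, hz2⟩ := (hsrc z).1 hz
      exact (hX z hz2).2 (h hz1)
    · refine Or.inr ⟨l, hl, fun z hz => ?_⟩
      obtain ⟨hz1, hz2⟩ := (hsrc z).1 hz
      rw [hX z hz2]
      exact h _ hz1

variable {P : V →L[ℝ] V} {p : V} {O : Set V} {h : V → V}

/-- The chart that straightens a stable graph. -/
def IsStableGraph.chart (H : IsStableGraph P p O h) (hPP : P * P = P) (W : Set V) (hW : IsOpen W) :
    OpenPartialHomeomorph V V where
  -- Because P(h y) = P y, the image has P-part Py - Pp and complementary part y - h y. The graph is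
  -- therefore sent into the range of P.
  toFun y := y - h y + P y - P p
  invFun z := z + P p + h (z + P p) - P (z + P p)
  source := O ∩ W
  target := ((fun z => z + P p) ⁻¹' O) ∩ (fun z => z + P p + h (z + P p) - P (z + P p)) ⁻¹' W
  map_source' := by
    rintro y ⟨hyO, hyW⟩
    have hPP' : ∀ v, P (P v) = P v := fun v => congrArg (fun L : V →L[ℝ] V => L v) hPP
    have h1 : y - h y + P y - P p + P p = y - h y + P y := by abel
    have h2 : P (y - h y + P y) = P y := by
      rw [map_add, map_sub, H.proj_apply y hyO, hPP']; abel
    have h3 : h (y - h y + P y) = h y := by rw [← H.apply_proj, h2, H.apply_proj]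
    refine ⟨?_, ?_⟩
    · change y - h y + P y - P p + P p ∈ O
      rw [h1, ← H.proj_mem, h2, H.proj_mem]; exact hyO
    · change y - h y + P y - P p + P p + h (y - h y + P y - P p + P p) -
        P (y - h y + P y - P p + P p) ∈ W
      rw [h1, h2, h3]
      convert hyW using 1; abel
  map_target' := by
    rintro z ⟨hzO, hzW⟩
    have hPP' : ∀ v, P (P v) = P v := fun v => congrArg (fun L : V →L[ℝ] V => L v) hPP
    refine ⟨?_, hzW⟩
    have : P (z + P p + h (z + P p) - P (z + P p)) = P (z + P p) := by
      rw [map_sub, map_add, H.proj_apply _ hzO, hPP']; abel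
    rw [← H.proj_mem, this, H.proj_mem]
    exact hzO
  left_inv' := by
    rintro y ⟨hyO, -⟩
    have hPP' : ∀ v, P (P v) = P v := fun v => congrArg (fun L : V →L[ℝ] V => L v) hPP
    have h1 : y - h y + P y - P p + P p = y - h y + P y := by abel
    have h2 : P (y - h y + P y) = P y := by
      rw [map_add, map_sub, H.proj_apply y hyO, hPP']; abel
    have h3 : h (y - h y + P y) = h y := by rw [← H.apply_proj, h2, H.apply_proj]
    rw [h1, h2, h3]; abel
  right_inv' := by
    rintro z ⟨hzO, -⟩
    have hPP' : ∀ v, P (P v) = P v := fun v => congrArg (fun L : V →L[ℝ] V => L v) hPP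
    have h1 : P (z + P p + h (z + P p) - P (z + P p)) = P (z + P p) := by
      rw [map_sub, map_add, H.proj_apply _ hzO, hPP']; abel
    have h2 : h (z + P p + h (z + P p) - P (z + P p)) = h (z + P p) := by
      rw [← H.apply_proj, h1, H.apply_proj]
    rw [h1, h2]; abel
  open_source := H.isOpen.inter hW
  open_target := by
    have hc : ContinuousOn (fun z => z + P p + h (z + P p) - P (z + P p))
        ((fun z => z + P p) ⁻¹' O) := by
      have : ContinuousOn (fun z => h (z + P p)) ((fun z => z + P p) ⁻¹' O) :=
        H.contDiffOn.continuousOn.comp (by fun_prop) fun _ hz => hz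
      exact ((by fun_prop : Continuous fun z : V => z + P p).continuousOn.add this).sub
        (by fun_prop : Continuous fun z : V => P (z + P p)).continuousOn
    exact hc.isOpen_inter_preimage (H.isOpen.preimage (by fun_prop)) hW
  continuousOn_toFun := by
    have : ContinuousOn h (O ∩ W) := H.contDiffOn.continuousOn.mono inter_subset_left
    fun_prop
  continuousOn_invFun := by
    have : ContinuousOn (fun z => h (z + P p)) (((fun z => z + P p) ⁻¹' O) ∩
        (fun z => z + P p + h (z + P p) - P (z + P p)) ⁻¹' W) :=
      H.contDiffOn.continuousOn.comp (by fun_prop) fun _ hz => hz.1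
    exact ((by fun_prop : Continuous fun z : V => z + P p).continuousOn.add this).sub
      (by fun_prop : Continuous fun z : V => P (z + P p)).continuousOn

/-- The straightening chart only translates the P-component, and the boundary functional l factors
through P. So l(Φ y) = l(y - p), and the phase space is a half-space in the chart too. -/
lemma IsStableGraph.isEmbeddedSubmanifold (H : IsStableGraph P p O h) (hPP : P * P = P)
    {X S W : Set V} (hW : IsOpen W) (hX : W ⊆ X ∨ ∃ l : V →L[ℝ] ℝ, (∀ v, l (P v) = l v) ∧
      (∃ v, l v ≠ 0) ∧ ∀ y ∈ W, y ∈ X ↔ 0 ≤ l (y - p))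
    (hS : S = {y | y ∈ O ∧ h y = y} ∩ X) (hSW : S ⊆ W) :
    IsEmbeddedSubmanifold X S (Module.finrank ℝ (P : V →ₗ[ℝ] V).range) := by
  have hPP' : ∀ v, P (P v) = P v := fun v => congrArg (fun L : V →L[ℝ] V => L v) hPP
  have hproj : ∀ y ∈ O, P (y - h y + P y - P p) = P y - P p := by
    intro y hy
    rw [map_sub, map_add, map_sub, H.proj_apply y hy, hPP', hPP']; abel
  refine ⟨by rw [hS]; exact inter_subset_right, fun y hy => ?_⟩
  have hyS : (y ∈ O ∧ h y = y) ∧ y ∈ X := by rw [hS] at hy; exact hy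
  refine ⟨H.chart hPP W hW, ⟨hyS.1.1, hSW hy⟩, ?_, ?_, (P : V →ₗ[ℝ] V).range, rfl,
    fun z hz => ?_, ?_⟩
  · have : ContDiffOn ℝ 1 h (O ∩ W) := H.contDiffOn.mono inter_subset_left
    change ContDiffOn ℝ 1 (fun y => y - h y + P y - P p) (O ∩ W)
    exact ((contDiffOn_id.sub this).add P.contDiff.contDiffOn).sub contDiffOn_const
  · have hadd : ContDiff ℝ 1 fun z : V => z + P p := contDiff_id.add contDiff_const
    change ContDiffOn ℝ 1 (fun z => z + P p + h (z + P p) - P (z + P p)) _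
    exact (hadd.contDiffOn.add (H.contDiffOn.comp hadd.contDiffOn fun _ hz => hz.1)).sub
      (P.contDiff.comp hadd).contDiffOn
  · change z ∈ S ↔ z ∈ X ∧ z - h z + P z - P p ∈ (P : V →ₗ[ℝ] V).range
    rw [hS]
    change (z ∈ O ∧ h z = z) ∧ z ∈ X ↔ _
    have : z - h z + P z - P p ∈ (P : V →ₗ[ℝ] V).range ↔ h z = z := by
      constructor
      · rintro ⟨v, hv⟩
        have hv' : P v = z - h z + P z - P p := hv
        have h1 := hproj z hz.1
        rw [← hv', hPP', hv'] at h1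
        have h2 : z - h z = 0 := by
          have : z - h z = (z - h z + P z - P p) - (P z - P p) := by abel
          rw [this, h1, sub_self]
        exact (sub_eq_zero.1 h2).symm
      · intro hz'
        exact ⟨z - p, by rw [hz']; simp⟩
    rw [this]
    exact ⟨fun h => ⟨h.2, h.1.2⟩, fun h => ⟨⟨hz.1, h.2⟩, h.1⟩⟩
  · rcases hX with h' | ⟨l, hl, ⟨v, hv⟩, h'⟩
    · exact Or.inl (inter_subset_right.trans h')
    · refine Or.inr ⟨l, ⟨P v, ⟨v, rfl⟩, by rwa [hl]⟩, fun z hz => ?_⟩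
      rw [h' z hz.2]
      change _ ↔ 0 ≤ l (z - h z + P z - P p)
      rw [← hl (z - h z + P z - P p), hproj z hz.1, ← map_sub, hl]

/-- A graph over a proper subspace has a unit normal field. -/
lemma IsStableGraph.exists_isUnitNormalField [FiniteDimensional ℝ V] (H : IsStableGraph P p O h)
    (hPP : P * P = P) (hP1 : P ≠ 1) {S : Set V} (hS : S ⊆ {y | y ∈ O ∧ h y = y}) :
    ∃ ν : V → V, IsUnitNormalField S ν := by
  have : CompleteSpace V := FiniteDimensional.complete ℝ V
  have hPP' : ∀ v, P (P v) = P v := fun v => congrArg (fun L : V →L[ℝ] V => L v) hPP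
  obtain ⟨w, hw, hw0⟩ : ∃ w ∈ (P : V →ₗ[ℝ] V).rangeᗮ, w ≠ 0 := by
    apply Submodule.exists_mem_ne_zero_of_ne_bot
    rw [Ne, Submodule.orthogonal_eq_bot_iff]
    intro htop
    apply hP1
    ext v
    obtain ⟨u, hu⟩ : v ∈ (P : V →ₗ[ℝ] V).range := by rw [htop]; trivial
    have hu' : P u = v := hu
    rw [← hu', hPP']; rfl
  have hwP : ∀ v, inner ℝ w (P v) = 0 := fun v =>
    (Submodule.mem_orthogonal' _ _).1 hw _ ⟨v, rfl⟩
  -- This is the differential of z ↦ ⟨w, z - h z⟩, which vanishes on S. It is nonzero because h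
  -- depends only on the P-component: on w - Pw it takes the value ⟨w, w⟩.
  let D : V → V →L[ℝ] ℝ := fun y => (innerSL ℝ w).comp (1 - fderiv ℝ h y)
  have hdiff : ∀ y ∈ O, HasFDerivAt h (fderiv ℝ h y) y := fun y hy =>
    ((H.contDiffOn.differentiableOn one_ne_zero y hy).differentiableAt
      (H.isOpen.mem_nhds hy)).hasFDerivAt
  have hD : ∀ y ∈ O, D y ≠ 0 := by
    intro y hy h0
    have h1 : HasFDerivAt h ((fderiv ℝ h (P y)).comp P) y := by
      have := (hdiff (P y) ((H.proj_mem y).2 hy)).comp y P.hasFDerivAt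
      have he : h ∘ P = h := funext H.apply_proj
      rwa [he] at this
    have h2 : fderiv ℝ h y (w - P w) = 0 := by
      rw [h1.fderiv]
      change fderiv ℝ h (P y) (P (w - P w)) = 0
      rw [map_sub, hPP', sub_self, map_zero]
    have h3 : D y (w - P w) = inner ℝ w w := by
      change inner ℝ w ((w - P w) - fderiv ℝ h y (w - P w)) = _
      rw [h2, sub_zero, inner_sub_right, hwP, sub_zero]
    rw [h0] at h3
    exact (inner_self_ne_zero (𝕜 := ℝ)).2 hw0 h3.symm
  let N : V → V := fun y => (InnerProductSpace.toDual ℝ V).symm (D y)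
  have hN : ∀ y ∈ O, N y ≠ 0 := fun y hy h0 => hD y hy (by simpa [N] using h0)
  have hNc : ContinuousOn N O := by
    have h1 : ContinuousOn (fderiv ℝ h) O :=
      H.contDiffOn.continuousOn_fderiv_of_isOpen H.isOpen le_rfl
    have h2 : ContinuousOn D O := continuousOn_const.clm_comp (continuousOn_const.sub h1)
    exact (InnerProductSpace.toDual ℝ V).symm.continuous.comp_continuousOn h2
  refine ⟨fun y => ‖N y‖⁻¹ • N y, ?_, fun y hy => ?_⟩
  · refine ContinuousOn.mono ?_ fun y hy => (hS hy).1
    exact (hNc.norm.inv₀ fun y hy => norm_ne_zero_iff.2 (hN y hy)).smul hNc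
  · have hyO := (hS hy).1
    refine ⟨norm_smul_inv_norm (𝕜 := ℝ) (hN y hyO), fun v hv => ?_⟩
    have h1 : HasFDerivAt (fun z => (inner ℝ w (z - h z) : ℝ)) (D y) y :=
      (innerSL ℝ w).hasFDerivAt.comp y ((hasFDerivAt_id y).sub (hdiff y hyO))
    have h2 : ∀ z ∈ S, inner ℝ w (z - h z) = (0 : ℝ) := fun z hz => by
      rw [(hS hz).2, sub_self, inner_zero_right]
    have h3 : HasFDerivWithinAt (fun z => (inner ℝ w (z - h z) : ℝ)) (0 : V →L[ℝ] ℝ) S y :=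
      (hasFDerivWithinAt_const (0 : ℝ) y S).congr h2 (h2 y hy)
    have h5 : D y v = 0 := h1.hasFDerivWithinAt.unique_on h3 hv
    rw [inner_smul_left, InnerProductSpace.toDual_symm_apply, h5, mul_zero]

/-- The local stable set of an equilibrium is an embedded, co-oriented submanifold. -/
theorem exists_localStableSet_isEmbeddedSubmanifold [FiniteDimensional ℝ V] {F : V → V} {X : Set V}
    (hF : ContDiff ℝ 1 F) (hp : F p = 0) (hP : IsDichotomy (fderiv ℝ F p) P)
    (hX : IsInvariant F X) (hXp : IsTransverseHalfSpace P X p) :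
    ∃ δ > 0, IsEmbeddedSubmanifold X (localStableSet F X (Metric.ball p δ) p)
        (Module.finrank ℝ (P : V →ₗ[ℝ] V).range) ∧
      (P ≠ 1 → ∃ ν, IsUnitNormalField (localStableSet F X (Metric.ball p δ) p) ν) := by
  obtain ⟨δ₀, hδ₀, hloc⟩ := exists_localStableSet_eq_graph hF hp hP
  obtain ⟨W, hW, hpW, hWX⟩ := hXp
  obtain ⟨ε, hε, hεW⟩ := Metric.isOpen_iff.1 hW p hpW
  -- The radius is also at most ε, so that the local stable set lies where X is described by the
  -- half-space.
  obtain ⟨O, h, H, hS⟩ := hloc (min δ₀ ε) (by positivity) (min_le_left _ _)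
  have hS' : localStableSet F X (Metric.ball p (min δ₀ ε)) p = {y | y ∈ O ∧ h y = y} ∩ X := by
    rw [hX.localStableSet_eq, hS]
  refine ⟨min δ₀ ε, by positivity, H.isEmbeddedSubmanifold hP.idem hW hWX hS' ?_, fun hP1 =>
    H.exists_isUnitNormalField hP.idem hP1 (by rw [hS']; exact inter_subset_left)⟩
  rintro x ⟨γ, -, rfl, hγ, -⟩
  exact hεW (Metric.ball_subset_ball (min_le_right _ _) (hγ 0 self_mem_Ici))

/-- **Global stable manifold theorem**: the stable set is an injectively immersed submanifold. -/
theorem isImmersedSubmanifold_stableSet [FiniteDimensional ℝ V] {F : V → V} {X : Set V}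
    (hF : ContDiff ℝ 1 F) (hX : IsInvariant F X) {δ : ℝ} (hδ : 0 < δ) {k : ℕ}
    (hloc : IsEmbeddedSubmanifold X (localStableSet F X (Metric.ball p δ) p) k) :
    IsImmersedSubmanifold X (stableSet F X p) k := by
  -- `T i` collects the points that have entered the small ball for good by time i. Bounding the
  -- earlier part of the orbit by δ + i lets the time-i map of a cut-off flow carry `T i` into the
  -- local stable set; every convergent orbit satisfies such bounds for large i.
  let T : ℕ → Set V := fun i => {x | ∃ γ : ℝ → V, IsSolution F X γ (Ici 0) ∧ γ 0 = x ∧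
    (∀ t ∈ Icc (0 : ℝ) i, γ t ∈ Metric.ball p (δ + i)) ∧
    (∀ t, (i : ℝ) ≤ t → γ t ∈ Metric.ball p δ) ∧ Tendsto γ atTop (𝓝 p)}
  refine ⟨T, monotone_nat_of_le_succ ?_, ?_, fun i => ?_⟩
  · rintro i x ⟨γ, h1, h2, h3, h4, h5⟩
    refine ⟨γ, h1, h2, fun t ht => ?_, fun t ht => h4 t ?_, h5⟩
    · rcases le_total t i with h | h
      · refine Metric.ball_subset_ball ?_ (h3 t ⟨ht.1, h⟩)
        push_cast; linarith
      · refine Metric.ball_subset_ball ?_ (h4 t h)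
        linarith [(Nat.cast_nonneg (i + 1) : (0 : ℝ) ≤ ((i + 1 : ℕ) : ℝ))]
    · push_cast at ht; linarith
  · ext x
    rw [mem_iUnion]
    constructor
    · rintro ⟨γ, h1, h2, h3⟩
      obtain ⟨t₀, ht₀⟩ := eventually_atTop.1 (h3.eventually (Metric.ball_mem_nhds p hδ))
      have hcomp : IsCompact (γ '' Icc 0 t₀) :=
        isCompact_Icc.image_of_continuousOn (h1.continuousOn.mono Icc_subset_Ici_self)
      obtain ⟨R, hR⟩ := hcomp.isBounded.subset_ball p
      obtain ⟨i, hi⟩ := exists_nat_ge (max t₀ R)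
      refine ⟨i, γ, h1, h2, fun t ht => ?_, fun t ht => ht₀ t ?_, h3⟩
      · rcases le_total t t₀ with h | h
        · refine Metric.ball_subset_ball ?_ (hR (mem_image_of_mem γ ⟨ht.1, h⟩))
          linarith [le_max_right t₀ R]
        · refine Metric.ball_subset_ball ?_ (ht₀ t h)
          have : (0 : ℝ) ≤ i := by positivity
          linarith
      · exact (le_max_left _ _).trans (hi.trans ht)
    · rintro ⟨i, γ, h1, h2, -, -, h3⟩
      exact ⟨γ, h1, h2, h3⟩
  · obtain ⟨G, K, φ, hG, hK, hφ, hGF⟩ := exists_isFlow_eqOn hF p (R := δ + i) (by positivity)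
    have hGF' : ∀ x ∈ Metric.ball p (δ + i), G x = F x := fun x hx =>
      hGF x (Metric.ball_subset_closedBall hx)
    have hδi : Metric.ball p δ ⊆ Metric.ball p (δ + i) :=
      Metric.ball_subset_ball (by simp)
    let ψ : V ≃ₜ V :=
      { toFun := φ i
        invFun := φ (-i)
        left_inv := fun x => by rw [← hφ.add hK]; simp [hφ.zero]
        right_inv := fun x => by rw [← hφ.add hK]; simp [hφ.zero]
        continuous_toFun := (hφ.contDiff hG hK i).continuous
        continuous_invFun := (hφ.contDiff hG hK (-i)).continuous }
    have hi0 : (0 : ℝ) ≤ i := by positivity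
    let D : Set V := {v | ∀ t ∈ Icc (0 : ℝ) i, φ t v ∈ Metric.ball p (δ + i)}
    have hDX : ∀ y ∈ D, y ∈ X ↔ ψ y ∈ X := by
      intro y hy
      have := hX (fun t => φ t y) i hi0 (hφ.isSolution hGF' hy)
      simp only [hφ.zero] at this
      exact this
    have hT : T i = {y | y ∈ D ∧ ψ y ∈ localStableSet F X (Metric.ball p δ) p} := by
      ext y
      constructor
      · rintro ⟨γ, h1, rfl, h3, h4, h5⟩
        have hγ := hφ.eq_of_isSolution hK hGF' (h1.mono Icc_subset_Ici_self subset_rfl) h3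
        refine ⟨fun t ht => by rw [← hγ t ht]; exact h3 t ht, fun t => γ (t + i),
          h1.comp_add hi0, ?_, fun t ht => h4 _ ?_, h5.comp (tendsto_atTop_add_const_right _ _
            tendsto_id)⟩
        · change γ (0 + i) = φ i (γ 0)
          rw [zero_add, hγ i (right_mem_Icc.2 hi0)]
        · have : (0 : ℝ) ≤ t := ht
          linarith
      · rintro ⟨hyD, γ, h1, h2, h3, h4⟩
        have h2' : γ 0 = φ i y := h2
        have hγ : ∀ t, 0 ≤ t → γ t = φ (t + i) y := by
          intro t ht
          rw [hφ.add hK, ← h2']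
          exact hφ.eq_of_isSolution hK hGF' (h1.mono Icc_subset_Ici_self subset_rfl)
            (fun s hs => hδi (h3 s hs.1)) t (right_mem_Icc.2 ht)
        have hafter : ∀ t, (i : ℝ) ≤ t → φ t y = γ (t - i) := by
          intro t ht
          rw [hγ _ (sub_nonneg.2 ht), sub_add_cancel]
        have hball : ∀ t ∈ Ici (0 : ℝ), φ t y ∈ Metric.ball p (δ + i) := by
          intro t ht
          rcases le_total t i with h | h
          · exact hyD t ⟨ht, h⟩
          · rw [hafter t h]; exact hδi (h3 _ (sub_nonneg.2 h))
        refine ⟨fun t => φ t y, hX.isSolution (hφ.isSolution hGF' hball) ?_, hφ.zero y,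
          fun t ht => hyD t ht, fun t ht => ?_, ?_⟩
        · rw [hφ.zero, hDX y hyD]
          change φ i y ∈ X
          rw [← h2']; exact (h1 0 self_mem_Ici).1
        · change φ t y ∈ _
          rw [hafter t ht]; exact h3 _ (sub_nonneg.2 ht)
        · have h5 : Tendsto (fun t : ℝ => γ (t - i)) atTop (𝓝 p) :=
            h4.comp (tendsto_atTop_add_const_right _ _ tendsto_id)
          refine h5.congr' ?_
          filter_upwards [eventually_ge_atTop (i : ℝ)] with t ht using (hafter t ht).symm
    rw [hT]
    exact hloc.preimage ψ (hφ.contDiff hG hK i) (hφ.contDiff hG hK (-i))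
      (hφ.isOpen_setOf_mem_ball hK p _ _) hDX

lemma unstableSet_eq_stableSet_neg (F : V → V) (X : Set V) (p : V) :
    unstableSet F X p = stableSet (-F) X p := by
  have key : ∀ (F : V → V) (γ : ℝ → V) (I : Set ℝ), IsSolution F X γ I →
      IsSolution (-F) X (fun t => γ (-t)) (-I) := by
    intro F γ I h t ht
    refine ⟨(h _ ht).1, ?_⟩
    have h1 : HasDerivWithinAt (fun t : ℝ => -t) (-1) (-I) t := (hasDerivAt_neg t).hasDerivWithinAt
    have h2 := (h _ ht).2.scomp t h1 fun u hu => hu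
    simpa [Function.comp_def] using h2
  ext x
  constructor
  · rintro ⟨γ, h1, h2, h3⟩
    refine ⟨fun t => γ (-t), ?_, by simpa using h2, h3.comp tendsto_neg_atTop_atBot⟩
    simpa using key F γ _ h1
  · rintro ⟨γ, h1, h2, h3⟩
    refine ⟨fun t => γ (-t), ?_, by simpa using h2, h3.comp tendsto_neg_atBot_atTop⟩
    simpa using key (-F) γ _ h1

/-- The notion is symmetric in the two ends of the time interval, so it passes to the reversed curve
γ(T - t). -/
lemma IsInvariant.neg {F : V → V} {X : Set V} (hX : IsInvariant F X) : IsInvariant (-F) X := by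
  intro γ T hT h
  have h1 : IsSolution F univ (fun t => γ (T - t)) (Icc 0 T) := by
    intro t ht
    refine ⟨mem_univ _, ?_⟩
    have hmaps : MapsTo (fun t : ℝ => T - t) (Icc 0 T) (Icc 0 T) := fun u hu =>
      ⟨by linarith [hu.2], by linarith [hu.1]⟩
    have h2 : HasDerivWithinAt (fun t : ℝ => T - t) (-1) (Icc 0 T) t :=
      ((hasDerivAt_id t).const_sub T).hasDerivWithinAt
    have h3 := (h _ (hmaps ht)).2.scomp t h2 hmaps
    simpa [Function.comp_def] using h3
  have := hX _ T hT h1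
  simpa using this.symm

/-- The unstable set of an equilibrium is an injectively immersed submanifold. -/
theorem isImmersedSubmanifold_unstableSet [FiniteDimensional ℝ V] {F : V → V} {X : Set V}
    (hF : ContDiff ℝ 1 F) (hp : F p = 0) (hP : IsDichotomy (fderiv ℝ F p) P)
    (hX : IsInvariant F X) (hXp : IsTransverseHalfSpace (1 - P) X p) :
    IsImmersedSubmanifold X (unstableSet F X p)
      (Module.finrank ℝ ((1 - P : V →L[ℝ] V) : V →ₗ[ℝ] V).range) := by
  rw [unstableSet_eq_stableSet_neg]
  have hF' : ContDiff ℝ 1 (-F) := hF.neg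
  have hd : IsDichotomy (fderiv ℝ (-F) p) (1 - P) := by
    rw [fderiv_neg]; exact hP.neg
  obtain ⟨δ, hδ, h1, -⟩ := exists_localStableSet_isEmbeddedSubmanifold hF'
    (by rw [Pi.neg_apply, hp, neg_zero]) hd hX.neg hXp
  exact isImmersedSubmanifold_stableSet hF' hX.neg hδ h1

end StableManifold

/-! ### The compactified input -/

section Input

variable {d : ℕ} {Λ : ℝ → EuclideanSpace ℝ (Fin d)} {lamP lamM : EuclideanSpace ℝ (Fin d)}
  {α ρ : ℝ}

lemma exp_hInv (hα : α ≠ 0) {s : ℝ} (h1 : -1 < s) (h2 : s < 1) :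
    Real.exp (α * hInv α s) = (1 + s) / (1 - s) := by
  rw [hInv, ← mul_assoc, mul_one_div_cancel hα, one_mul, Real.exp_log]
  exact div_pos (by linarith) (by linarith)

/-- The derivative is the reciprocal of the speed s' = α(1 - s²)/2; it blows up at the ends of the
interval. -/
lemma hasDerivAt_hInv (hα : α ≠ 0) {s : ℝ} (h1 : -1 < s) (h2 : s < 1) :
    HasDerivAt (hInv α) (2 / (α * (1 - s ^ 2))) s := by
  have e1 : (1 + s) ≠ 0 := by linarith
  have e2 : (1 - s) ≠ 0 := by linarith
  have e3 : (1 - s ^ 2) ≠ 0 := by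
    rw [show 1 - s ^ 2 = (1 + s) * (1 - s) by ring]; exact mul_ne_zero e1 e2
  have h3 : HasDerivAt (fun s : ℝ => (1 + s) / (1 - s)) _ s :=
    ((hasDerivAt_id s).const_add 1).div ((hasDerivAt_id s).const_sub 1) e2
  refine ((h3.log (div_ne_zero e1 e2)).const_mul (1 / α)).congr_deriv ?_
  have e4 : 1 - id s ≠ 0 := e2
  simp only [id]
  field_simp
  ring

lemma tendsto_hInv (hα : 0 < α) : Tendsto (hInv α) (𝓝[<] 1) atTop := by
  have h1 : Tendsto (fun s : ℝ => 1 - s) (𝓝[<] 1) (𝓝[>] 0) := by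
    refine tendsto_nhdsWithin_iff.2 ⟨?_, ?_⟩
    · have : Continuous fun s : ℝ => 1 - s := by fun_prop
      simpa using (this.tendsto 1).mono_left nhdsWithin_le_nhds
    · filter_upwards [self_mem_nhdsWithin] with s hs
      exact sub_pos.2 (mem_Iio.1 hs)
  have h2 : Tendsto (fun s : ℝ => 1 + s) (𝓝[<] 1) (𝓝 2) := by
    have : Continuous fun s : ℝ => 1 + s := by fun_prop
    have h3 := (this.tendsto 1).mono_left (nhdsWithin_le_nhds (s := Iio 1))
    norm_num at h3
    exact h3
  have h3 : Tendsto (fun s : ℝ => (1 + s) / (1 - s)) (𝓝[<] 1) atTop := by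
    simp only [div_eq_mul_inv]
    exact h2.pos_mul_atTop two_pos (tendsto_inv_nhdsGT_zero.comp h1)
  exact (Real.tendsto_log_atTop.comp h3).const_mul_atTop (by positivity)

/-- The derivative of the compactified input on the right half of the phase interval. -/
def inputDeriv (Λ : ℝ → EuclideanSpace ℝ (Fin d)) (α s : ℝ) : EuclideanSpace ℝ (Fin d) :=
  if s < 1 then (2 / (α * (1 - s ^ 2))) • deriv Λ (hInv α s) else 0

/-- The singular factor 2/(α(1-s²)) equals 2/(α(1+s)²)·e^{ατ}. Against the decay e^{-ρτ} of Λ' this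
leaves e^{(α-ρ)τ} times a convergent factor, which vanishes in the limit because α < ρ. -/
lemma tendsto_inputDeriv (hα : 0 < α) (hαρ : α < ρ) {a : EuclideanSpace ℝ (Fin d)}
    (h : Tendsto (fun τ => (Real.exp (-ρ * τ))⁻¹ • deriv Λ τ) atTop (𝓝 a)) :
    Tendsto (inputDeriv Λ α) (𝓝[<] 1) (𝓝 0) := by
  have h1 := h.comp (tendsto_hInv hα)
  have h2 : Tendsto (fun s => Real.exp ((α - ρ) * hInv α s)) (𝓝[<] 1) (𝓝 0) :=
    Real.tendsto_exp_atBot.comp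
      ((tendsto_hInv hα).const_mul_atTop_of_neg (by linarith))
  have h3 : Tendsto (fun s : ℝ => 2 / (α * (1 + s) ^ 2)) (𝓝[<] 1) (𝓝 (2 / (α * (1 + 1) ^ 2))) := by
    have : ContinuousAt (fun s : ℝ => 2 / (α * (1 + s) ^ 2)) 1 :=
      ContinuousAt.div (by fun_prop) (by fun_prop) (by positivity)
    exact this.tendsto.mono_left nhdsWithin_le_nhds
  have h4 := (h3.mul h2).smul h1
  rw [mul_zero, zero_smul] at h4
  refine h4.congr' ?_
  filter_upwards [Ioo_mem_nhdsLT (show (-1 : ℝ) < 1 by norm_num)] with s hs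
  rw [inputDeriv, if_pos hs.2, Function.comp_apply, smul_smul]
  congr 1
  have e1 : (1 + s) ≠ 0 := by linarith [hs.1]
  have e2 : (1 - s) ≠ 0 := by linarith [hs.2]
  have e3 : Real.exp ((α - ρ) * hInv α s) * (Real.exp (-ρ * hInv α s))⁻¹ = (1 + s) / (1 - s) := by
    rw [← Real.exp_neg, ← Real.exp_add, ← exp_hInv hα.ne' hs.1 hs.2]
    congr 1; ring
  rw [mul_assoc, e3, show 1 - s ^ 2 = (1 + s) * (1 - s) by ring]
  field_simp

/-- To the right of 1 the input is constant; the left derivative at 1 is the limit of the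
derivatives, which is zero. The two sides match to first order, so no boundary remains at s = 1. -/
lemma contDiffOn_inputOfS (hα : 0 < α) (hαρ : α < ρ) (hΛ : ContDiff ℝ 1 Λ)
    (hP : Tendsto Λ atTop (𝓝 lamP)) {a : EuclideanSpace ℝ (Fin d)}
    (h : Tendsto (fun τ => (Real.exp (-ρ * τ))⁻¹ • deriv Λ τ) atTop (𝓝 a)) :
    ContDiffOn ℝ 1 (inputOfS Λ lamP lamM α) (Ioi (-1)) ∧
      HasDerivAt (inputOfS Λ lamP lamM α) 0 1 := by
  set f := inputOfS Λ lamP lamM α with hf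
  have hf1 : ∀ s, 1 ≤ s → f s = lamP := by
    intro s hs
    rw [hf, inputOfS, if_neg (by linarith), if_pos hs]
  have hf2 : ∀ s ∈ Ioo (-1 : ℝ) 1, f s = Λ (hInv α s) := by
    intro s hs
    rw [hf, inputOfS, if_neg (by linarith [hs.1]), if_neg (by linarith [hs.2])]
  have hlt : ∀ s ∈ Ioo (-1 : ℝ) 1, HasDerivAt f (inputDeriv Λ α s) s := by
    intro s hs
    have h1 := ((hΛ.differentiable one_ne_zero) (hInv α s)).hasDerivAt.scomp s
      (hasDerivAt_hInv hα.ne' hs.1 hs.2)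
    rw [inputDeriv, if_pos hs.2]
    refine h1.congr_of_eventuallyEq ?_
    filter_upwards [Ioo_mem_nhds hs.1 hs.2] with u hu using hf2 u hu
  have hgt : ∀ s, 1 < s → HasDerivAt f (inputDeriv Λ α s) s := by
    intro s hs
    rw [inputDeriv, if_neg hs.not_gt]
    refine (hasDerivAt_const s lamP).congr_of_eventuallyEq ?_
    filter_upwards [Ioi_mem_nhds hs] with u hu using hf1 u (le_of_lt hu)
  have hI : Ioo (-1 : ℝ) 1 ∈ 𝓝[<] 1 := Ioo_mem_nhdsLT (by norm_num)
  have hD := tendsto_inputDeriv hα hαρ h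
  have hone : HasDerivAt f 0 1 := by
    have hleft : HasDerivWithinAt f 0 (Iic 1) 1 := by
      refine hasDerivWithinAt_Iic_of_tendsto_deriv (s := Ioo (-1) 1)
        (fun s hs => (hlt s hs).differentiableAt.differentiableWithinAt) ?_ hI ?_
      · rw [ContinuousWithinAt, hf1 1 le_rfl, nhdsWithin_Ioo_eq_nhdsLT (by norm_num)]
        refine (hP.comp (tendsto_hInv hα)).congr' ?_
        filter_upwards [hI] with s hs using (hf2 s hs).symm
      · refine hD.congr' ?_
        filter_upwards [hI] with s hs using (hlt s hs).deriv.symm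
    have hright : HasDerivWithinAt f 0 (Ici 1) 1 :=
      (hasDerivWithinAt_const 1 _ lamP).congr (fun s hs => hf1 s hs) (hf1 1 le_rfl)
    have := hleft.union hright
    rwa [Iic_union_Ici, hasDerivWithinAt_univ] at this
  refine ⟨?_, hone⟩
  have hall : ∀ s ∈ Ioi (-1 : ℝ), HasDerivAt f (inputDeriv Λ α s) s := by
    intro s hs
    rcases lt_trichotomy s 1 with h1 | rfl | h1
    · exact hlt s ⟨hs, h1⟩
    · rwa [inputDeriv, if_neg (lt_irrefl _)]
    · exact hgt s h1
  rw [show (1 : WithTop ℕ∞) = 0 + 1 by norm_num, contDiffOn_succ_iff_deriv_of_isOpen isOpen_Ioi]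
  refine ⟨fun s hs => (hall s hs).differentiableAt.differentiableWithinAt, by simp, ?_⟩
  rw [contDiffOn_zero]
  have hcont : ContinuousOn (inputDeriv Λ α) (Ioi (-1)) := by
    intro s hs
    refine ContinuousAt.continuousWithinAt ?_
    rcases lt_trichotomy s 1 with h1 | rfl | h1
    · have hs0 : α * (1 - s ^ 2) ≠ 0 := by
        have e1 : 0 < 1 + s := by linarith [mem_Ioi.1 hs]
        have e2 : 0 < 1 - s := by linarith
        rw [show 1 - s ^ 2 = (1 + s) * (1 - s) by ring]; positivity
      have hc : ContinuousAt (fun s => (2 / (α * (1 - s ^ 2))) • deriv Λ (hInv α s)) s := by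
        have hc' : ContinuousAt (fun s : ℝ => 2 / (α * (1 - s ^ 2))) s :=
          ContinuousAt.div (by fun_prop) (by fun_prop) hs0
        refine hc'.smul ?_
        exact (hΛ.continuous_deriv le_rfl).continuousAt.comp
          (hasDerivAt_hInv hα.ne' hs h1).continuousAt
      refine hc.congr ?_
      filter_upwards [Iio_mem_nhds h1] with u hu
      rw [inputDeriv, if_pos (mem_Iio.1 hu)]
    · have h0 : inputDeriv Λ α 1 = 0 := by rw [inputDeriv, if_neg (lt_irrefl _)]
      rw [continuousAt_iff_continuous_left'_right', ContinuousWithinAt, ContinuousWithinAt, h0]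
      refine ⟨hD, tendsto_const_nhds.congr' ?_⟩
      filter_upwards [self_mem_nhdsWithin] with u hu
      rw [inputDeriv, if_neg (not_lt.2 (le_of_lt hu))]
    · refine (continuousAt_const (y := 0)).congr ?_
      filter_upwards [Ioi_mem_nhds h1] with u hu
      rw [inputDeriv, if_neg (not_lt.2 (le_of_lt hu))]
  exact hcont.congr fun s hs => (hall s hs).deriv

/-- Reversing τ reverses s and exchanges the two limits, so the end s = -1 is reduced to s = 1. -/
lemma inputOfS_neg (s : ℝ) : inputOfS Λ lamP lamM α (-s) =
    inputOfS (fun τ => Λ (-τ)) lamM lamP α s := by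
  have h1 : hInv α (-s) = -hInv α s := by
    rw [hInv, hInv, ← mul_neg, ← Real.log_inv, inv_div, sub_neg_eq_add, ← sub_eq_add_neg]
  simp only [inputOfS, h1]
  have e1 : -s ≤ -1 ↔ 1 ≤ s := by constructor <;> intro h <;> linarith
  have e2 : 1 ≤ -s ↔ s ≤ -1 := by constructor <;> intro h <;> linarith
  simp only [e1, e2]
  split_ifs with h2 h3
  · linarith
  all_goals rfl

/-- The compactified input is `C¹`, with vanishing derivative at the ends of the phase interval. -/
theorem contDiff_inputOfS (hα : 0 < α) (hαρ : α < ρ) (hΛ : ContDiff ℝ 1 Λ)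
    (hP : Tendsto Λ atTop (𝓝 lamP)) (hM : Tendsto Λ atBot (𝓝 lamM))
    (hρ : IsExpBiAsymptoticallyConstant Λ ρ) :
    ContDiff ℝ 1 (inputOfS Λ lamP lamM α) ∧ HasDerivAt (inputOfS Λ lamP lamM α) 0 1 ∧
      HasDerivAt (inputOfS Λ lamP lamM α) 0 (-1) := by
  obtain ⟨-, ⟨a, ha⟩, ⟨b, hb⟩⟩ := hρ
  obtain ⟨h1, h2⟩ := contDiffOn_inputOfS (lamM := lamM) hα hαρ hΛ hP ha
  have hb' : Tendsto (fun τ => (Real.exp (-ρ * τ))⁻¹ • deriv (fun τ => Λ (-τ)) τ) atTop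
      (𝓝 (-b)) := by
    refine (hb.comp tendsto_neg_atTop_atBot).neg.congr fun τ => ?_
    simp [deriv_comp_neg]
  obtain ⟨h3, h4⟩ := contDiffOn_inputOfS (lamM := lamP) hα hαρ (hΛ.comp contDiff_neg)
    (hM.comp tendsto_neg_atTop_atBot) hb'
  have hrefl : inputOfS Λ lamP lamM α =
      fun s => inputOfS (fun τ => Λ (-τ)) lamM lamP α (-s) := by
    ext1 s; rw [← inputOfS_neg, neg_neg]
  refine ⟨contDiff_iff_contDiffAt.2 fun s => ?_, h2, ?_⟩
  · rcases lt_or_ge (-1) s with hs | hs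
    · exact h1.contDiffAt (Ioi_mem_nhds hs)
    · rw [hrefl]
      exact (h3.contDiffAt (Ioi_mem_nhds (by linarith : -1 < -s))).comp s
        contDiff_neg.contDiffAt
  · rw [hrefl]
    have h5 : HasDerivAt (inputOfS (fun τ => Λ (-τ)) lamM lamP α) 0 (- -1) := by
      rw [neg_neg]; exact h4
    simpa [Function.comp_def] using h5.scomp (-1) (hasDerivAt_neg (-1))

end Input

/-! ### Block-diagonal operators on the extended space -/

section Block

variable {n : ℕ}

/-- The identification of the extended space with a product. -/
def extEquiv (n : ℕ) : Ext n ≃L[ℝ] EuclideanSpace ℝ (Fin n) × ℝ :=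
  WithLp.prodContinuousLinearEquiv 2 ℝ (EuclideanSpace ℝ (Fin n)) ℝ

/-- The coordinate `x`. -/
def fstL (n : ℕ) : Ext n →L[ℝ] EuclideanSpace ℝ (Fin n) :=
  (ContinuousLinearMap.fst ℝ (EuclideanSpace ℝ (Fin n)) ℝ).comp
    (extEquiv n : Ext n →L[ℝ] EuclideanSpace ℝ (Fin n) × ℝ)

/-- The coordinate `s`. -/
def sndL (n : ℕ) : Ext n →L[ℝ] ℝ :=
  (ContinuousLinearMap.snd ℝ (EuclideanSpace ℝ (Fin n)) ℝ).comp
    (extEquiv n : Ext n →L[ℝ] EuclideanSpace ℝ (Fin n) × ℝ)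

/-- The inclusion of the coordinate `x`. -/
def inlL (n : ℕ) : EuclideanSpace ℝ (Fin n) →L[ℝ] Ext n :=
  ((extEquiv n).symm : EuclideanSpace ℝ (Fin n) × ℝ →L[ℝ] Ext n).comp
    (ContinuousLinearMap.inl ℝ (EuclideanSpace ℝ (Fin n)) ℝ)

/-- The inclusion of the coordinate `s`. -/
def inrL (n : ℕ) : ℝ →L[ℝ] Ext n :=
  ((extEquiv n).symm : EuclideanSpace ℝ (Fin n) × ℝ →L[ℝ] Ext n).comp
    (ContinuousLinearMap.inr ℝ (EuclideanSpace ℝ (Fin n)) ℝ)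

/-- The block-diagonal operator on the extended space. -/
def block (n : ℕ) : ((EuclideanSpace ℝ (Fin n) →L[ℝ] EuclideanSpace ℝ (Fin n)) × (ℝ →L[ℝ] ℝ)) →ₐ[ℝ]
    (Ext n →L[ℝ] Ext n) :=
  AlgHom.ofLinearMap
    { toFun := fun A => ((extEquiv n).symm : EuclideanSpace ℝ (Fin n) × ℝ →L[ℝ] Ext n).comp
        ((A.1.prodMap A.2).comp (extEquiv n : Ext n →L[ℝ] EuclideanSpace ℝ (Fin n) × ℝ))
      map_add' := fun _ _ => rfl
      map_smul' := fun _ _ => rfl }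
    rfl (fun _ _ => rfl)

lemma continuous_block (n : ℕ) : Continuous (block n) := by
  have h : ∀ A : (EuclideanSpace ℝ (Fin n) →L[ℝ] EuclideanSpace ℝ (Fin n)) × (ℝ →L[ℝ] ℝ),
      block n A = (inlL n).comp (A.1.comp (fstL n)) + (inrL n).comp (A.2.comp (sndL n)) := by
    intro A
    ext p
    change pair (A.1 p.fst) (A.2 p.snd) = pair (A.1 p.fst) 0 + pair 0 (A.2 p.snd)
    change _ = pair (A.1 p.fst + 0) (0 + A.2 p.snd)
    rw [add_zero, zero_add]
  rw [funext h]
  exact (continuous_const.clm_comp (continuous_fst.clm_comp continuous_const)).add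
    (continuous_const.clm_comp (continuous_snd.clm_comp continuous_const))

lemma block_exp (A : EuclideanSpace ℝ (Fin n) →L[ℝ] EuclideanSpace ℝ (Fin n)) (B : ℝ →L[ℝ] ℝ) :
    NormedSpace.exp (block n (A, B)) = block n (NormedSpace.exp A, NormedSpace.exp B) := by
  let _ : NormedAlgebra ℚ (EuclideanSpace ℝ (Fin n) →L[ℝ] EuclideanSpace ℝ (Fin n)) :=
    NormedAlgebra.restrictScalars ℚ ℝ _
  let _ : NormedAlgebra ℚ (ℝ →L[ℝ] ℝ) := NormedAlgebra.restrictScalars ℚ ℝ _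
  let _ : NormedAlgebra ℚ (Ext n →L[ℝ] Ext n) := NormedAlgebra.restrictScalars ℚ ℝ _
  rw [← NormedSpace.map_exp (block n) (continuous_block n)]
  congr 1
  exact Prod.ext (Prod.fst_exp _) (Prod.snd_exp _)

/-- `block` is a continuous algebra homomorphism, so it commutes with the exponential and transports
each condition from the two factors. -/
lemma isDichotomy_block {A P : EuclideanSpace ℝ (Fin n) →L[ℝ] EuclideanSpace ℝ (Fin n)}
    {B Q : ℝ →L[ℝ] ℝ} (h₁ : IsDichotomy A P) (h₂ : IsDichotomy B Q) :
    IsDichotomy (block n (A, B)) (block n (P, Q)) where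
  idem := by rw [← map_mul, Prod.mk_mul_mk, h₁.idem, h₂.idem]
  comm := by rw [← map_mul, ← map_mul, Prod.mk_mul_mk, Prod.mk_mul_mk, h₁.comm, h₂.comm]
  stable := by
    have h := ((continuous_block n).tendsto _).comp (h₁.stable.prodMk_nhds h₂.stable)
    have h0 : block n (0, 0) = 0 := map_zero (block n)
    rw [h0] at h
    refine h.congr fun t => ?_
    rw [← map_smul, Prod.smul_mk, block_exp, ← map_mul, Prod.mk_mul_mk]
    rfl
  unstable := by
    have h := ((continuous_block n).tendsto _).comp (h₁.unstable.prodMk_nhds h₂.unstable)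
    have h0 : block n (0, 0) = 0 := map_zero (block n)
    rw [h0] at h
    refine h.congr fun t => ?_
    rw [← map_smul, Prod.smul_mk, block_exp, ← map_one (block n), ← map_sub, ← map_mul]
    rfl

lemma isDichotomy_neg_smul_one {κ : ℝ} (hκ : 0 < κ) :
    IsDichotomy ((-κ) • (1 : ℝ →L[ℝ] ℝ)) 1 where
  idem := one_mul 1
  comm := by rw [one_mul, mul_one]
  stable := by
    refine tendsto_exp_smul_mul _ _ (Polynomial.X_sub_C_ne_zero (-κ)) (fun z hz => ?_) ?_
    · have : z = -κ := by
        simpa [sub_eq_zero, add_eq_zero_iff_eq_neg] using hz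
      simp [this, hκ]
    · rw [mul_one, map_sub, Polynomial.aeval_X, Polynomial.aeval_C,
        Algebra.algebraMap_eq_smul_one, sub_self]
  unstable := by simp

lemma isDichotomy_smul_one {κ : ℝ} (hκ : 0 < κ) : IsDichotomy (κ • (1 : ℝ →L[ℝ] ℝ)) 0 := by
  have h := (isDichotomy_neg_smul_one hκ).neg
  have e : -((-κ) • (1 : ℝ →L[ℝ] ℝ)) = κ • 1 := by ext; simp
  rwa [e, sub_self] at h

lemma finrank_range_block (P : EuclideanSpace ℝ (Fin n) →L[ℝ] EuclideanSpace ℝ (Fin n))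
    (Q : ℝ →L[ℝ] ℝ) :
    Module.finrank ℝ (block n (P, Q) : Ext n →ₗ[ℝ] Ext n).range =
      Module.finrank ℝ (P : EuclideanSpace ℝ (Fin n) →ₗ[ℝ] EuclideanSpace ℝ (Fin n)).range +
        Module.finrank ℝ (Q : ℝ →ₗ[ℝ] ℝ).range := by
  let e : Ext n ≃ₗ[ℝ] EuclideanSpace ℝ (Fin n) × ℝ := (extEquiv n).toLinearEquiv
  have h1 : (block n (P, Q) : Ext n →ₗ[ℝ] Ext n).range =
      (((P : EuclideanSpace ℝ (Fin n) →ₗ[ℝ] EuclideanSpace ℝ (Fin n)).range).prod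
        (Q : ℝ →ₗ[ℝ] ℝ).range).map
        (e.symm : (EuclideanSpace ℝ (Fin n) × ℝ) →ₗ[ℝ] Ext n) := by
    rw [← LinearMap.range_prodMap, ← LinearMap.range_comp, ← LinearMap.range_comp_of_range_eq_top
      _ (LinearEquiv.range e)]
    rfl
  rw [h1, LinearEquiv.finrank_map_eq, ← Module.finrank_prod]
  exact LinearEquiv.finrank_eq
    { toFun := fun x => (⟨x.1.1, x.2.1⟩, ⟨x.1.2, x.2.2⟩)
      invFun := fun x => ⟨(x.1.1, x.2.1), ⟨x.1.2, x.2.2⟩⟩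
      map_add' := fun _ _ => rfl
      map_smul' := fun _ _ => rfl
      left_inv := fun _ => rfl
      right_inv := fun _ => rfl }

lemma charpoly_block (A : EuclideanSpace ℝ (Fin n) →L[ℝ] EuclideanSpace ℝ (Fin n)) (κ : ℝ) :
    (block n (A, κ • 1) : Ext n →ₗ[ℝ] Ext n).charpoly =
      (A : EuclideanSpace ℝ (Fin n) →ₗ[ℝ] EuclideanSpace ℝ (Fin n)).charpoly *
        (Polynomial.X - Polynomial.C κ) := by
  let e : Ext n ≃ₗ[ℝ] EuclideanSpace ℝ (Fin n) × ℝ := (extEquiv n).toLinearEquiv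
  have h1 : (block n (A, κ • 1) : Ext n →ₗ[ℝ] Ext n) =
      e.symm.conj ((A : EuclideanSpace ℝ (Fin n) →ₗ[ℝ] EuclideanSpace ℝ (Fin n)).prodMap
        (κ • LinearMap.id)) := rfl
  rw [h1, LinearEquiv.charpoly_conj, LinearMap.charpoly_prodMap]
  congr 1
  rw [← LinearMap.charpoly_toMatrix _ (Module.Basis.singleton Unit ℝ), Matrix.charpoly,
    Matrix.det_unique]
  simp [Matrix.charmatrix, Module.Basis.toMatrix_apply]

end Block

/-! ### Eigenvalues -/

section Eigenvalues

open Polynomial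

lemma mem_complexEigenvalues {V : Type*} [NormedAddCommGroup V] [InnerProductSpace ℝ V]
    [FiniteDimensional ℝ V] {A : Module.End ℝ V} {z : ℂ} :
    z ∈ complexEigenvalues A ↔ aeval z A.charpoly = 0 := by
  rw [complexEigenvalues, mem_roots, IsRoot.def, eval_map_algebraMap]
  exact (Polynomial.map_ne_zero_iff (algebraMap ℝ ℂ).injective).2 A.charpoly_monic.ne_zero

/-- The identity is det(cz - cB) = c^N det(z - B), with N the dimension, read off in a basis. -/
lemma aeval_charpoly_smul {V : Type*} [AddCommGroup V] [Module ℝ V]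
    [Module.Finite ℝ V] (A : Module.End ℝ V) (c : ℝ) (z : ℂ) :
    aeval ((c : ℂ) * z) (c • A).charpoly = (c : ℂ) ^ Module.finrank ℝ V * aeval z A.charpoly := by
  let b := Module.finBasis ℝ V
  have key : ∀ (B : Module.End ℝ V) (w : ℂ), aeval w B.charpoly =
      (Matrix.scalar _ w - (LinearMap.toMatrix b b B).map (algebraMap ℝ ℂ)).det := by
    intro B w
    rw [← eval_map_algebraMap, ← LinearMap.charpoly_toMatrix B b, ← Matrix.charpoly_map,
      Matrix.eval_charpoly]
  have hdet := fun M : Matrix (Fin (Module.finrank ℝ V)) (Fin (Module.finrank ℝ V)) ℂ =>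
    Matrix.det_smul M (c : ℂ)
  simp only [Fintype.card_fin] at hdet
  rw [key, key, ← hdet]
  congr 1
  ext i j
  simp [Matrix.scalar_apply, Matrix.diagonal_apply, mul_sub]

lemma mem_complexEigenvalues_smul {V : Type*} [NormedAddCommGroup V] [InnerProductSpace ℝ V]
    [FiniteDimensional ℝ V] {A : Module.End ℝ V} {c : ℝ} (hc : c ≠ 0) {z : ℂ} :
    (c : ℂ) * z ∈ complexEigenvalues (c • A) ↔ z ∈ complexEigenvalues A := by
  rw [mem_complexEigenvalues, mem_complexEigenvalues, aeval_charpoly_smul]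
  have : (c : ℂ) ^ Module.finrank ℝ V ≠ 0 := pow_ne_zero _ (by exact_mod_cast hc)
  simp [this]

end Eigenvalues

/-! ### The compactified system -/

section Compactified

variable {n d : ℕ}
  {f : EuclideanSpace ℝ (Fin n) × EuclideanSpace ℝ (Fin d) → EuclideanSpace ℝ (Fin n)}
  {Λ : ℝ → EuclideanSpace ℝ (Fin d)} {lamP lamM : EuclideanSpace ℝ (Fin d)} {α r : ℝ}

/-- Smoothness holds on the whole extended space and not only on the slab, so the theory of flows
applies up to and across S⁺ and S⁻. -/
lemma contDiff_compactified (hf : ContDiff ℝ 1 f)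
    (hin : ContDiff ℝ 1 (inputOfS Λ lamP lamM α)) :
    ContDiff ℝ 1 (compactified f Λ lamP lamM α r) := by
  have h1 : ContDiff ℝ 1 fun p : Ext n => p.fst := contDiff_fst.comp (extEquiv n).contDiff
  have h2 : ContDiff ℝ 1 fun p : Ext n => p.snd := contDiff_snd.comp (extEquiv n).contDiff
  have h3 : ContDiff ℝ 1 fun p : Ext n => (r⁻¹ • f (p.fst, inputOfS Λ lamP lamM α p.snd),
      α * (1 - p.snd ^ 2) / 2) :=
    ((hf.comp (h1.prodMk (hin.comp h2))).const_smul r⁻¹).prodMk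
      ((contDiff_const.mul (contDiff_const.sub (h2.pow 2))).div_const 2)
  exact (extEquiv n).symm.contDiff.comp h3

/-- The x-equation depends on s only through the input, whose derivative at σ is zero; this removes
the off-diagonal block. -/
lemma hasFDerivAt_compactified (hf : ContDiff ℝ 1 f) {x : EuclideanSpace ℝ (Fin n)} {σ : ℝ}
    {lam : EuclideanSpace ℝ (Fin d)} (hσ : inputOfS Λ lamP lamM α σ = lam)
    (hin : HasDerivAt (inputOfS Λ lamP lamM α) 0 σ) :
    HasFDerivAt (compactified f Λ lamP lamM α r)
      (block n (r⁻¹ • fderiv ℝ (frozen f lam) x, (-(α * σ)) • 1)) (pair x σ) := by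
  have hfd : HasFDerivAt f (fderiv ℝ f (x, lam)) (x, lam) :=
    ((hf.differentiable one_ne_zero) (x, lam)).hasFDerivAt
  have hfr : HasFDerivAt (frozen f lam) ((fderiv ℝ f (x, lam)).comp
      ((ContinuousLinearMap.id ℝ _).prod 0)) x :=
    HasFDerivAt.comp x hfd ((hasFDerivAt_id x).prodMk (hasFDerivAt_const lam x))
  have h1 : HasFDerivAt (fun p : Ext n => p.fst) (fstL n) (pair x σ) :=
    (fstL n).hasFDerivAt
  have h2 : HasFDerivAt (fun p : Ext n => p.snd) (sndL n) (pair x σ) :=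
    (sndL n).hasFDerivAt
  have h3 : HasFDerivAt (fun p : Ext n => inputOfS Λ lamP lamM α p.snd)
      (0 : Ext n →L[ℝ] EuclideanSpace ℝ (Fin d)) (pair x σ) := by
    have : HasFDerivAt (inputOfS Λ lamP lamM α) (0 : ℝ →L[ℝ] EuclideanSpace ℝ (Fin d)) σ := by
      have := hin.hasFDerivAt
      simpa using this
    have h4 := HasFDerivAt.comp (pair x σ) (g := inputOfS Λ lamP lamM α) this h2
    exact h4.congr_fderiv (ContinuousLinearMap.zero_comp _)
  have h4 : HasFDerivAt (fun p : Ext n => f (p.fst, inputOfS Λ lamP lamM α p.snd))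
      ((fderiv ℝ f (x, lam)).comp ((fstL n).prod 0)) (pair x σ) := by
    refine HasFDerivAt.comp (pair x σ) (g := f) (f := fun p : Ext n => (p.fst,
      inputOfS Λ lamP lamM α p.snd)) ?_ (h1.prodMk h3)
    change HasFDerivAt f _ (x, inputOfS Λ lamP lamM α σ)
    rw [hσ]; exact hfd
  have h5 : HasDerivAt (fun s : ℝ => α * (1 - s ^ 2) / 2) (-(α * σ)) σ := by
    refine ((((hasDerivAt_pow 2 σ).const_sub 1).const_mul α).div_const 2).congr_deriv ?_
    simp; ring
  have h6 := HasDerivAt.comp_hasFDerivAt (pair x σ) (h₂ := fun s : ℝ => α * (1 - s ^ 2) / 2)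
    (f := fun p : Ext n => p.snd) h5 h2
  have h7 := (h4.const_smul r⁻¹).prodMk h6
  have h8 := ((extEquiv n).symm : EuclideanSpace ℝ (Fin n) × ℝ →L[ℝ] Ext n).hasFDerivAt.comp
    (pair x σ) h7
  refine HasFDerivAt.congr_fderiv (f := compactified f Λ lamP lamM α r) h8 ?_
  rw [hfr.fderiv]
  exact ContinuousLinearMap.ext fun v => rfl

lemma uniqueDiffOn_of_convex {V : Type*} [NormedAddCommGroup V] [NormedSpace ℝ V] {s : Set V}
    (hs : ∀ x ∈ s, ∀ y ∈ s, ∀ a b : ℝ, 0 ≤ a → 0 ≤ b → a + b = 1 → a • x + b • y ∈ s) {U : Set V}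
    (hU : IsOpen U) (hUs : U ⊆ s) (hne : U.Nonempty) : UniqueDiffOn ℝ s :=
  uniqueDiffOn_convex (fun x hx y hy a b ha hb hab => hs x hx y hy a b ha hb hab)
    (hne.mono (interior_maximal hUs hU))

/-- The slab is convex with nonempty interior. Hence the Jacobian taken within it is the full
derivative, also at boundary points. -/
lemma uniqueDiffOn_phaseSpace (n : ℕ) : UniqueDiffOn ℝ (phaseSpace n) := by
  have hsnd : Continuous fun p : Ext n => p.snd := continuous_snd.comp (extEquiv n).continuous
  refine uniqueDiffOn_of_convex (U := {p : Ext n | p.snd ∈ Ioo (-1 : ℝ) 1}) ?_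
    (isOpen_Ioo.preimage hsnd) (fun p hp => Ioo_subset_Icc_self hp) ⟨pair 0 0, ?_⟩
  · intro p hp q hq a b ha hb hab
    exact (convex_Icc (-1 : ℝ) 1) hp hq ha hb hab
  · change (0 : ℝ) ∈ Ioo (-1 : ℝ) 1
    norm_num

/-- A scalar linear equation preserves signs. -/
lemma exists_pos_mul_of_linear {u c : ℝ → ℝ} {T : ℝ} (hT : 0 ≤ T) (hc : ContinuousOn c (Icc 0 T))
    (hu : ∀ t ∈ Icc 0 T, HasDerivWithinAt u (c t * u t) (Icc 0 T) t) :
    ∃ k > 0, u T = k * u 0 := by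
  let c' : ℝ → ℝ := IccExtend hT ((Icc 0 T).domRestrict c)
  have hc' : Continuous c' := (continuousOn_iff_continuous_domRestrict.1 hc).Icc_extend'
  have hcc : ∀ t ∈ Icc 0 T, c' t = c t := fun t ht => IccExtend_of_mem hT _ ht
  let I : ℝ → ℝ := fun t => ∫ s in (0 : ℝ)..t, c' s
  have hI : ∀ t, HasDerivAt I (c' t) t := fun t =>
    intervalIntegral.integral_hasDerivAt_right (hc'.intervalIntegrable _ _)
      hc'.stronglyMeasurable.stronglyMeasurableAtFilter hc'.continuousAt
  have hv : ∀ t ∈ Icc 0 T, HasDerivWithinAt (fun t => u t * Real.exp (-I t)) 0 (Icc 0 T) t := by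
    intro t ht
    refine ((hu t ht).mul (hI t).neg.exp.hasDerivWithinAt).congr_deriv ?_
    rw [hcc t ht]; simp only [Pi.neg_apply]; ring
  have hconst := constant_of_has_deriv_right_zero (a := 0) (b := T)
    (f := fun t => u t * Real.exp (-I t))
    (fun t ht => (hv t ht).continuousWithinAt)
    (fun t ht => (hv t (Ico_subset_Icc_self ht)).mono_of_mem_nhdsWithin
      (Icc_mem_nhdsGE_of_mem ht)) T (right_mem_Icc.2 hT)
  refine ⟨Real.exp (I T), Real.exp_pos _, ?_⟩
  have h0 : I 0 = 0 := by simp [I]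
  simp only [h0, neg_zero, Real.exp_zero, mul_one] at hconst
  rw [← hconst, mul_left_comm, ← Real.exp_add]
  simp

lemma hasDerivWithinAt_snd {F : Ext n → Ext n} {X : Set (Ext n)} {γ : ℝ → Ext n} {I : Set ℝ}
    (hγ : IsSolution F X γ I) : ∀ t ∈ I, HasDerivWithinAt (fun t => (γ t).snd) (F (γ t)).snd I t := by
  intro t ht
  have := (sndL n).hasFDerivAt.comp_hasDerivWithinAt t (hγ t ht).2
  exact this

/-- Along a solution 1 - s and 1 + s each satisfy a scalar linear equation, for instance (1-s)' =
-(α(1+s)/2)(1-s). Each is thus multiplied by a positive factor, and signs agree at both ends of the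
time interval. -/
lemma isInvariant_phaseSpace : IsInvariant (compactified f Λ lamP lamM α r) (phaseSpace n) := by
  intro γ T hT hγ
  have hs := hasDerivWithinAt_snd hγ
  have hsc : ContinuousOn (fun t => (γ t).snd) (Icc 0 T) := fun t ht =>
    (hs t ht).continuousWithinAt
  obtain ⟨k, hk, h1⟩ := exists_pos_mul_of_linear (u := fun t => 1 - (γ t).snd)
    (c := fun t => -(α * (1 + (γ t).snd) / 2)) hT (by fun_prop) (fun t ht => by
      refine ((hs t ht).const_sub 1).congr_deriv ?_
      change -(α * (1 - (γ t).snd ^ 2) / 2) = _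
      ring)
  obtain ⟨m, hm, h2⟩ := exists_pos_mul_of_linear (u := fun t => 1 + (γ t).snd)
    (c := fun t => α * (1 - (γ t).snd) / 2) hT (by fun_prop) (fun t ht => by
      refine ((hs t ht).const_add 1).congr_deriv ?_
      change α * (1 - (γ t).snd ^ 2) / 2 = _
      ring)
  change (γ 0).snd ∈ Icc (-1 : ℝ) 1 ↔ (γ T).snd ∈ Icc (-1 : ℝ) 1
  have e1 : ∀ s : ℝ, s ∈ Icc (-1 : ℝ) 1 ↔ 0 ≤ 1 - s ∧ 0 ≤ 1 + s := by
    intro s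
    constructor
    · rintro ⟨h, h'⟩; constructor <;> linarith
    · rintro ⟨h, h'⟩; constructor <;> linarith
  rw [e1, e1, h1, h2, mul_nonneg_iff_of_pos_left hk, mul_nonneg_iff_of_pos_left hm]

end Compactified

/-! ### The spectrum at a regular edge state -/

section EdgeState

variable {V : Type*} [NormedAddCommGroup V] [InnerProductSpace ℝ V] [FiniteDimensional ℝ V]
  {F : V → V} {θ : Set V} {η : V}

/-- At an equilibrium in a normally repelling hypersurface not all directions are contracted. -/
lemma IsNormallyRepelling.not_isDichotomy_one {ν : V → V} (hν : IsUnitNormalField θ ν)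
    (hrep : IsNormallyRepelling F θ ν) (hη : η ∈ θ) (hFη : F η = 0) :
    ¬ IsDichotomy (fderiv ℝ F η) 1 := by
  have : CompleteSpace V := FiniteDimensional.complete ℝ V
  intro hdich
  set A := fderiv ℝ F η with hA
  have hsol : IsSolution F univ (fun _ => η) (Ici 0) := fun t _ =>
    ⟨mem_univ _, by rw [hFη]; exact hasDerivWithinAt_const _ _ _⟩
  obtain ⟨β, a, c, C, hβ, -, hc, h⟩ := hrep _ hsol hη
  -- Perturb the constant trajectory in the normal direction: repulsion keeps the normal component
  -- of e^{tA}ν at least c for t ≥ 0, while a dichotomy with trivial unstable part forces e^{tA} →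
  -- 0.
  have hw : IsVariation F (fun _ => η) fun t => NormedSpace.exp (t • A) (ν η) := by
    intro t _
    have h1 : HasDerivAt (fun t : ℝ => NormedSpace.exp (t • A)) (A * NormedSpace.exp (t • A)) t :=
      hasDerivAt_exp_smul_const' A t
    exact (h1.clm_apply (hasDerivAt_const t (ν η))).hasDerivWithinAt.congr_deriv (by simp [hA])
  have h1 := (h _ hw).1
  have hnorm := (hν.2 η hη).1
  have h2 : ∀ t : ℝ, 0 ≤ t → c ≤ ‖NormedSpace.exp (t • A) * 1‖ := by
    intro t ht
    have h3 := h1 t ht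
    have h4 : (inner ℝ (ν η) (NormedSpace.exp ((0 : ℝ) • A) (ν η)) : ℝ) = 1 := by
      rw [zero_smul, NormedSpace.exp_zero, one_apply_eq_self,
        real_inner_self_eq_norm_sq, hnorm, one_pow]
    rw [h4, abs_one, mul_one] at h3
    have h5 : c ≤ c * Real.exp (β * t) :=
      le_mul_of_one_le_right hc.le (Real.one_le_exp (by positivity))
    have h6 := abs_real_inner_le_norm (ν η) (NormedSpace.exp (t • A) (ν η))
    have h7 := (NormedSpace.exp (t • A)).le_opNorm (ν η)
    rw [hnorm] at h6 h7
    rw [mul_one]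
    linarith
  have h3 := ge_of_tendsto hdich.stable.norm ((eventually_ge_atTop 0).mono h2)
  rw [norm_zero] at h3
  exact absurd hc (not_lt.2 h3)

omit [FiniteDimensional ℝ V] in
/-- The tangent space of an embedded submanifold. -/
lemma IsEmbeddedSubmanifold.exists_tangentSpace {k : ℕ} (hS : IsEmbeddedSubmanifold univ θ k)
    (hη : η ∈ θ) : ∃ T : Submodule ℝ V, Module.finrank ℝ T = k ∧ ∀ w ∈ T, ∃ c : ℝ → V,
      c 0 = η ∧ HasDerivAt c w 0 ∧ ∀ᶠ ε in 𝓝 0, c ε ∈ θ := by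
  obtain ⟨Φ, hηΦ, hΦ, hΦs, L, hL, hmem, -⟩ := hS.2 η hη
  have hηt := Φ.map_source hηΦ
  have hd : HasFDerivAt Φ (fderiv ℝ Φ η) η :=
    ((hΦ.contDiffAt (Φ.open_source.mem_nhds hηΦ)).differentiableAt one_ne_zero).hasFDerivAt
  have hds : HasFDerivAt Φ.symm (fderiv ℝ Φ.symm (Φ η)) (Φ η) :=
    ((hΦs.contDiffAt (Φ.open_target.mem_nhds hηt)).differentiableAt one_ne_zero).hasFDerivAt
  set B := fderiv ℝ Φ.symm (Φ η) with hB
  have hcomp : (fderiv ℝ Φ η).comp B = ContinuousLinearMap.id ℝ V := by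
    have h1 : HasFDerivAt (Φ ∘ Φ.symm) ((fderiv ℝ Φ η).comp B) (Φ η) :=
      HasFDerivAt.comp _ (by rwa [Φ.left_inv hηΦ]) hds
    have h2 : HasFDerivAt (Φ ∘ Φ.symm) (ContinuousLinearMap.id ℝ V) (Φ η) :=
      (hasFDerivAt_id _).congr_of_eventuallyEq
        (Filter.mem_of_superset (Φ.open_target.mem_nhds hηt) fun y hy => Φ.right_inv hy)
    exact h1.unique h2
  have hinj : Function.Injective B := Function.LeftInverse.injective (g := fderiv ℝ Φ η)
    fun v => congrArg (fun M : V →L[ℝ] V => M v) hcomp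
  -- The tangent space is the image of L under the derivative of the inverse chart; its vectors are
  -- velocities of images of lines in L.
  refine ⟨L.map (B : V →ₗ[ℝ] V), ?_, ?_⟩
  · rw [← hL]
    exact (L.equivMapOfInjective (B : V →ₗ[ℝ] V) hinj).finrank_eq.symm
  · rintro _ ⟨l, hl, rfl⟩
    have hline : HasDerivAt (fun ε : ℝ => Φ η + ε • l) l 0 := by
      simpa using ((hasDerivAt_id (0 : ℝ)).smul_const l).const_add (Φ η)
    have h0 : Φ η + (0 : ℝ) • l = Φ η := by simp
    refine ⟨fun ε => Φ.symm (Φ η + ε • l), ?_, ?_, ?_⟩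
    · change Φ.symm (Φ η + (0 : ℝ) • l) = η
      rw [h0, Φ.left_inv hηΦ]
    · exact HasFDerivAt.comp_hasDerivAt (0 : ℝ) (by rwa [h0]) hline
    · have h1 : ∀ᶠ ε in 𝓝 (0 : ℝ), Φ η + ε • l ∈ Φ.target :=
        hline.continuousAt.eventually_mem (by rw [h0]; exact Φ.open_target.mem_nhds hηt)
      filter_upwards [h1] with ε hε
      refine (hmem _ (Φ.map_target hε)).2 ⟨mem_univ _, ?_⟩
      rw [Φ.right_inv hε]
      exact L.add_mem ((hmem η hηΦ).1 hη).2 (L.smul_mem _ hl)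

/-- A submanifold of a stable graph has dimension complementary to the unstable directions. -/
lemma IsStableGraph.finrank_le {P : V →L[ℝ] V} {O : Set V} {h : V → V} {k : ℕ}
    (H : IsStableGraph P η O h) (hP : P * P = P) (hS : IsEmbeddedSubmanifold univ θ k)
    (hη : η ∈ θ) (hθ : ∀ᶠ y in 𝓝[θ] η, h y = y) :
    k + Module.finrank ℝ ((1 - P : V →L[ℝ] V) : V →ₗ[ℝ] V).range ≤ Module.finrank ℝ V := by
  obtain ⟨T, rfl, hT⟩ := hS.exists_tangentSpace hη
  refine Submodule.finrank_add_finrank_le_of_disjoint (Submodule.disjoint_def.2 ?_)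
  rintro w hw ⟨u, rfl⟩
  obtain ⟨c, hc0, hc, hcθ⟩ := hT _ hw
  set w := ((1 - P : V →L[ℝ] V) : V →ₗ[ℝ] V) u with hwdef
  have hPw : P w = 0 := by
    change P (u - P u) = 0
    rw [map_sub, sub_eq_zero]
    exact (congrArg (fun M : V →L[ℝ] V => M u) hP).symm
  have h1 : Tendsto c (𝓝 0) (𝓝[θ] η) :=
    tendsto_nhdsWithin_iff.2 ⟨hc0 ▸ hc.continuousAt, hcθ⟩
  have hd : HasFDerivAt h (fderiv ℝ h (P (c 0))) (P (c 0)) :=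
    ((H.contDiffOn.contDiffAt (H.isOpen.mem_nhds (by
      rw [hc0]; exact (H.proj_mem η).2 H.mem))).differentiableAt one_ne_zero).hasFDerivAt
  -- A curve in θ satisfies c = h(Pc). If its velocity w is tangent to θ and Pw = 0, differentiating
  -- gives w = 0, so the tangent space meets the range of 1 - P trivially.
  have h2 : HasDerivAt (fun ε => h (P (c ε))) (fderiv ℝ h (P (c 0)) (P w)) 0 :=
    hd.comp_hasDerivAt (0 : ℝ) (P.hasFDerivAt.comp_hasDerivAt (0 : ℝ) hc)
  rw [hPw, map_zero] at h2
  refine hc.unique (h2.congr_of_eventuallyEq ?_)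
  filter_upwards [h1.eventually hθ] with ε hε
  rw [H.apply_proj, hε]

/-- Both curves stay in one ball over the compact time interval, so they are trajectories of the
same cut-off flow. -/
lemma IsSolution.eqOn_of_contDiff (hF : ContDiff ℝ 1 F) {X Y : Set V} {γ₁ γ₂ : ℝ → V} {T : ℝ}
    (h₁ : IsSolution F X γ₁ (Icc 0 T)) (h₂ : IsSolution F Y γ₂ (Icc 0 T)) (h0 : γ₁ 0 = γ₂ 0) :
    ∀ t ∈ Icc 0 T, γ₁ t = γ₂ t := by
  obtain ⟨R, hR⟩ := ((isCompact_Icc.image_of_continuousOn h₁.continuousOn).union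
    (isCompact_Icc.image_of_continuousOn h₂.continuousOn)).isBounded.subset_closedBall (0 : V)
  obtain ⟨G, K, φ, -, hK, hφ, hGF⟩ := exists_isFlow_eqOn hF (0 : V) (R := max R 1) (by positivity)
  have hsub := hR.trans (Metric.closedBall_subset_closedBall (le_max_left R 1))
  intro t ht
  rw [hφ.eq_of_isSolution hK hGF h₁ (fun s hs => hsub (Or.inl ⟨s, hs, rfl⟩)) t ht,
    hφ.eq_of_isSolution hK hGF h₂ (fun s hs => hsub (Or.inr ⟨s, hs, rfl⟩)) t ht, h0]

/-- Points of an attractor in an embedded invariant submanifold are Lyapunov stable there. -/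
lemma eventually_forall_mem_ball {k : ℕ} (hF : ContDiff ℝ 1 F) (hFη : F η = 0)
    (hS : IsEmbeddedSubmanifold univ θ k) (hinv : IsForwardInvariant F θ) (hη : η ∈ θ) {D : Set V}
    (hDθ : D ⊆ θ) (hD : D ∈ 𝓝[θ] η) (hω : omegaLimitSet F D ∩ θ = {η}) {δ : ℝ} (hδ : 0 < δ) :
    ∀ᶠ y in 𝓝[θ] η, ∀ γ : ℝ → V, IsSolution F univ γ (Ici 0) → γ 0 = y →
      ∀ t ∈ Ici (0 : ℝ), γ t ∈ Metric.ball η δ := by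
  obtain ⟨Φ, hηΦ, hΦ, -, L, -, hmem, -⟩ := hS.2 η hη
  obtain ⟨ε₀, hε₀, hball⟩ := Metric.nhds_basis_closedBall.mem_iff.1
    (Φ.open_source.mem_nhds hηΦ)
  set ε := min ε₀ δ with hεdef
  have hε : 0 < ε := lt_min hε₀ hδ
  have hεΦ : Metric.sphere η ε ⊆ Φ.source := Metric.sphere_subset_closedBall.trans
    ((Metric.closedBall_subset_closedBall (min_le_left _ _)).trans hball)
  -- An embedded submanifold is closed inside a chart domain, so small spheres about η meet θ in a
  -- compact set.
  have hK : IsCompact (Metric.sphere η ε ∩ θ) := by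
    have h1 : Metric.sphere η ε ∩ θ = Metric.sphere η ε ∩ Φ ⁻¹' L := by
      ext y
      constructor
      · rintro ⟨h, h'⟩; exact ⟨h, ((hmem y (hεΦ h)).1 h').2⟩
      · rintro ⟨h, h'⟩; exact ⟨h, (hmem y (hεΦ h)).2 ⟨mem_univ _, h'⟩⟩
    rw [h1]
    exact (isCompact_sphere η ε).of_isClosed_subset
      ((hΦ.continuousOn.mono hεΦ).preimage_isClosed_of_isClosed Metric.isClosed_sphere
        L.closed_of_finiteDimensional) inter_subset_left
  let Z : ℝ → Set V := fun T => closure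
    {y | ∃ γ : ℝ → V, IsSolution F univ γ (Ici 0) ∧ γ 0 ∈ D ∧ ∃ t : ℝ, T < t ∧ γ t = y}
  have hZ : Antitone Z := fun T T' hT => closure_mono fun y ⟨γ, h1, h2, t, h3, h4⟩ =>
    ⟨γ, h1, h2, t, hT.trans_lt h3, h4⟩
  -- The closed tails decrease to the ω-limit set, whose only point in θ is the centre η. By
  -- compactness some tail already misses the sphere.
  obtain ⟨i, hi⟩ := hK.elim_directed_family_closed (fun i : ℕ => Z (i + 1))
    (fun i => isClosed_closure) (by
      rw [eq_empty_iff_forall_notMem]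
      rintro y ⟨⟨hy, hyθ⟩, hyZ⟩
      have h1 : y ∈ omegaLimitSet F D ∩ θ := by
        refine ⟨mem_iInter₂.2 fun T _ => ?_, hyθ⟩
        obtain ⟨i, hi⟩ := exists_nat_gt T
        exact hZ (by linarith : T ≤ (i : ℝ) + 1) (mem_iInter.1 hyZ i)
      rw [hω, mem_singleton_iff] at h1
      rw [h1, mem_sphere_iff_norm, sub_self, norm_zero] at hy
      exact hε.ne hy)
    (directed_of_isDirected_le fun i j hij => hZ (by gcongr))
  obtain ⟨G, K, φ, -, hGK, hφ, hGF⟩ := exists_isFlow_eqOn hF η hε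
  have hGη : G η = 0 := by rw [hGF η (Metric.mem_closedBall_self hε.le), hFη]
  -- Up to time i + 2 continuity of the flow keeps orbits inside; a later exit would cross the
  -- sphere at a time beyond i + 1, where the tail misses it.
  have hN : {v | ∀ t ∈ Icc (0 : ℝ) (i + 2), φ t v ∈ Metric.ball η ε} ∈ 𝓝 η :=
    (hφ.isOpen_setOf_mem_ball hGK η ε _).mem_nhds fun t _ => by
      rw [hφ.fixed hGK hGη]; exact Metric.mem_ball_self hε
  filter_upwards [hD, nhdsWithin_le_nhds hN] with y hyD hyN γ hγ hγ0
  have hearly : ∀ t ∈ Icc (0 : ℝ) (i + 2), γ t ∈ Metric.ball η ε := by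
    intro t ht
    rw [(hγ.mono Icc_subset_Ici_self subset_rfl).eqOn_of_contDiff hF
      (hφ.isSolution (fun x hx => hGF x (Metric.ball_subset_closedBall hx)) hyN)
      (hγ0.trans (hφ.zero y).symm) t ht]
    exact hyN t ht
  intro t ht
  refine Metric.ball_subset_ball (min_le_right ε₀ δ) ?_
  by_contra hout
  have hi0 : (0 : ℝ) ≤ i := i.cast_nonneg
  have hti : (i : ℝ) + 2 ≤ t := by
    by_contra! h
    exact hout (hearly t ⟨ht, h.le⟩)
  have hcont : ContinuousOn (fun s => dist (γ s) η) (Icc (i + 2 : ℝ) t) :=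
    (continuous_id.dist continuous_const).comp_continuousOn (hγ.continuousOn.mono
      fun s (hs : s ∈ Icc (i + 2 : ℝ) t) => mem_Ici.2 (by linarith [hs.1]))
  obtain ⟨s, hs, hsε⟩ := intermediate_value_Icc hti hcont
    ⟨(Metric.mem_ball.1 (hearly (i + 2) ⟨by linarith, le_rfl⟩)).le,
      not_lt.1 fun h => hout (Metric.mem_ball.2 h)⟩
  have hs0 : 0 ≤ s := by linarith [hs.1]
  have hmemZ : γ s ∈ Metric.sphere η ε ∩ θ ∩ Z (i + 1) := by
    refine ⟨⟨hsε, hinv γ s (hγ.mono Icc_subset_Ici_self subset_rfl) ?_ s ⟨hs0, le_rfl⟩⟩,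
      subset_closure ⟨γ, hγ, ?_, s, by linarith [hs.1], rfl⟩⟩
    · rw [hγ0]; exact hDθ hyD
    · rw [hγ0]; exact hyD
  rw [hi] at hmemZ
  exact hmemZ

omit [FiniteDimensional ℝ V] in
lemma jacobian_univ : jacobian F univ η = (fderiv ℝ F η : V →ₗ[ℝ] V) := by
  rw [jacobian, fderivWithin_univ]

/-- The unstable directions at a regular edge state form a line. -/
theorem IsEquilibriumRegularEdgeState.exists_isDichotomy (hF : ContDiff ℝ 1 F)
    (h : IsEquilibriumRegularEdgeState F η) : ∃ P, IsDichotomy (fderiv ℝ F η) P ∧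
      Module.finrank ℝ (P : V →ₗ[ℝ] V).range + 1 = Module.finrank ℝ V ∧
      Module.finrank ℝ ((1 - P : V →L[ℝ] V) : V →ₗ[ℝ] V).range = 1 ∧
      ∃ z ∈ complexEigenvalues (jacobian F univ η), 0 < z.re := by
  obtain ⟨hhyp, θ, hθ, hη, hθs, D, hDθ, hD, hω⟩ := h
  obtain ⟨ν, hν, hrep⟩ := hθ.normallyRepelling
  obtain ⟨k, hk, hemb⟩ := hθ.embedded
  have hnot := hrep.not_isDichotomy_one hν hη hhyp.equilibrium
  have hspec := hhyp.hyperbolic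
  simp only [jacobian_univ, mem_complexEigenvalues] at hspec
  obtain ⟨P, hP⟩ := RTip.exists_isDichotomy (fderiv ℝ F η) hspec
  have hsum : Module.finrank ℝ (P : V →ₗ[ℝ] V).range +
      Module.finrank ℝ ((1 - P : V →L[ℝ] V) : V →ₗ[ℝ] V).range = Module.finrank ℝ V := by
    have hker : ((1 - P : V →L[ℝ] V) : V →ₗ[ℝ] V).range = (P : V →ₗ[ℝ] V).ker := by
      ext v
      constructor
      · rintro ⟨u, rfl⟩
        change P (u - P u) = 0
        rw [map_sub, sub_eq_zero]
        exact (congrArg (fun M : V →L[ℝ] V => M u) hP.idem).symm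
      · intro hv
        refine ⟨v, ?_⟩
        change v - P v = v
        rw [show P v = 0 from hv, sub_zero]
    rw [hker]
    exact LinearMap.finrank_range_add_finrank_ker _
  obtain ⟨δ, hδ, hloc⟩ := exists_localStableSet_eq_graph hF hhyp.equilibrium hP
  obtain ⟨O, g, H, hOg⟩ := hloc δ hδ le_rfl
  have hgraph : ∀ᶠ y in 𝓝[θ] η, g y = y := by
    filter_upwards [eventually_forall_mem_ball hF hhyp.equilibrium hemb hθ.forwardInvariant hη
      hDθ hD hω hδ, self_mem_nhdsWithin] with y hy hyθ
    obtain ⟨γ, hγ, hγ0, hlim⟩ := hθs hyθ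
    have : y ∈ localStableSet F univ (Metric.ball η δ) η := ⟨γ, hγ, hγ0, hy γ hγ hγ0, hlim⟩
    rw [hOg] at this
    exact this.2
  -- As dim θ is one less than the dimension of the space, the unstable dimension is at most 1;
  -- normal repulsion excludes 0.
  have hle := H.finrank_le hP.idem hemb hη hgraph
  have hpos : Module.finrank ℝ ((1 - P : V →L[ℝ] V) : V →ₗ[ℝ] V).range ≠ 0 := by
    intro h0
    rw [Submodule.finrank_eq_zero, LinearMap.range_eq_bot] at h0
    have h1 : P = 1 := by
      ext v
      have : v - P v = 0 := congrArg (fun M : V →ₗ[ℝ] V => M v) h0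
      exact (sub_eq_zero.1 this).symm
    exact hnot (h1 ▸ hP)
  refine ⟨P, hP, by omega, by omega, ?_⟩
  by_contra! hneg
  -- With no eigenvalue in the right half-plane, hyperbolicity would place all of them on the left,
  -- and every direction would contract.
  refine hnot (isDichotomy_one _ fun z hz => ?_)
  have hz' : z ∈ complexEigenvalues (jacobian F univ η) := by
    rwa [jacobian_univ, mem_complexEigenvalues]
  exact lt_of_le_of_ne (hneg z hz') (hhyp.hyperbolic z hz')

end EdgeState

/-! ### Equilibria of the compactified system -/

lemma jacobian_eq_of_hasFDerivAt {V : Type*} [NormedAddCommGroup V] [InnerProductSpace ℝ V]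
    {F : V → V} {F' : V →L[ℝ] V} {X : Set V} {p : V} (hF : HasFDerivAt F F' p)
    (hX : UniqueDiffWithinAt ℝ X p) : jacobian F X p = (F' : V →ₗ[ℝ] V) := by
  rw [jacobian, hF.hasFDerivWithinAt.fderivWithin hX]

section Compactified

variable {n d : ℕ}
  {f : EuclideanSpace ℝ (Fin n) × EuclideanSpace ℝ (Fin d) → EuclideanSpace ℝ (Fin n)}
  {Λ : ℝ → EuclideanSpace ℝ (Fin d)} {lamP lamM lam : EuclideanSpace ℝ (Fin d)} {α r σ : ℝ}
  {x : EuclideanSpace ℝ (Fin n)}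

lemma hasEigenvector_block (A : EuclideanSpace ℝ (Fin n) →L[ℝ] EuclideanSpace ℝ (Fin n)) (κ : ℝ) :
    Module.End.HasEigenvector (block n (A, κ • 1) : Ext n →ₗ[ℝ] Ext n) κ (pair 0 1) := by
  refine ⟨Module.End.mem_eigenspace_iff.2 ?_, fun h => ?_⟩
  · change pair (A 0) (κ • (1 : ℝ)) = pair (κ • 0) (κ • (1 : ℝ))
    rw [map_zero, smul_zero]
  · have : (1 : ℝ) = 0 := congrArg (fun p : Ext n => p.snd) h
    exact one_ne_zero this

lemma isNormalTo_slice (s : ℝ) : IsNormalTo (pair 0 1 : Ext n) (slice n s) := by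
  intro p hp q hq
  have hp' : p.snd = s := hp
  have hq' : q.snd = s := hq
  rw [WithLp.prod_inner_apply]
  change inner ℝ (0 : EuclideanSpace ℝ (Fin n)) _ + inner ℝ (1 : ℝ) (p.snd - q.snd) = 0
  rw [hp', hq', sub_self, inner_zero_left, inner_zero_right, add_zero]

lemma jacobian_compactified (hf : ContDiff ℝ 1 f) (hσ : inputOfS Λ lamP lamM α σ = lam)
    (hin : HasDerivAt (inputOfS Λ lamP lamM α) 0 σ) (hσI : σ ∈ Icc (-1 : ℝ) 1) :
    jacobian (compactified f Λ lamP lamM α r) (phaseSpace n) (pair x σ) =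
      (block n (r⁻¹ • fderiv ℝ (frozen f lam) x, (-(α * σ)) • 1) : Ext n →ₗ[ℝ] Ext n) :=
  jacobian_eq_of_hasFDerivAt (hasFDerivAt_compactified hf hσ hin)
    (uniqueDiffOn_phaseSpace n _ hσI)

lemma compactified_eq_zero (hσ : inputOfS Λ lamP lamM α σ = lam) (hσ2 : σ ^ 2 = 1)
    (hx : frozen f lam x = 0) : compactified f Λ lamP lamM α r (pair x σ) = 0 := by
  change pair (r⁻¹ • f (x, inputOfS Λ lamP lamM α σ)) (α * (1 - σ ^ 2) / 2) = pair 0 0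
  have hx' : f (x, lam) = 0 := hx
  rw [hσ, hσ2, hx', smul_zero, sub_self, mul_zero, zero_div]

lemma complexEigenvalues_block (A : EuclideanSpace ℝ (Fin n) →L[ℝ] EuclideanSpace ℝ (Fin n))
    (κ : ℝ) : complexEigenvalues (block n (A, κ • 1) : Ext n →ₗ[ℝ] Ext n) =
      complexEigenvalues (A : EuclideanSpace ℝ (Fin n) →ₗ[ℝ] EuclideanSpace ℝ (Fin n)) +
        {(κ : ℂ)} := by
  have hne : ∀ p : Polynomial ℝ, p.Monic → p.map (algebraMap ℝ ℂ) ≠ 0 := fun p hp =>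
    (hp.map _).ne_zero
  rw [complexEigenvalues, charpoly_block, Polynomial.map_mul, Polynomial.roots_mul
    (mul_ne_zero (hne _ (LinearMap.charpoly_monic _)) (hne _ (Polynomial.monic_X_sub_C κ))),
    Polynomial.map_sub, Polynomial.map_X, Polynomial.map_C, Polynomial.roots_X_sub_C]
  rfl

lemma mem_complexEigenvalues_compactified (hf : ContDiff ℝ 1 f) (hr : 0 < r)
    (hσ : inputOfS Λ lamP lamM α σ = lam) (hin : HasDerivAt (inputOfS Λ lamP lamM α) 0 σ)
    (hσI : σ ∈ Icc (-1 : ℝ) 1) {z : ℂ} :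
    z ∈ complexEigenvalues
        (jacobian (compactified f Λ lamP lamM α r) (phaseSpace n) (pair x σ)) ↔
      (∃ w ∈ complexEigenvalues (jacobian (frozen f lam) univ x), z = (r⁻¹ : ℝ) * w) ∨
        z = (-(α * σ) : ℝ) := by
  have hr' : (r⁻¹ : ℝ) ≠ 0 := inv_ne_zero hr.ne'
  rw [jacobian_compactified hf hσ hin hσI, complexEigenvalues_block, Multiset.mem_add,
    Multiset.mem_singleton, ContinuousLinearMap.toLinearMap_smul, jacobian_univ]
  refine or_congr_left ⟨fun h => ?_, ?_⟩
  · have hz : z = ((r⁻¹ : ℝ) : ℂ) * (r * z) := by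
      rw [← mul_assoc, ← Complex.ofReal_mul, inv_mul_cancel₀ hr.ne', Complex.ofReal_one, one_mul]
    rw [hz] at h
    exact ⟨_, (mem_complexEigenvalues_smul hr').1 h, hz⟩
  · rintro ⟨w, hw, rfl⟩
    exact (mem_complexEigenvalues_smul hr').2 hw

lemma isHyperbolicEquilibrium_compactified (hf : ContDiff ℝ 1 f) (hr : 0 < r) (hα : 0 < α)
    (hσ : inputOfS Λ lamP lamM α σ = lam) (hin : HasDerivAt (inputOfS Λ lamP lamM α) 0 σ)
    (hσI : σ ∈ Icc (-1 : ℝ) 1) (hσ2 : σ ^ 2 = 1)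
    (hx : IsHyperbolicEquilibrium (frozen f lam) univ x) :
    IsHyperbolicEquilibrium (compactified f Λ lamP lamM α r) (phaseSpace n) (pair x σ) where
  mem := hσI
  equilibrium := compactified_eq_zero hσ hσ2 hx.equilibrium
  differentiable :=
    (hasFDerivAt_compactified hf hσ hin).differentiableAt.differentiableWithinAt
  hyperbolic := by
    intro z hz
    rcases (mem_complexEigenvalues_compactified hf hr hσ hin hσI).1 hz with ⟨w, hw, rfl⟩ | rfl
    · rw [Complex.re_ofReal_mul]
      exact mul_ne_zero (inv_ne_zero hr.ne') (hx.hyperbolic w hw)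
    · rw [Complex.ofReal_re]
      refine neg_ne_zero.2 (mul_ne_zero hα.ne' fun h => ?_)
      simp [h] at hσ2

lemma isLeadingEigenvector_compactified (hf : ContDiff ℝ 1 f) (hr : 0 < r)
    (hσ : inputOfS Λ lamP lamM α 1 = lam) (hin : HasDerivAt (inputOfS Λ lamP lamM α) 0 1)
    {l : ℂ} (hl : IsLeadingEigenvalue (jacobian (frozen f lam) univ x) l) (hlα : α < -l.re / r) :
    IsLeadingEigenvector
      (jacobian (compactified f Λ lamP lamM α r) (phaseSpace n) (pair x 1)) (pair 0 1) := by
  have hI : (1 : ℝ) ∈ Icc (-1 : ℝ) 1 := by norm_num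
  have hlt : ∀ w ∈ complexEigenvalues (jacobian (frozen f lam) univ x),
      (((r⁻¹ : ℝ) : ℂ) * w).re < -α := by
    intro w hw
    have h1 : r⁻¹ * w.re ≤ r⁻¹ * l.re := mul_le_mul_of_nonneg_left (hl.2 w hw) (by positivity)
    have h2 : -l.re / r = -(r⁻¹ * l.re) := by ring
    rw [Complex.re_ofReal_mul]
    linarith
  have hmem := fun z => mem_complexEigenvalues_compactified (x := x) (z := z) hf hr hσ hin hI
  refine ⟨-α, ?_, ?_, ?_⟩
  · rw [jacobian_compactified hf hσ hin hI, mul_one]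
    exact hasEigenvector_block _ _
  · rw [jacobian_compactified hf hσ hin hI, mul_one, complexEigenvalues_block, Multiset.count_add,
      Multiset.count_singleton_self, Nat.add_eq_right, Multiset.count_eq_zero]
    -- Algebraic simplicity: the x-block cannot have the eigenvalue -α, since all its eigenvalues
    -- have real part below -α.
    intro h
    rw [ContinuousLinearMap.toLinearMap_smul] at h
    have hz : ((-α : ℝ) : ℂ) = ((r⁻¹ : ℝ) : ℂ) * (r * (-α : ℝ)) := by
      rw [← mul_assoc, ← Complex.ofReal_mul, inv_mul_cancel₀ hr.ne', Complex.ofReal_one, one_mul]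
    rw [hz, mem_complexEigenvalues_smul (inv_ne_zero hr.ne'), ← jacobian_univ] at h
    have h1 := hlt _ h
    rw [← hz, Complex.ofReal_re] at h1
    exact lt_irrefl _ h1
  · intro z hz hne
    rcases (hmem z).1 hz with ⟨w, hw, rfl⟩ | rfl
    · exact hlt w hw
    · rw [mul_one] at hne
      exact absurd rfl hne

/-- The defining functional of the boundary depends on s alone, and the second component 1 of the
projection keeps s. The boundary is thus transverse to the range whatever P is. -/
lemma isTransverseHalfSpace_one {P : EuclideanSpace ℝ (Fin n) →L[ℝ] EuclideanSpace ℝ (Fin n)} :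
    IsTransverseHalfSpace (block n (P, 1)) (phaseSpace n) (pair x 1) := by
  refine ⟨{p | -1 < p.snd}, isOpen_Ioi.preimage (sndL n).continuous, ?_,
    Or.inr ⟨-sndL n, fun v => rfl, ⟨pair 0 1, ?_⟩, fun y hy => ?_⟩⟩
  · change (-1 : ℝ) < 1
    norm_num
  · change -(1 : ℝ) ≠ 0
    norm_num
  · change y.snd ∈ Icc (-1 : ℝ) 1 ↔ 0 ≤ -(y.snd - 1)
    exact ⟨fun h => by linarith [h.2], fun h => ⟨le_of_lt hy, by linarith⟩⟩

lemma isTransverseHalfSpace_neg_one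
    {P : EuclideanSpace ℝ (Fin n) →L[ℝ] EuclideanSpace ℝ (Fin n)} :
    IsTransverseHalfSpace (block n (P, 1)) (phaseSpace n) (pair x (-1)) := by
  refine ⟨{p | p.snd < 1}, isOpen_Iio.preimage (sndL n).continuous, ?_,
    Or.inr ⟨sndL n, fun v => rfl, ⟨pair 0 1, ?_⟩, fun y hy => ?_⟩⟩
  · change (-1 : ℝ) < 1
    norm_num
  · change (1 : ℝ) ≠ 0
    norm_num
  · change y.snd ∈ Icc (-1 : ℝ) 1 ↔ 0 ≤ y.snd - (-1)
    exact ⟨fun h => by linarith [h.1], fun h => ⟨by linarith, le_of_lt hy⟩⟩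

/-- Backward orbits converging to a point of `S⁺` stay in the phase space. -/
lemma unstableSet_phaseSpace (hα : 0 < α) :
    unstableSet (compactified f Λ lamP lamM α r) (phaseSpace n) (pair x 1) =
      unstableSet (compactified f Λ lamP lamM α r) univ (pair x 1) := by
  rw [unstableSet_eq_stableSet_neg, unstableSet_eq_stableSet_neg]
  set F := compactified f Λ lamP lamM α r with hFdef
  ext y
  refine ⟨fun ⟨γ, h, h0, hlim⟩ => ⟨γ, h.mono subset_rfl (subset_univ _), h0, hlim⟩,
    fun ⟨γ, h, h0, hlim⟩ => ⟨γ, fun t ht => ⟨?_, (h t ht).2⟩, h0, hlim⟩⟩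
  have hsnd : Tendsto (fun t => (γ t).snd) atTop (𝓝 1) :=
    ((sndL n).continuous.tendsto (pair x 1)).comp hlim
  obtain ⟨T, hT⟩ := eventually_atTop.1 (hsnd.eventually (lt_mem_nhds (zero_lt_one' ℝ)))
  set S := max (max T t) 0 with hS
  have hTS : T ≤ S := (le_max_left _ _).trans (le_max_left _ _)
  have htS : t ≤ S := (le_max_right _ _).trans (le_max_left _ _)
  have hS0 : 0 ≤ S := le_max_right _ _
  -- In reversed time (1-s)² is nondecreasing once s > 0, yet tends to 0; so it vanishes and the
  -- orbit lies in S⁺ from then on. The square allows for s > 1.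
  have hd : ∀ s, S < s → HasDerivAt (fun s => (1 - (γ s).snd) ^ 2)
      (α * (1 + (γ s).snd) * (1 - (γ s).snd) ^ 2) s := by
    intro s hs
    have h1 := (hasDerivWithinAt_snd h s (hS0.trans hs.le)).hasDerivAt
      (Ici_mem_nhds (hS0.trans_lt hs))
    refine ((h1.const_sub 1).pow 2).congr_deriv ?_
    change _ * (1 - (γ s).snd) ^ _ * -(-(α * (1 - (γ s).snd ^ 2) / 2)) = _
    push_cast
    ring
  have hcont : ContinuousOn (fun s => (1 - (γ s).snd) ^ 2) (Ici S) := by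
    have h1 : ContinuousOn (fun s => (γ s).snd) (Ici S) := fun s hs =>
      ((hasDerivWithinAt_snd h s (hS0.trans hs)).continuousWithinAt).mono
        (Ici_subset_Ici.2 hS0)
    exact (continuousOn_const.sub h1).pow 2
  have hmono : MonotoneOn (fun s => (1 - (γ s).snd) ^ 2) (Ici S) := by
    refine monotoneOn_of_deriv_nonneg (convex_Ici S) hcont ?_ ?_
    · rw [interior_Ici]
      exact fun s hs => (hd s hs).differentiableAt.differentiableWithinAt
    · rw [interior_Ici]
      intro s hs
      rw [(hd s hs).deriv]
      have := hT s (hTS.trans (le_of_lt hs))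
      positivity
  have hle : (1 - (γ S).snd) ^ 2 ≤ 0 := by
    have h1 : Tendsto (fun s => (1 - (γ s).snd) ^ 2) atTop (𝓝 ((1 - 1) ^ 2)) :=
      (hsnd.const_sub 1).pow 2
    rw [sub_self, zero_pow two_ne_zero] at h1
    exact ge_of_tendsto h1 ((eventually_ge_atTop S).mono fun s hs => hmono self_mem_Ici hs hs)
  have hone : (γ S).snd = 1 := by
    have := pow_eq_zero_iff two_ne_zero |>.1 (le_antisymm hle (sq_nonneg _))
    linarith
  have hSX : γ S ∈ phaseSpace n := by
    change (γ S).snd ∈ Icc (-1 : ℝ) 1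
    rw [hone]; norm_num
  have hinv := isInvariant_phaseSpace (f := f) (Λ := Λ) (lamP := lamP) (lamM := lamM) (α := α)
    (r := r)
  have h2 := hinv.neg (fun s => γ (s + t)) (S - t) (by linarith)
    ((h.comp_add ht).mono Icc_subset_Ici_self subset_rfl)
  simp only [zero_add, sub_add_cancel] at h2
  exact h2.2 hSX

end Compactified

lemma IsDichotomy.of_hasFDerivAt {V : Type*} [NormedAddCommGroup V] [NormedSpace ℝ V]
    {F : V → V} {F' P : V →L[ℝ] V} {p : V} (h : IsDichotomy F' P) (hF : HasFDerivAt F F' p) :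
    IsDichotomy (fderiv ℝ F p) P := by
  rwa [hF.fderiv]

/-! ### The three kinds of equilibria -/

section Compactified

variable {n d : ℕ}
  {f : EuclideanSpace ℝ (Fin n) × EuclideanSpace ℝ (Fin d) → EuclideanSpace ℝ (Fin n)}
  {Λ : ℝ → EuclideanSpace ℝ (Fin d)} {lamP lamM : EuclideanSpace ℝ (Fin d)} {α r : ℝ}
  {x : EuclideanSpace ℝ (Fin n)}

lemma inputOfS_one : inputOfS Λ lamP lamM α 1 = lamP := by
  rw [inputOfS, if_neg (by norm_num), if_pos le_rfl]

lemma inputOfS_neg_one : inputOfS Λ lamP lamM α (-1) = lamM := by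
  rw [inputOfS, if_pos le_rfl]

lemma finrank_ext (n : ℕ) : Module.finrank ℝ (Ext n) = n + 1 := by
  rw [(extEquiv n).toLinearEquiv.finrank_eq, Module.finrank_prod, finrank_euclideanSpace_fin,
    Module.finrank_self]

lemma contDiff_frozen (hf : ContDiff ℝ 1 f) (lam : EuclideanSpace ℝ (Fin d)) :
    ContDiff ℝ 1 (frozen f lam) :=
  hf.comp (contDiff_id.prodMk contDiff_const)

lemma finrank_range_one_real : Module.finrank ℝ ((1 : ℝ →L[ℝ] ℝ) : ℝ →ₗ[ℝ] ℝ).range = 1 := by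
  have h : ((1 : ℝ →L[ℝ] ℝ) : ℝ →ₗ[ℝ] ℝ).range = ⊤ := LinearMap.range_id
  rw [h, finrank_top, Module.finrank_self]

lemma one_sub_block (P : EuclideanSpace ℝ (Fin n) →L[ℝ] EuclideanSpace ℝ (Fin n)) (Q : ℝ →L[ℝ] ℝ) :
    1 - block n (P, Q) = block n (1 - P, 1 - Q) := by
  rw [← map_one (block n), ← map_sub]
  rfl

lemma isHyperbolicSink_compactified (hf : ContDiff ℝ 1 f) (hr : 0 < r) (hα : 0 < α)
    (hin : HasDerivAt (inputOfS Λ lamP lamM α) 0 1) (hx : IsHyperbolicSink (frozen f lamP) univ x) :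
    IsHyperbolicSink (compactified f Λ lamP lamM α r) (phaseSpace n) (pair x 1) where
  toIsHyperbolicEquilibrium := isHyperbolicEquilibrium_compactified hf hr hα inputOfS_one hin
    (by norm_num) (by norm_num) hx.toIsHyperbolicEquilibrium
  stable := by
    intro z hz
    rcases (mem_complexEigenvalues_compactified hf hr inputOfS_one hin (by norm_num)).1 hz with
      ⟨w, hw, rfl⟩ | rfl
    · rw [Complex.re_ofReal_mul]
      exact mul_neg_of_pos_of_neg (inv_pos.2 hr) (hx.stable w hw)
    · rw [Complex.ofReal_re]
      linarith

lemma hasEigenvector_compactified (hf : ContDiff ℝ 1 f) {lam : EuclideanSpace ℝ (Fin d)} {σ κ : ℝ}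
    (hσ : inputOfS Λ lamP lamM α σ = lam) (hin : HasDerivAt (inputOfS Λ lamP lamM α) 0 σ)
    (hσI : σ ∈ Icc (-1 : ℝ) 1) (hκ : -(α * σ) = κ) :
    (jacobian (compactified f Λ lamP lamM α r) (phaseSpace n) (pair x σ)).HasEigenvector κ
      (pair 0 1) := by
  rw [jacobian_compactified hf hσ hin hσI, hκ]
  exact hasEigenvector_block _ _

/-- The stable projection is that of the limit system enlarged by the s-axis: its rank rises by one
with the dimension of the space, and the unstable line stays in the x-directions. The unstable set
needs no boundary, since its orbits converging backwards to S⁺ are the same in the slab and in the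
whole space. -/
lemma edgeState_compactified (hf : ContDiff ℝ 1 f) (hr : 0 < r) (hα : 0 < α)
    (hin : ContDiff ℝ 1 (inputOfS Λ lamP lamM α))
    (hin1 : HasDerivAt (inputOfS Λ lamP lamM α) 0 1)
    (hx : IsEquilibriumRegularEdgeState (frozen f lamP) x) :
    IsHyperbolicSaddle (compactified f Λ lamP lamM α r) (phaseSpace n) (pair x 1) ∧
      IsImmersedHypersurface (phaseSpace n)
        (stableSet (compactified f Λ lamP lamM α r) (phaseSpace n) (pair x 1)) ∧
      (∃ U : Set (Ext n), IsOpen U ∧ pair x 1 ∈ U ∧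
        IsEmbeddedOrientableHypersurface (phaseSpace n)
          (localStableSet (compactified f Λ lamP lamM α r) (phaseSpace n) U (pair x 1)) ∧
        localStableSet (compactified f Λ lamP lamM α r) (phaseSpace n) U (pair x 1) ⊆
          stableSet (compactified f Λ lamP lamM α r) (phaseSpace n) (pair x 1)) ∧
      IsImmersedSubmanifold Set.univ
        (unstableSet (compactified f Λ lamP lamM α r) (phaseSpace n) (pair x 1)) 1 := by
  obtain ⟨P, hP, hP1, hP2, z, hz, hz0⟩ := hx.exists_isDichotomy (contDiff_frozen hf lamP)
  have hF : ContDiff ℝ 1 (compactified f Λ lamP lamM α r) := contDiff_compactified hf hin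
  have hp : compactified f Λ lamP lamM α r (pair x 1) = 0 :=
    compactified_eq_zero inputOfS_one (by norm_num) hx.1.equilibrium
  have hX := isInvariant_phaseSpace (f := f) (Λ := Λ) (lamP := lamP) (lamM := lamM) (α := α)
    (r := r)
  have hmem := fun z => mem_complexEigenvalues_compactified (x := x) (z := z) hf hr
    (inputOfS_one (Λ := Λ) (lamP := lamP) (lamM := lamM) (α := α)) hin1 (by norm_num)
  have hQ : IsDichotomy (fderiv ℝ (compactified f Λ lamP lamM α r) (pair x 1))
      (block n (P, 1)) := by
    refine IsDichotomy.of_hasFDerivAt ?_ (hasFDerivAt_compactified hf inputOfS_one hin1)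
    rw [mul_one]
    exact isDichotomy_block (hP.smul (inv_pos.2 hr)) (isDichotomy_neg_smul_one hα)
  have hrank : Module.finrank ℝ (block n (P, 1) : Ext n →ₗ[ℝ] Ext n).range + 1 =
      Module.finrank ℝ (Ext n) := by
    rw [finrank_range_block, finrank_range_one_real, hP1, finrank_euclideanSpace_fin, finrank_ext]
  have hne : block n (P, 1) ≠ 1 := by
    intro h
    rw [h] at hrank
    have h1 : ((1 : Ext n →L[ℝ] Ext n) : Ext n →ₗ[ℝ] Ext n).range = ⊤ := LinearMap.range_id
    rw [h1, finrank_top] at hrank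
    omega
  have hurank : Module.finrank ℝ ((1 - block n (P, 1) : Ext n →L[ℝ] Ext n) :
      Ext n →ₗ[ℝ] Ext n).range = 1 := by
    have h0 : ((0 : ℝ →L[ℝ] ℝ) : ℝ →ₗ[ℝ] ℝ).range = ⊥ := LinearMap.range_zero
    rw [one_sub_block, finrank_range_block, hP2, sub_self, h0, finrank_bot]
  obtain ⟨δ, hδ, hemb, hor⟩ := exists_localStableSet_isEmbeddedSubmanifold hF hp hQ hX
    isTransverseHalfSpace_one
  refine ⟨⟨isHyperbolicEquilibrium_compactified hf hr hα inputOfS_one hin1 (by norm_num)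
    (by norm_num) hx.1, ⟨_, (hmem _).2 (Or.inr rfl), ?_⟩,
    ⟨_, (hmem _).2 (Or.inl ⟨z, hz, rfl⟩), ?_⟩⟩,
    ⟨_, hrank, isImmersedSubmanifold_stableSet hF hX hδ hemb⟩,
    ⟨Metric.ball (pair x 1) δ, Metric.isOpen_ball, Metric.mem_ball_self hδ,
      ⟨⟨_, hrank, hemb⟩, hor hne⟩, fun y ⟨γ, h1, h2, _, h3⟩ => ⟨γ, h1, h2, h3⟩⟩, ?_⟩
  · rw [Complex.ofReal_re]
    linarith
  · rw [Complex.re_ofReal_mul]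
    exact mul_pos (inv_pos.2 hr) hz0
  · rw [unstableSet_phaseSpace hα, ← hurank]
    exact isImmersedSubmanifold_unstableSet hF hp hQ (isInvariant_univ _)
      (isTransverseHalfSpace_univ _ _)

/-- Positive dimension is what supplies the stable eigenvalue of the saddle on S⁻. -/
lemma exists_mem_complexEigenvalues (hn : 0 < n) (A : Module.End ℝ (EuclideanSpace ℝ (Fin n))) :
    ∃ z, z ∈ complexEigenvalues A := by
  have hdeg : (A.charpoly.map (algebraMap ℝ ℂ)).degree ≠ 0 := by
    rw [Polynomial.degree_map, Polynomial.degree_eq_natDegree A.charpoly_monic.ne_zero,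
      LinearMap.charpoly_natDegree, finrank_euclideanSpace_fin]
    exact_mod_cast hn.ne'
  obtain ⟨z, hz⟩ := IsAlgClosed.exists_root _ hdeg
  exact ⟨z, (Polynomial.mem_roots ((A.charpoly_monic.map _).ne_zero)).2 hz⟩

/-- All x-directions contract and only the s-axis expands, so the unstable projection is onto the
s-axis. It points into the slab, and the unstable manifold is a curve with boundary on S⁻. -/
lemma pastSink_compactified (hn : 0 < n) (hf : ContDiff ℝ 1 f) (hr : 0 < r) (hα : 0 < α)
    (hin : ContDiff ℝ 1 (inputOfS Λ lamP lamM α))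
    (hin1 : HasDerivAt (inputOfS Λ lamP lamM α) 0 (-1))
    (hx : IsHyperbolicSink (frozen f lamM) univ x) :
    IsHyperbolicSaddle (compactified f Λ lamP lamM α r) (phaseSpace n) (pair x (-1)) ∧
      IsImmersedSubmanifold (phaseSpace n)
        (unstableSet (compactified f Λ lamP lamM α r) (phaseSpace n) (pair x (-1))) 1 := by
  have hP : IsDichotomy (fderiv ℝ (frozen f lamM) x) 1 := by
    refine isDichotomy_one _ fun z hz => hx.stable z ?_
    rwa [jacobian_univ, mem_complexEigenvalues]
  have hF : ContDiff ℝ 1 (compactified f Λ lamP lamM α r) := contDiff_compactified hf hin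
  have hp : compactified f Λ lamP lamM α r (pair x (-1)) = 0 :=
    compactified_eq_zero inputOfS_neg_one (by norm_num) hx.equilibrium
  have hX := isInvariant_phaseSpace (f := f) (Λ := Λ) (lamP := lamP) (lamM := lamM) (α := α)
    (r := r)
  have hmem := fun z => mem_complexEigenvalues_compactified (x := x) (z := z) hf hr
    (inputOfS_neg_one (Λ := Λ) (lamP := lamP) (lamM := lamM) (α := α)) hin1 (by norm_num)
  have hQ : IsDichotomy (fderiv ℝ (compactified f Λ lamP lamM α r) (pair x (-1)))
      (block n (1, 0)) := by
    refine IsDichotomy.of_hasFDerivAt ?_ (hasFDerivAt_compactified hf inputOfS_neg_one hin1)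
    rw [mul_neg_one, neg_neg]
    exact isDichotomy_block (hP.smul (inv_pos.2 hr)) (isDichotomy_smul_one hα)
  have hsub : 1 - block n (1, 0) = block n (0, 1) := by
    rw [one_sub_block, sub_self, sub_zero]
  have hurank : Module.finrank ℝ ((1 - block n (1, 0) : Ext n →L[ℝ] Ext n) :
      Ext n →ₗ[ℝ] Ext n).range = 1 := by
    have h0 : ((0 : EuclideanSpace ℝ (Fin n) →L[ℝ] EuclideanSpace ℝ (Fin n)) :
      EuclideanSpace ℝ (Fin n) →ₗ[ℝ] EuclideanSpace ℝ (Fin n)).range = ⊥ := LinearMap.range_zero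
    rw [hsub, finrank_range_block, finrank_range_one_real, h0, finrank_bot]
  obtain ⟨z, hz⟩ := exists_mem_complexEigenvalues hn (jacobian (frozen f lamM) univ x)
  refine ⟨⟨isHyperbolicEquilibrium_compactified hf hr hα inputOfS_neg_one hin1 (by norm_num)
    (by norm_num) hx.toIsHyperbolicEquilibrium, ⟨_, (hmem _).2 (Or.inl ⟨z, hz, rfl⟩), ?_⟩,
    ⟨_, (hmem _).2 (Or.inr rfl), ?_⟩⟩, ?_⟩
  · rw [Complex.re_ofReal_mul]
    exact mul_neg_of_pos_of_neg (inv_pos.2 hr) (hx.stable z hz)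
  · rw [Complex.ofReal_re]
    linarith
  · rw [← hurank]
    refine isImmersedSubmanifold_unstableSet hF hp hQ hX ?_
    rw [hsub]
    exact isTransverseHalfSpace_neg_one

end Compactified

end RTip

end

/-! ### The main theorem -/

theorem mainTheorem7 {n d : ℕ} (hn : 0 < n)
    (f : EuclideanSpace ℝ (Fin n) × EuclideanSpace ℝ (Fin d) → EuclideanSpace ℝ (Fin n))
    (hf : ContDiff ℝ 1 f)
    (Λ : ℝ → EuclideanSpace ℝ (Fin d)) (hΛ : ContDiff ℝ 1 Λ)
    (lamP lamM : EuclideanSpace ℝ (Fin d))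
    (hP : Filter.Tendsto Λ Filter.atTop (nhds lamP))
    (hM : Filter.Tendsto Λ Filter.atBot (nhds lamM))
    (ρ : ℝ) (hρ : IsExpBiAsymptoticallyConstant Λ ρ)
    (α : ℝ) (hα : 0 < α) (hαρ : α < ρ) (r : ℝ) (hr : 0 < r) :
    -- (a) sinks of the future limit system
    (∀ eP, IsHyperbolicSink (frozen f lamP) Set.univ eP →
      IsHyperbolicSink (compactified f Λ lamP lamM α r) (phaseSpace n) (pair eP 1) ∧
      ∃ v : Ext n,
        (jacobian (compactified f Λ lamP lamM α r) (phaseSpace n)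
          (pair eP 1)).HasEigenvector (-α) v ∧
        IsNormalTo v (slice n 1) ∧
        ∀ l₁ : ℂ, IsLeadingEigenvalue (jacobian (frozen f lamP) Set.univ eP) l₁ →
          α < -l₁.re / r →
          IsLeadingEigenvector
            (jacobian (compactified f Λ lamP lamM α r) (phaseSpace n) (pair eP 1)) v) ∧
    -- (b) equilibrium regular edge states of the future limit system
    (∀ ηP, IsEquilibriumRegularEdgeState (frozen f lamP) ηP →
      IsHyperbolicSaddle (compactified f Λ lamP lamM α r) (phaseSpace n) (pair ηP 1) ∧
      IsImmersedHypersurface (phaseSpace n)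
        (stableSet (compactified f Λ lamP lamM α r) (phaseSpace n) (pair ηP 1)) ∧
      (∃ U : Set (Ext n), IsOpen U ∧ pair ηP 1 ∈ U ∧
        IsEmbeddedOrientableHypersurface (phaseSpace n)
          (localStableSet (compactified f Λ lamP lamM α r) (phaseSpace n) U (pair ηP 1)) ∧
        localStableSet (compactified f Λ lamP lamM α r) (phaseSpace n) U (pair ηP 1) ⊆
          stableSet (compactified f Λ lamP lamM α r) (phaseSpace n) (pair ηP 1)) ∧
      IsImmersedSubmanifold Set.univ
        (unstableSet (compactified f Λ lamP lamM α r) (phaseSpace n) (pair ηP 1)) 1 ∧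
      ∃ v : Ext n,
        (jacobian (compactified f Λ lamP lamM α r) (phaseSpace n)
          (pair ηP 1)).HasEigenvector (-α) v ∧
        IsNormalTo v (slice n 1)) ∧
    -- (c) sinks of the past limit system
    (∀ eM, IsHyperbolicSink (frozen f lamM) Set.univ eM →
      IsHyperbolicSaddle (compactified f Λ lamP lamM α r) (phaseSpace n) (pair eM (-1)) ∧
      IsImmersedSubmanifold (phaseSpace n)
        (unstableSet (compactified f Λ lamP lamM α r) (phaseSpace n) (pair eM (-1))) 1 ∧
      ∃ v : Ext n,
        (jacobian (compactified f Λ lamP lamM α r) (phaseSpace n)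
          (pair eM (-1))).HasEigenvector α v ∧
        IsNormalTo v (slice n (-1))) := by
  obtain ⟨hin, hin1, hin2⟩ := contDiff_inputOfS hα hαρ hΛ hP hM hρ
  refine ⟨fun eP he => ⟨isHyperbolicSink_compactified hf hr hα hin1 he, pair 0 1,
    hasEigenvector_compactified hf inputOfS_one hin1 (by norm_num) (by rw [mul_one]),
    isNormalTo_slice 1, fun l₁ hl hlα =>
      isLeadingEigenvector_compactified hf hr inputOfS_one hin1 hl hlα⟩, fun ηP hη => ?_,
    fun eM he => ?_⟩
  · obtain ⟨h1, h2, h3, h4⟩ := edgeState_compactified hf hr hα hin hin1 hη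
    exact ⟨h1, h2, h3, h4, pair 0 1,
      hasEigenvector_compactified hf inputOfS_one hin1 (by norm_num) (by rw [mul_one]),
      isNormalTo_slice 1⟩
  · obtain ⟨h1, h2⟩ := pastSink_compactified hn hf hr hα hin hin2 he
    exact ⟨h1, h2, pair 0 1, hasEigenvector_compactified hf inputOfS_neg_one hin2 (by norm_num)
      (by rw [mul_neg_one, neg_neg]), isNormalTo_slice (-1)⟩
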